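/- Let $k$ be a perfect field of characteristic $p\ge 0$. An algebraic $k$-scheme is a Noetherian separated $k$-scheme all of whose local rings are essentially of finite type over $k$. Let $f:Y\to X$ be a nonsingular model, i.e. a proper, generically finite $k$-morphism of integral algebraic $k$-schemes with regular local rings, such that $K(Y)/K(X)$ is finite separable and $\dim X=\mathrm{tr.deg}_k K(X)=2$. Points $\alpha,\beta$ below are points of $X$, $Y$ with two-dimensional local ring (the closed points, when $X$ is of finite type over $k$); "r.s.p." means regular system of parameters. Let $C_f$ be the divisor on $Y$ defined by the Jacobian determinant of $f$, and write $C_f=R_f+S_f$, where $R_f$ is carried by the curves which $f$ maps onto curves and $S_f$ by the curves which $f$ contracts to points. Put $B_f=f(R_f)_{\rm red}$, and assume that $B_f$ and $f^*B_f$ are divisors with strict normal crossings (multiplicities allowed: locally the divisor of a monomial $x^ay^b$ in some r.s.p. $(x,y)$). An r.s.p. $(u,v)$ of $\mathcal O_{X,\alpha}$ is admissible if $\alpha\notin B_f$, or if $B_f$ is defined at $\alpha$ by $u=0$ or by $uv=0$. We say that $f$ is monomial at $\beta$ if there are an admissible r.s.p. $(u,v)$ at $\alpha=f(\beta)$ and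 an r.s.p. $(x,y)$ of $\mathcal O_{Y,\beta}$ with either (1) $u=\gamma x^ay^b,\ v=\delta x^cy^d$, where $\gamma\delta$ is a unit of $\mathcal O_{Y,\beta}$ and $p\nmid ad-bc$ (if $p=0$: $ad-bc\ne 0$), or (2) $u=\gamma x^a,\ v=\delta x^c$, where $\gamma\delta$ and $a\gamma\,\partial\delta/\partial y-c\delta\,\partial\gamma/\partial y$ are units of $\mathcal O_{Y,\beta}$. The model $f$ is monomial if it is monomial at every $\beta$. For a component $E$ of $S_f$ let $i_E=\nu_E(S_f)+1-\max\nu_E(uv)$, the maximum being over all admissible r.s.p. $(u,v)$ at $f(E)$; for $\beta\in\mathrm{Supp}(S_f)$ let $i_\beta=\max_E i_E$ over the components $E$ of $S_f$ through $\beta$. Then for every $\beta$, $f$ is monomial at $\beta$ if and only if (i) for every irreducible component $D$ of $R_f$ through $\beta$, with $\Delta=f(D)$, the extension of discrete valuation rings $\mathcal O_{Y,D}/\mathcal O_{X,\Delta}$ is tamely ramified (i.e. $p=0$, or $p$ does not divide the ramification index and the residue field extension is separable); and (ii) $i_\beta=0$ if $\beta\in\mathrm{Supp}(S_f)$. In particular,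 $f$ is a monomial model if and only if (i) and (ii) hold at every $\beta$; and if every closed point of $X$ has a two-dimensional local ring (as when $X$ is of finite type over $k$), $f$ is a monomial model if and only if $\mathcal O_{Y,D}/\mathcal O_{X,\Delta}$ is tamely ramified for all components $D$ of $R_f$ and $i_\beta=0$ for all $\beta\in\mathrm{Supp}(S_f)$. -/

import Mathlib

open AlgebraicGeometry CategoryTheory IsLocalRing TopologicalSpace

universe u

noncomputable section

namespace MonomialModel

section LocalAlgebra

/-- `(x, y)` is a regular system of parameters of the two-dimensional regular local ring `R`. -/
structure IsRSP (R : Type u) [CommRing R] (x y : R) : Prop where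
  regular : IsRegularLocalRing R
  dim_eq_two : ringKrullDim R = 2
  span_eq : ∃ _ : IsLocalRing R, Ideal.span {x, y} = maximalIdeal R

/-- Order of an ideal of a local ring along the maximal ideal: the largest `n` with `I ≤ 𝔪 ^ n`.
For a nonzero ideal of a discrete valuation ring this is the valuation of a generator. -/
def idealOrder (R : Type u) [CommRing R] [IsLocalRing R] (I : Ideal R) : ℕ :=
  sSup {n : ℕ | I ≤ maximalIdeal R ^ n}

/-- The ideal is, at a two-dimensional regular local ring, the ideal of a divisor with strict normal
crossings (multiplicities allowed): it is generated by a monomial in some regular system of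
parameters. -/
def IsSNCIdeal {R : Type u} [CommRing R] (I : Ideal R) : Prop :=
  ∃ x y : R, IsRSP R x y ∧ ∃ a b : ℕ, I = Ideal.span {x ^ a * y ^ b}

/-- The Jacobian ideal of a homomorphism `φ : R → S` of local rings of smooth surfaces over `k`,
generated by all Jacobian determinants `det (Dᵢ (φ uⱼ))` with `u₁, u₂ ∈ R` and
`D₁, D₂` in the module of `k`-derivations of `S`. As `Ω_{R/k}` and `Ω_{S/k}` are free of rank two,
it is generated by the Jacobian determinant of `φ` with respect to any local parameters. -/
def jacobianIdeal (k : Type u) [Field k] {R S : Type u} [CommRing R] [CommRing S] [Algebra k S]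
    (φ : R →+* S) : Ideal S :=
  Ideal.span {j : S | ∃ (D₁ D₂ : Derivation k S S) (u₁ u₂ : R),
    j = D₁ (φ u₁) * D₂ (φ u₂) - D₁ (φ u₂) * D₂ (φ u₁)}

/-- Tame ramification of an extension `φ : W → V` of discrete valuation rings over `k`: either
`char k = 0`, or `char k` does not divide the ramification index (the order of `𝔪_W V` in `V`) and
the residue field extension is separable. -/
def IsTame (k : Type u) [Field k] {W V : Type u} [CommRing W] [CommRing V] [IsLocalRing W]
    [IsLocalRing V] (φ : W →+* V) [IsLocalHom φ] : Prop :=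
  ringChar k = 0 ∨
    (¬ ringChar k ∣ idealOrder V ((maximalIdeal W).map φ) ∧
      letI : Algebra (ResidueField W) (ResidueField V) := (ResidueField.map φ).toAlgebra
      Algebra.IsSeparable (ResidueField W) (ResidueField V))

/-- First monomial form: `u = γ x^a y^b`, `v = δ x^c y^d` with `γδ` a unit and `char k ∤ ad - bc`. -/
def FormOne (k : Type u) [Field k] {S : Type u} [CommRing S] (u v x y : S) : Prop :=
  ∃ (γ δ : S) (a b c d : ℕ), u = γ * (x ^ a * y ^ b) ∧ v = δ * (x ^ c * y ^ d) ∧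
    IsUnit (γ * δ) ∧ ¬ ((ringChar k : ℤ) ∣ (a : ℤ) * d - (b : ℤ) * c)

/-- Second monomial form: `u = γ x^a`, `v = δ x^c` with `γδ` and `aγ ∂δ/∂y - cδ ∂γ/∂y` units. Here
`∂/∂y` is the `k`-derivation of `S` with `∂x/∂y = 0`, `∂y/∂y = 1`, which is unique when `x, y` are
regular parameters of a local ring of a smooth surface. -/
def FormTwo (k : Type u) [Field k] {S : Type u} [CommRing S] [Algebra k S] (u v x y : S) : Prop :=
  ∃ (γ δ : S) (a c : ℕ), u = γ * x ^ a ∧ v = δ * x ^ c ∧ IsUnit (γ * δ) ∧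
    ∃ dy : Derivation k S S, dy x = 0 ∧ dy y = 1 ∧
      IsUnit ((a : S) * γ * dy δ - (c : S) * δ * dy γ)

end LocalAlgebra

section Schemes

variable {k : Type u} [Field k] {X Y : Scheme.{u}}

/-- The `k`-algebra structure on the local ring of a `k`-scheme at a point. -/
abbrev stalkAlgebra (s : X ⟶ Spec (CommRingCat.of k)) (x : X) : Algebra k (X.presheaf.stalk x) :=
  ((Scheme.ΓSpecIso (CommRingCat.of k)).inv ≫ s.appTop ≫
    X.presheaf.germ ⊤ x trivial).hom.toAlgebra

/-- Algebraic `k`-schemes: Noetherian separated `k`-schemes all of whose local rings are essentially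
of finite type over `k`. -/
structure IsAlgebraicScheme (s : X ⟶ Spec (CommRingCat.of k)) : Prop where
  noetherian : IsNoetherian X
  separated : IsSeparated s
  essFiniteType : ∀ x : X, letI := stalkAlgebra s x; Algebra.EssFiniteType k (X.presheaf.stalk x)

/-- `X` is nonsingular: all its local rings are regular. -/
def IsNonsingular (X : Scheme.{u}) : Prop := ∀ x : X, IsRegularLocalRing (X.presheaf.stalk x)

/-- `x` is a point of the surface in the classical sense, i.e. a point of codimension two. -/
def IsSurfacePoint (x : X) : Prop := ringKrullDim (X.presheaf.stalk x) = 2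

/-- `f : Y ⟶ X` is a model of the finite separable extension `K(Y) / K(X)` of two-dimensional
function fields over `k`: a proper, generically finite morphism of integral algebraic `k`-schemes
with `dim X = trdeg_k K(X) = 2`. -/
structure IsModel [IsIntegral X] [IsIntegral Y] (sX : X ⟶ Spec (CommRingCat.of k))
    (sY : Y ⟶ Spec (CommRingCat.of k)) (f : Y ⟶ X) : Prop where
  comp_eq : f ≫ sX = sY
  algebraic_target : IsAlgebraicScheme sX
  algebraic_source : IsAlgebraicScheme sY
  proper : IsProper f
  map_genericPoint : f (genericPoint Y) = genericPoint X
  finite : (f.stalkMap (genericPoint Y)).hom.Finite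
  separable :
    letI := (f.stalkMap (genericPoint Y)).hom.toAlgebra
    Algebra.IsSeparable (X.presheaf.stalk (f (genericPoint Y))) (Y.presheaf.stalk (genericPoint Y))
  dim_eq_two : topologicalKrullDim X = 2
  trdeg_eq_two :
    letI := stalkAlgebra sX (genericPoint X)
    Algebra.trdeg k (X.presheaf.stalk (genericPoint X)) = 2

/-- The order of the critical divisor `C_f` (given by the vanishing of the Jacobian determinant)
at the point `y`; used at points of codimension one. -/
def criticalOrder (sY : Y ⟶ Spec (CommRingCat.of k)) (f : Y ⟶ X) (y : Y) : ℕ :=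
  letI := stalkAlgebra sY y
  idealOrder (Y.presheaf.stalk y) (jacobianIdeal k (f.stalkMap y).hom)

open Classical in
/-- The divisor `R_f`, as a function giving the multiplicity at (the generic point of) each prime
divisor: the part of `C_f` carried by curves which `f` maps onto curves. -/
def divR (sY : Y ⟶ Spec (CommRingCat.of k)) (f : Y ⟶ X) (η : Y) : ℕ :=
  if ringKrullDim (Y.presheaf.stalk η) = 1 ∧ ringKrullDim (X.presheaf.stalk (f η)) = 1 then
    criticalOrder sY f η else 0

open Classical in
/-- The divisor `S_f`: the part of `C_f` carried by curves which `f` contracts to points. -/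
def divS (sY : Y ⟶ Spec (CommRingCat.of k)) (f : Y ⟶ X) (η : Y) : ℕ :=
  if ringKrullDim (Y.presheaf.stalk η) = 1 ∧ IsSurfacePoint (f η) then
    criticalOrder sY f η else 0

/-- The (generic point `η` of the) prime divisor is a component of the divisor `D`. -/
def IsComponent (D : Y → ℕ) (η : Y) : Prop := D η ≠ 0

/-- The support of an effective divisor: the union of its components. A point `y` lies on the
component with generic point `η` iff `η ⤳ y`. -/
def supp (D : Y → ℕ) : Set Y := {y | ∃ η, IsComponent D η ∧ η ⤳ y}

/-- The (support of the) reduced divisor `B_f = f(R_f)_red`. -/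
def branchLocus (sY : Y ⟶ Spec (CommRingCat.of k)) (f : Y ⟶ X) : Set X := f '' supp (divR sY f)

/-- The ideal, in the local ring at `x`, of the closed subset `Z` with its reduced structure: germs
whose image vanishes at each generization of `x` that lies in `Z`. -/
def idealAt (Z : Set X) (x : X) : Ideal (X.presheaf.stalk x) :=
  ⨅ (z : X) (_ : z ∈ Z) (h : z ⤳ x),
    (maximalIdeal (X.presheaf.stalk z)).comap (X.presheaf.stalkSpecializes h).hom

/-- `B_f` is a divisor with strict normal crossings on `X`. -/
def BranchSNC (sY : Y ⟶ Spec (CommRingCat.of k)) (f : Y ⟶ X) : Prop :=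
  ∀ α : X, IsSurfacePoint α → IsSNCIdeal (idealAt (branchLocus sY f) α)

/-- The pulled back divisor `f^* B_f` is a divisor with strict normal crossings on `Y`. -/
def PullbackBranchSNC (sY : Y ⟶ Spec (CommRingCat.of k)) (f : Y ⟶ X) : Prop :=
  ∀ β : Y, IsSurfacePoint β →
    IsSNCIdeal ((idealAt (branchLocus sY f) (f β)).map (f.stalkMap β).hom)

/-- `(u, v)` is an admissible regular system of parameters at `α`. -/
def IsAdmissible (sY : Y ⟶ Spec (CommRingCat.of k)) (f : Y ⟶ X) (α : X)
    (u v : X.presheaf.stalk α) : Prop :=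
  IsRSP (X.presheaf.stalk α) u v ∧
    (α ∈ branchLocus sY f →
      idealAt (branchLocus sY f) α = Ideal.span {u} ∨
      idealAt (branchLocus sY f) α = Ideal.span {u * v})

/-- `f` is monomial at `β` with respect to some admissible regular system of parameters at `f β`. -/
def IsMonomialAt (sY : Y ⟶ Spec (CommRingCat.of k)) (f : Y ⟶ X) (β : Y) : Prop :=
  letI := stalkAlgebra sY β
  ∃ u v : X.presheaf.stalk (f β), IsAdmissible sY f (f β) u v ∧
    ∃ x y : Y.presheaf.stalk β, IsRSP (Y.presheaf.stalk β) x y ∧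
      (FormOne k ((f.stalkMap β).hom u) ((f.stalkMap β).hom v) x y ∨
        FormTwo k ((f.stalkMap β).hom u) ((f.stalkMap β).hom v) x y)

/-- `f` is a monomial model. -/
def IsMonomial (sY : Y ⟶ Spec (CommRingCat.of k)) (f : Y ⟶ X) : Prop :=
  ∀ β : Y, IsSurfacePoint β → IsMonomialAt sY f β

/-- The complexity `i_E = ν_E(S_f) + 1 - max ν_E(uv)` of the component `E` of `S_f` with generic
point `η`, the maximum being over all admissible regular systems of parameters at `f(E) = f η`. -/
def complexity (sY : Y ⟶ Spec (CommRingCat.of k)) (f : Y ⟶ X) (η : Y) : ℤ :=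
  (divS sY f η : ℤ) + 1 -
    (sSup {n : ℕ | ∃ u v : X.presheaf.stalk (f η), IsAdmissible sY f (f η) u v ∧
      n = idealOrder (Y.presheaf.stalk η) (Ideal.span {(f.stalkMap η).hom (u * v)})} : ℕ)

/-- The complexity `i_β`: the maximum of the complexities of the components of `S_f` through `β`. -/
def complexityAt (sY : Y ⟶ Spec (CommRingCat.of k)) (f : Y ⟶ X) (β : Y) : ℤ :=
  sSup {i : ℤ | ∃ η : Y, IsComponent (divS sY f) η ∧ η ⤳ β ∧ i = complexity sY f η}

end Schemes

end MonomialModel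

end

/-!
Everything is decided in the local homomorphism `φ : R → S` of the two-dimensional regular local
rings at `f β` and `β`. As `k` is perfect, `Ω` of `S` is free on the differentials of any regular
system of parameters, so there is a frame of derivations `d₁, d₂` of `S`, and the critical divisor
is locally the divisor of `J = jac d₁ d₂ (φ u) (φ v)`, which does not depend on the parameters
`u, v` of `R` up to units. Prime divisors through `β` correspond to primes `t` of the factorial
ring `S`.

For every prime `t`, the order of `u v` along `t` is at most the order of `t J`
(`pow_dvd_mul_jac`). Parameters for which equality holds are called optimal along `t`
(`IsOptimal`). Both conditions of the theorem are statements on optimality: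
* the complexity of a contracted curve `t = 0` is nonnegative, and it is zero if and only if some
  admissible pair is optimal along `t` (`IsJacobian.complexity_nonneg_and_eq_zero_iff`);
* a curve `t = 0` dominating a branch curve is tamely ramified if and only if some admissible pair
  is optimal along `t` (`IsFrame.isTame_iff_exists`): if `u` is the equation of the branch curve and
  `u = t ^ a g`, then optimality says that `a` is prime to the characteristic and that the
  restriction of `v` to `t = 0` has nonzero derivative.

Hence it remains to show that `φ` is monomial at `β` if and only if every prime factor `t` of `J`
admits an optimal admissible pair (`IsJacobian.exists_form_iff`). In a monomial form the pair
`u, v` is optimal along all `t` by the logarithmic Jacobian formula. Conversely, one has to find a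
pair that is optimal along all prime factors of `J` at once, and that pair has a monomial form.
* If the branch locus is `u v = 0` at `f β`, all admissible pairs have the same product up to units,
  and the normal crossings of its pullback give the form.
* If it is `u = 0`, any two choices `v, v'` of the second parameter are related by
  `v = e v' + ε u ^ s` with units `e, ε`, or `v = e v'`, while `φ u` is a monomial; so the choices
  made for two primes can be compared.
* If `f β` is not a branch point, all components of the critical divisor through `β` are contracted.
  One chooses `w` such that `φ w` generates the extension of the maximal ideal of `R`, and then the
  most divisible one of the parameters `v` that are optimal, together with `w`, along the individual
  primes. Both choices rest on the fact that for parameters `w, v` of `R` such that `φ w` is a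
  product of two nonunits, one of `φ w ^ s` and `φ v` divides the other
  (`IsRSP.pow_dvd_or_dvd_pow`). To see this, note that the integral closure of `R` in the function
  field of `Y` is unramified over `R` in codimension one, by the valuative criterion of
  properness (`IsModel.isUnramifiedAt`), hence unramified by
  purity, so that the maximal ideal of its localization `T` dominated by `S` is generated by `w, v`.
  If neither `v / w ^ s` nor its inverse is in the normal ring `S`, all polynomials over `S` that
  vanish at `v / w ^ s` have coefficients in the maximal ideal. As every nonzero element of `T` is a
  power of `w` times the value at `v / w ^ s` of a polynomial over `T` with a unit coefficient, and
  elements of `S` are quotients of elements of `T`, this implies that `w` is not a product of two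
  nonunits of `S` (`pow_dvd_or_dvd_pow_of_eq_mul`).
-/

noncomputable section

namespace MonomialModel

/-! ### Two-dimensional regular local rings -/

section RegularLocal

variable {S : Type u} [CommRing S]

theorem IsRSP.isLocalRing {x y : S} (h : IsRSP S x y) : IsLocalRing S :=
  h.regular.toIsLocalRing

theorem IsRSP.isNoetherianRing {x y : S} (h : IsRSP S x y) : IsNoetherianRing S := by
  have := h.regular
  infer_instance

theorem IsRSP.span [IsLocalRing S] {x y : S} (h : IsRSP S x y) :
    Ideal.span {x, y} = maximalIdeal S := h.span_eq.2

theorem IsRSP.symm {x y : S} (h : IsRSP S x y) : IsRSP S y x :=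
  ⟨h.regular, h.dim_eq_two, h.span_eq.1, by rw [Set.pair_comm]; exact h.span_eq.2⟩

theorem IsRSP.of_span [IsLocalRing S] {x y a b : S} (h : IsRSP S x y)
    (hab : Ideal.span {a, b} = maximalIdeal S) : IsRSP S a b :=
  ⟨h.regular, h.dim_eq_two, ‹_›, hab⟩

theorem IsRSP.left_mem [IsLocalRing S] {x y : S} (h : IsRSP S x y) : x ∈ maximalIdeal S := by
  rw [← h.span]; exact Ideal.subset_span (by simp)

theorem IsRSP.right_mem [IsLocalRing S] {x y : S} (h : IsRSP S x y) : y ∈ maximalIdeal S :=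
  h.symm.left_mem

theorem IsRSP.mem_iff [IsLocalRing S] {x y : S} (h : IsRSP S x y) {a : S} :
    a ∈ maximalIdeal S ↔ ∃ p q, p * x + q * y = a := by
  rw [← h.span, Ideal.mem_span_pair]

theorem IsRSP.height_eq [IsLocalRing S] {x y : S} (h : IsRSP S x y) :
    (maximalIdeal S).height = 2 := by
  have := IsLocalRing.maximalIdeal_height_eq_ringKrullDim (R := S)
  rw [h.dim_eq_two] at this
  exact WithBot.coe_injective (this.trans rfl)

/-- Every regular system of parameters consists of two elements of which none generates the maximal
ideal alone. -/
theorem IsRSP.ne_span_singleton [IsLocalRing S] {x y : S} (h : IsRSP S x y) (z : S) :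
    maximalIdeal S ≠ Ideal.span {z} := by
  intro hz
  have := h.isNoetherianRing
  have h1 := Ideal.height_span_singleton_le_one (x := z)
    (by rw [← Ideal.span_singleton_eq_top, ← hz]; exact (maximalIdeal.isMaximal S).ne_top)
  rw [← hz, h.height_eq] at h1
  exact absurd h1 (by decide)

theorem IsRSP.exists_regular_of_isRegularLocalRing [IsRegularLocalRing S]
    (hd : ringKrullDim S = 2) : ∃ x y : S, IsRSP S x y := by
  have h1 : (maximalIdeal S).spanFinrank = 2 := by
    have := IsRegularLocalRing.spanFinrank_maximalIdeal (R := S)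
    rw [hd] at this
    exact_mod_cast this
  have h2 := (Submodule.FG.generators_ncard (maximalIdeal S).fg_of_isNoetherianRing)
  rw [h1, Set.ncard_eq_two] at h2
  obtain ⟨x, y, -, hxy⟩ := h2
  refine ⟨x, y, inferInstance, hd, inferInstance, ?_⟩
  rw [← hxy]
  exact (maximalIdeal S).span_generators

/-- Nakayama's lemma for `P` modulo the multiples of `x`. -/
theorem le_span_singleton_of_le_sup_smul [IsLocalRing S] [IsNoetherianRing S] {P : Ideal S} {x y : S}
    (hy : y ∈ maximalIdeal S) (hle : ∀ p ∈ P, ∃ a, ∃ b ∈ P, p = a * x + b * y) :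
    P ≤ Ideal.span {x} := by
  refine Submodule.le_of_le_smul_of_le_jacobson_bot (I := Ideal.span {y}) (N' := P)
    (IsNoetherian.noetherian P) ?_ ?_
  · rw [IsLocalRing.jacobson_eq_maximalIdeal _ bot_ne_top]
    rwa [Ideal.span_singleton_le_iff_mem]
  · intro p hp
    obtain ⟨a, b, hb, rfl⟩ := hle p hp
    refine Submodule.add_mem_sup (Ideal.mem_span_singleton'.2 ⟨a, rfl⟩) ?_
    rw [mul_comm]
    exact Submodule.smul_mem_smul (Ideal.mem_span_singleton_self y) hb

theorem IsRSP.prime_left {x y : S} (h : IsRSP S x y) : Prime x := by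
  have := h.isLocalRing
  have := h.isNoetherianRing
  have hx0 : x ≠ 0 := by
    rintro rfl
    exact h.ne_span_singleton y (by rw [← h.span, Ideal.span_insert]; simp)
  have hxu : Ideal.span {x} ≠ ⊤ := by
    rw [Ne, Ideal.span_singleton_eq_top]; exact h.left_mem
  obtain ⟨P, hP⟩ := Ideal.nonempty_minimalPrimes hxu
  have := hP.1.1
  have hxP : x ∈ P := hP.1.2 (Ideal.mem_span_singleton_self x)
  have hyP : y ∉ P := by
    intro hy
    have hle : maximalIdeal S ≤ P := by
      rw [← h.span, Ideal.span_le]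
      rintro z (rfl | rfl) <;> assumption
    have h1 := Ideal.height_mono hle
    rw [h.height_eq] at h1
    have h2 := Ideal.height_le_one_of_isPrincipal_of_mem_minimalPrimes (Ideal.span {x}) P hP
    exact absurd (h1.trans h2) (by decide)
  have : P = Ideal.span {x} := by
    refine le_antisymm (le_span_singleton_of_le_sup_smul h.right_mem ?_)
      (by rwa [Ideal.span_singleton_le_iff_mem])
    intro p hp
    obtain ⟨a, b, rfl⟩ := h.mem_iff.1 (le_maximalIdeal Ideal.IsPrime.ne_top' hp)
    refine ⟨a, b, ?_, rfl⟩
    have : b * y ∈ P := by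
      have := P.sub_mem hp (P.mul_mem_left a hxP)
      simpa using this
    exact (Ideal.IsPrime.mem_or_mem ‹_› this).resolve_right hyP
  rw [← Ideal.span_singleton_prime hx0, ← this]
  infer_instance

theorem IsRSP.prime_right {x y : S} (h : IsRSP S x y) : Prime y := h.symm.prime_left

theorem IsRSP.not_dvd {x y : S} (h : IsRSP S x y) : ¬ x ∣ y := by
  have := h.isLocalRing
  rintro ⟨c, rfl⟩
  refine h.ne_span_singleton x ?_
  rw [← h.span]
  refine le_antisymm (Ideal.span_le.2 ?_) (Ideal.span_mono (by simp))
  rintro z (rfl | rfl)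
  · exact Ideal.mem_span_singleton_self _
  · exact Ideal.mem_span_singleton.2 ⟨c, rfl⟩

/-- In the discrete valuation ring `S / (x)` every nonzero element is a unit times a power of the
image of `y`. -/
theorem IsRSP.exists_eq_unit_mul_pow_add {x y : S} (h : IsRSP S x y) {v : S} (hv : ¬ x ∣ v) :
    ∃ (e c : S) (n : ℕ), IsUnit e ∧ v = e * y ^ n + c * x := by
  have := h.isLocalRing
  have := h.isNoetherianRing
  by_contra hcon
  have key : ∀ n : ℕ, ∃ a c, v = a * y ^ n + c * x := by
    intro n
    induction n with
    | zero => exact ⟨v, 0, by simp⟩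
    | succ n ih =>
      obtain ⟨a, c, hac⟩ := ih
      have ha : a ∈ maximalIdeal S := by
        by_contra ha
        exact hcon ⟨a, c, n, by simpa using ha, hac⟩
      obtain ⟨p, q, rfl⟩ := h.mem_iff.1 ha
      exact ⟨q, c + p * y ^ n, by rw [hac]; ring⟩
  apply hv
  rw [← Ideal.mem_span_singleton]
  have hinf := IsHausdorff.of_le_jacobson (I := maximalIdeal S) (M := S ⧸ Ideal.span {x})
    (by rw [IsLocalRing.jacobson_eq_maximalIdeal _ bot_ne_top])
  rw [← Ideal.Quotient.eq_zero_iff_mem]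
  refine hinf.haus _ fun n ↦ ?_
  rw [SModEq.zero]
  obtain ⟨a, c, hac⟩ := key n
  have : Ideal.Quotient.mk (Ideal.span {x}) v = (a * y ^ n) • (1 : S ⧸ Ideal.span {x}) := by
    rw [hac, map_add, Ideal.Quotient.eq_zero_iff_mem.2 (Ideal.mem_span_singleton'.2 ⟨c, rfl⟩),
      add_zero, Algebra.smul_def, mul_one]; rfl
  rw [this]
  exact Submodule.smul_mem_smul (Ideal.mul_mem_left _ _ (Ideal.pow_mem_pow h.right_mem n))
    trivial

variable [IsDomain S]

/-- A prime ideal of a two-dimensional regular local ring that is neither zero nor maximal is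
principal: if it does not contain `x`, its image in the discrete valuation ring `S / (x)` is
principal, and a lift of a generator generates it by Nakayama's lemma. -/
theorem IsRSP.exists_eq_span_singleton [IsLocalRing S] {x y : S} (h : IsRSP S x y) {P : Ideal S}
    [hP : P.IsPrime] (hPm : P ≠ maximalIdeal S) : ∃ t, P = Ideal.span {t} := by
  have := h.isNoetherianRing
  by_cases hxP : x ∈ P
  · refine ⟨x, le_antisymm (le_span_singleton_of_le_sup_smul h.right_mem ?_)
      (by rwa [Ideal.span_singleton_le_iff_mem])⟩
    intro p hp
    have hyP : y ∉ P := by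
      intro hy
      refine hPm (le_antisymm (le_maximalIdeal hP.ne_top) ?_)
      rw [← h.span, Ideal.span_le]
      rintro z (rfl | rfl) <;> assumption
    obtain ⟨a, b, rfl⟩ := h.mem_iff.1 (le_maximalIdeal Ideal.IsPrime.ne_top' hp)
    refine ⟨a, b, ?_, rfl⟩
    have : b * y ∈ P := by
      have := P.sub_mem hp (P.mul_mem_left a hxP)
      simpa using this
    exact (hP.mem_or_mem this).resolve_right hyP
  by_cases hP0 : P = ⊥
  · exact ⟨0, by simp [hP0]⟩
  -- some element of `P` is not divisible by `x`, since `x` may be divided out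
  have hex : ∃ n : ℕ, ∃ p ∈ P, ∃ e c, IsUnit e ∧ p = e * y ^ n + c * x := by
    obtain ⟨p, hp, hp0⟩ := Submodule.exists_mem_ne_zero_of_ne_bot hP0
    obtain ⟨n, q, hq, rfl⟩ := WfDvdMonoid.max_power_factor hp0 h.prime_left.irreducible
    obtain ⟨e, c, m, he, hm⟩ := h.exists_eq_unit_mul_pow_add hq
    refine ⟨m, q, (hP.mem_or_mem hp).resolve_left fun hx ↦ hxP (hP.mem_of_pow_mem _ hx),
      e, c, he, hm⟩
  classical
  obtain ⟨p, hp, e, c, he, hpe⟩ := Nat.find_spec hex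
  refine ⟨p, le_antisymm (le_span_singleton_of_le_sup_smul h.left_mem ?_)
      (by rwa [Ideal.span_singleton_le_iff_mem])⟩
  intro q hq
  have : ∃ a b, q = a * p + b * x := by
    by_cases hxq : x ∣ q
    · obtain ⟨b, rfl⟩ := hxq
      exact ⟨0, b, by ring⟩
    obtain ⟨e', c', m, he', hm⟩ := h.exists_eq_unit_mul_pow_add hxq
    have hle : Nat.find hex ≤ m := Nat.find_min' hex ⟨q, hq, e', c', he', hm⟩
    obtain ⟨e₁, he₁⟩ := he.exists_left_inv
    obtain ⟨k, rfl⟩ := Nat.exists_eq_add_of_le hle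
    refine ⟨e' * y ^ k * e₁, c' - e' * y ^ k * e₁ * c, ?_⟩
    rw [hpe, hm, pow_add]
    linear_combination (- e' * y ^ k * y ^ Nat.find hex) * he₁
  obtain ⟨a, b, rfl⟩ := this
  refine ⟨a, b, ?_, rfl⟩
  have : b * x ∈ P := by
    have := P.sub_mem hq (P.mul_mem_left a hp)
    simpa using this
  exact (hP.mem_or_mem this).resolve_right hxP

theorem IsRSP.uniqueFactorizationMonoid {x y : S} (h : IsRSP S x y) :
    UniqueFactorizationMonoid S := by
  have := h.isLocalRing
  have := h.isNoetherianRing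
  rw [UniqueFactorizationMonoid.iff_exists_prime_mem_of_isPrime]
  intro P hP0 hP
  by_cases hPm : P = maximalIdeal S
  · exact ⟨x, hPm ▸ h.left_mem, h.prime_left⟩
  · obtain ⟨t, rfl⟩ := h.exists_eq_span_singleton hPm
    have ht : t ≠ 0 := by rintro rfl; simp at hP0
    exact ⟨t, Ideal.mem_span_singleton_self t, (Ideal.span_singleton_prime ht).1 hP⟩

/-- Changing one member of a regular system of parameters: if `w = α u + β v` with `α` a unit, `(w, v)` is again one. -/
theorem IsRSP.of_unit_combination {u v α β : S} (h : IsRSP S u v) (hα : IsUnit α) :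
    IsRSP S (α * u + β * v) v := by
  have := h.isLocalRing
  refine h.of_span (le_antisymm ?_ ?_)
  · rw [Ideal.span_le]
    rintro z (rfl | rfl)
    · exact h.mem_iff.2 ⟨α, β, rfl⟩
    · exact h.right_mem
  · rw [← h.span, Ideal.span_le]
    obtain ⟨α', hα'⟩ := hα.exists_left_inv
    rintro z (rfl | rfl)
    · refine Ideal.mem_span_pair.2 ⟨α', -(α' * β), ?_⟩
      linear_combination z * hα'
    · exact Ideal.subset_span (by simp)

theorem IsRSP.coeff_isUnit {u v α β : S} (h : IsRSP S u v) (h' : IsRSP S (α * u + β * v) v) :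
    IsUnit α := by
  have := h.isLocalRing
  by_contra hα
  obtain ⟨p, q, rfl⟩ := h.mem_iff.1 (show α ∈ maximalIdeal S by simpa using hα)
  obtain ⟨r, s, hrs⟩ := h'.mem_iff.1 h.left_mem
  -- modulo `v` this reads `u = r p u²`
  have h1 : u * (1 - r * p * u) = v * (r * (q * u + β) + s) := by linear_combination -hrs
  have h2 : IsUnit (1 - r * p * u) := by
    by_contra hu
    have hone : (1 : S) ∈ maximalIdeal S := by
      have := (maximalIdeal S).add_mem (show 1 - r * p * u ∈ maximalIdeal S by simpa using hu)
        ((maximalIdeal S).mul_mem_left (r * p) h.left_mem)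
      simpa using this
    exact (Ideal.ne_top_iff_one _).1 (maximalIdeal.isMaximal S).ne_top hone
  exact h.symm.not_dvd ((h2.dvd_mul_right).1 (h1 ▸ dvd_mul_right _ _))

/-- Two systems of parameters `(w, v)` and `(w, v')`: either `v` and `v'` differ by a unit, or `v`
is a unit times `v'` plus a unit times a power of `w`. -/
theorem IsRSP.compare {w v v' : S} (h : IsRSP S w v) (h' : IsRSP S w v') :
    (∃ e, IsUnit e ∧ v = e * v') ∨
      ∃ e ε, ∃ s : ℕ, IsUnit e ∧ IsUnit ε ∧ 1 ≤ s ∧ v = e * v' + ε * w ^ s := by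
  have := h.isLocalRing
  by_cases hd : v' ∣ v
  · obtain ⟨e, rfl⟩ := hd
    refine Or.inl ⟨e, ?_, mul_comm _ _⟩
    have : IsRSP S (e * v' + 0 * w) w := by simpa [mul_comm] using h.symm
    exact h'.symm.coeff_isUnit this
  · obtain ⟨ε, e, s, hε, hs⟩ := h'.symm.exists_eq_unit_mul_pow_add hd
    have hs1 : 1 ≤ s := by
      rcases Nat.eq_zero_or_pos s with rfl | hs1
      · exfalso
        rw [pow_zero, mul_one] at hs
        have : ε ∈ maximalIdeal S := by
          have := (maximalIdeal S).sub_mem h.right_mem ((maximalIdeal S).mul_mem_left e h'.right_mem)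
          rwa [hs, add_sub_cancel_right] at this
        exact this hε
      · exact hs1
    refine Or.inr ⟨e, ε, s, ?_, hε, hs1, by rw [hs, add_comm]⟩
    obtain ⟨k, rfl⟩ := Nat.exists_eq_add_of_le hs1
    have : IsRSP S (e * v' + (ε * w ^ k) * w) w := by
      have h2 := h.symm
      rw [hs] at h2
      convert h2 using 1
      ring
    exact h'.symm.coeff_isUnit this

end RegularLocal

/-! ### Dimension and residue fields of local rings essentially of finite type -/

section Dimension

theorem ringKrullDim_le_of_isIntegral {A B : Type*} [CommRing A] [CommRing B] [Algebra A B]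
    [Algebra.IsIntegral A B] : ringKrullDim B ≤ ringKrullDim A := by
  refine Order.krullDim_le_of_strictMono (PrimeSpectrum.comap (algebraMap A B)) ?_
  intro P Q h
  rw [← PrimeSpectrum.asIdeal_lt_asIdeal] at h ⊢
  exact Ideal.IsIntegral.comap_lt_comap h

/-- A local domain essentially of finite type over a field `k`, of transcendence degree at most
two, has dimension at most two, and its residue field is algebraic over `k` if its dimension
is two. -/
theorem ringKrullDim_le_two_and_isAlgebraic (k : Type u) [Field k] {S : Type u} [CommRing S]
    [IsDomain S] [IsLocalRing S] [Algebra k S] [Algebra.EssFiniteType k S]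
    (htr : ∀ (n : ℕ) (g : Fin n → S), AlgebraicIndependent k g → n ≤ 2) :
    ringKrullDim S ≤ 2 ∧ (ringKrullDim S = 2 → Algebra.IsAlgebraic k (ResidueField S)) := by
  let A := Algebra.EssFiniteType.subalgebra k S
  let p : Ideal A := (maximalIdeal S).comap (algebraMap A S)
  have hM : Algebra.EssFiniteType.submonoid k S = p.primeCompl := by
    ext a
    change IsUnit (algebraMap A S a) ↔ ¬ (algebraMap A S a ∈ maximalIdeal S)
    simp
  have hloc : IsLocalization.AtPrime S p := by
    have := Algebra.EssFiniteType.isLocalization (R := k) (S := S)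
    rwa [hM] at this
  have hdimA : ringKrullDim A ≤ 2 := by
    obtain ⟨n, g, hg, hint⟩ := exists_integral_inj_algHom_of_fg k A
    letI : Algebra (MvPolynomial (Fin n) k) A := g.toRingHom.toAlgebra
    have : Algebra.IsIntegral (MvPolynomial (Fin n) k) A := ⟨hint⟩
    refine (ringKrullDim_le_of_isIntegral (A := MvPolynomial (Fin n) k)).trans ?_
    rw [MvPolynomial.ringKrullDim_of_isNoetherianRing, ringKrullDim_eq_zero_of_field, zero_add]
    have hn : n ≤ 2 := by
      refine htr n (fun i ↦ (g (MvPolynomial.X i) : S)) ?_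
      have h1 : AlgebraicIndependent k (fun i : Fin n ↦ g (MvPolynomial.X i)) :=
        (MvPolynomial.algebraicIndependent_X (Fin n) k).map' hg
      exact h1.map' (f := A.val) Subtype.val_injective
    simp only [Nat.card_eq_fintype_card, Fintype.card_fin]
    exact_mod_cast hn
  have hdim : ringKrullDim S = p.height := IsLocalization.AtPrime.ringKrullDim_eq_height p S
  have hp : (p.height : WithBot ℕ∞) ≤ ringKrullDim A := Ideal.height_le_ringKrullDim_of_isPrime
  refine ⟨hdim ▸ hp.trans hdimA, fun h2 ↦ ?_⟩
  have hmax : p.IsMaximal := by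
    have heq : (p.height : WithBot ℕ∞) = ringKrullDim A :=
      le_antisymm hp (by rw [← hdim, h2]; exact hdimA)
    have : FiniteRingKrullDim A := by
      rw [finiteRingKrullDim_iff_ne_bot_and_top]
      refine ⟨?_, ?_⟩
      · rw [← heq]; simp
      · intro htop
        rw [htop] at hdimA
        exact absurd hdimA (by decide)
    exact Ideal.isMaximal_of_height_eq_ringKrullDim heq
  letI := Ideal.Quotient.field p
  have hfin : Module.Finite k (A ⧸ p) := finite_of_finite_type_of_isJacobsonRing k (A ⧸ p)
  have hA : ∀ a : A, IsAlgebraic k (residue S (algebraMap A S a)) := by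
    intro a
    have h1 : IsAlgebraic k (Ideal.Quotient.mk p a) := Algebra.IsAlgebraic.isAlgebraic _
    obtain ⟨f, hf0, hf⟩ := h1
    refine ⟨f, hf0, ?_⟩
    have h2 : Ideal.Quotient.mk p (Polynomial.aeval a f) = 0 := by
      rw [← hf]
      exact (Polynomial.aeval_algHom_apply (Ideal.Quotient.mkₐ k p) a f).symm
    rw [Ideal.Quotient.eq_zero_iff_mem] at h2
    have h3 : residue S (algebraMap A S (Polynomial.aeval a f)) = 0 := by
      rw [residue_eq_zero_iff]; exact h2
    rw [← h3]
    let φ : A →ₐ[k] ResidueField S := (IsScalarTower.toAlgHom k S (ResidueField S)).comp A.val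
    exact Polynomial.aeval_algHom_apply φ a f
  refine ⟨fun z ↦ ?_⟩
  obtain ⟨s, rfl⟩ := residue_surjective z
  obtain ⟨a, b, rfl⟩ := IsLocalization.exists_mk'_eq p.primeCompl s
  have h1 : residue S (IsLocalization.mk' S a b) =
      residue S (algebraMap A S a) * (residue S (algebraMap A S b))⁻¹ := by
    have hb : residue S (algebraMap A S b) ≠ 0 := by
      rw [Ne, residue_eq_zero_iff]
      exact b.2
    rw [eq_mul_inv_iff_mul_eq₀ hb, ← map_mul, IsLocalization.mk'_spec]
  rw [h1]
  exact (hA a).mul (hA b).inv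

end Dimension

/-! ### Differentials -/

section Differentials

open KaehlerDifferential
open scoped IntermediateField.algebraAdjoinAdjoin

/-- The differentials of generators of the maximal ideal generate `Ω[A⁄k]`, if the residue field of
the local ring `A` is algebraic over the perfect field `k`: an element `a` of `A` is, up to the
maximal ideal, a simple root of a polynomial over `k`. -/
theorem span_D_eq_top (k : Type u) [Field k] [PerfectField k] {A : Type u} [CommRing A]
    [IsLocalRing A] [Algebra k A] [Algebra.EssFiniteType k A]
    [Algebra.IsAlgebraic k (ResidueField A)] {s : Set A} (hs : Ideal.span s = maximalIdeal A) :
    Submodule.span A (D k A '' s) = ⊤ := by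
  set N := Submodule.span A (D k A '' s)
  have hm : ∀ a ∈ maximalIdeal A, D k A a ∈ N ⊔ maximalIdeal A • (⊤ : Submodule A (Ω[A⁄k])) := by
    intro a ha
    rw [← hs] at ha
    induction ha using Submodule.span_induction with
    | mem x hx => exact Submodule.mem_sup_left (Submodule.subset_span ⟨x, hx, rfl⟩)
    | zero => simp
    | add x y _ _ hx hy => rw [map_add]; exact add_mem hx hy
    | smul c x hxs hx =>
      rw [smul_eq_mul, Derivation.leibniz]
      refine add_mem (Submodule.smul_mem _ _ hx) (Submodule.mem_sup_right ?_)
      exact Submodule.smul_mem_smul (hs ▸ hxs) trivial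
  rw [eq_top_iff]
  refine Submodule.le_of_le_smul_of_le_jacobson_bot (I := maximalIdeal A) (Module.Finite.fg_top)
    (by rw [IsLocalRing.jacobson_eq_maximalIdeal _ bot_ne_top]) ?_
  rw [← span_range_derivation k A, Submodule.span_le]
  rintro _ ⟨a, rfl⟩
  rw [span_range_derivation k A]
  have hsep : (minpoly k (residue A a)).Separable := Algebra.IsSeparable.isSeparable k (residue A a)
  set f := minpoly k (residue A a)
  have hres : ∀ g : Polynomial k, residue A (Polynomial.aeval a g) =
      Polynomial.aeval (residue A a) g := fun g ↦
    (Polynomial.aeval_algHom_apply (IsScalarTower.toAlgHom k A (ResidueField A)) a g).symm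
  have h1 : Polynomial.aeval a f ∈ maximalIdeal A := by
    rw [← residue_eq_zero_iff, hres, minpoly.aeval]
  have h2 : IsUnit (Polynomial.aeval a (Polynomial.derivative f)) := by
    by_contra hu
    rw [← mem_nonunits_iff, ← mem_maximalIdeal, ← residue_eq_zero_iff, hres] at hu
    exact hsep.aeval_derivative_ne_zero (minpoly.aeval _ _) hu
  have h3 := hm _ h1
  rw [Derivation.map_aeval] at h3
  obtain ⟨c, hc⟩ := h2.exists_left_inv
  have := Submodule.smul_mem _ c h3
  rwa [smul_smul, hc, one_smul] at this

/-- `x, y` are local coordinates of the `k`-algebra `A`, as far as generation is concerned: `dx` and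
`dy` generate the module of differentials. -/
def Coordinates (k : Type u) [Field k] {A : Type u} [CommRing A] [Algebra k A] (x y : A) : Prop :=
  Submodule.span A {D k A x, D k A y} = ⊤

variable {k : Type u} [Field k] {A : Type u} [CommRing A] [Algebra k A] {x y : A}

theorem Coordinates.exists_coeff (h : Coordinates k x y) (a : A) :
    ∃ p q : A, ∀ {M : Type u} [AddCommGroup M] [Module k M] [Module A M] [IsScalarTower k A M]
      (d : Derivation k A M), d a = p • d x + q • d y := by
  have h1 : D k A a ∈ Submodule.span A {D k A x, D k A y} := by
    rw [show Submodule.span A {D k A x, D k A y} = ⊤ from h]; trivial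
  obtain ⟨p, q, hpq⟩ := Submodule.mem_span_pair.1 h1
  refine ⟨p, q, fun {M} _ _ _ _ d ↦ ?_⟩
  have := congrArg d.liftKaehlerDifferential hpq
  simpa using this.symm

/-- Coordinates remain coordinates in a localization. -/
theorem Coordinates.localization (h : Coordinates k x y) {B : Type u} [CommRing B] [Algebra k B]
    [Algebra A B] [IsScalarTower k A B] (M : Submonoid A) [IsLocalization M B] :
    Coordinates k (algebraMap A B x) (algebraMap A B y) := by
  unfold Coordinates
  rw [eq_top_iff, ← span_range_map_derivation_of_isLocalization k A B M, Submodule.span_le]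
  rintro _ ⟨a, rfl⟩
  obtain ⟨p, q, hpq⟩ := h.exists_coeff a
  have := hpq ((D k B).compAlgebraMap A)
  simp only [Derivation.compAlgebraMap_apply] at this
  simp only [Function.comp_apply, map_D, SetLike.mem_coe]
  rw [Submodule.mem_span_pair]
  refine ⟨algebraMap A B p, algebraMap A B q, ?_⟩
  rw [algebraMap_smul, algebraMap_smul]
  exact this.symm

/-- Coordinates on a domain whose field of fractions has a two-dimensional module of differentials
have dual derivations, since `dx`, `dy` are then a basis of the module of differentials. -/
theorem Coordinates.exists_dual [IsDomain A] (h : Coordinates k x y) (L : Type u) [Field L]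
    [Algebra k L] [Algebra A L] [IsScalarTower k A L] [IsFractionRing A L]
    (hL : Module.finrank L (Ω[L⁄k]) = 2) :
    ∃ dx dy : Derivation k A A, dx x = 1 ∧ dx y = 0 ∧ dy x = 0 ∧ dy y = 1 := by
  have hLc : Coordinates k (algebraMap A L x) (algebraMap A L y) :=
    h.localization (nonZeroDivisors A)
  have hrange : ∀ {B : Type u} [CommRing B] [Algebra k B] (a b : B),
      Set.range ![D k B a, D k B b] = {D k B a, D k B b} := fun a b ↦ by simp [Set.pair_comm]
  have hliL : LinearIndependent L ![D k L (algebraMap A L x), D k L (algebraMap A L y)] := by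
    refine linearIndependent_of_top_le_span_of_card_eq_finrank ?_ (by simp [hL])
    rw [hrange]; exact hLc.ge
  have hli : LinearIndependent A ![D k A x, D k A y] := by
    rw [LinearIndependent.pair_iff] at hliL ⊢
    intro p q hpq
    have h1 := congrArg (KaehlerDifferential.map k k A L) hpq
    rw [map_add, map_smul, map_smul, map_D, map_D, map_zero, ← algebraMap_smul L p,
      ← algebraMap_smul L q] at h1
    obtain ⟨h2, h3⟩ := hliL _ _ h1
    have hinj := IsFractionRing.injective A L
    exact ⟨hinj (by rw [h2, map_zero]), hinj (by rw [h3, map_zero])⟩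
  let b : Module.Basis (Fin 2) A (Ω[A⁄k]) := Module.Basis.mk hli (by rw [hrange]; exact h.ge)
  have hb0 : D k A x = b 0 := by simp [b]
  have hb1 : D k A y = b 1 := by simp [b]
  refine ⟨(b.coord 0).compDer (D k A), (b.coord 1).compDer (D k A), ?_, ?_, ?_, ?_⟩
  all_goals simp [hb0, hb1]

/-- The module of differentials of a finitely generated field of transcendence degree two over a
perfect field has dimension two. -/
theorem finrank_kaehlerDifferential_eq_two [PerfectField k] {K : Type u} [Field K] [Algebra k K]
    [Algebra.EssFiniteType k K] (htr : Algebra.trdeg k K = 2) : Module.finrank K (Ω[K⁄k]) = 2 := by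
  obtain ⟨s, hs, hsep⟩ := exists_isTranscendenceBasis_and_isSeparable_of_perfectField k K
  have hcard : s.card = 2 := by
    have := hs.cardinalMk_eq_trdeg
    rw [htr] at this
    rw [Cardinal.mk_coe_finset] at this
    exact_mod_cast this
  let P := MvPolynomial s k
  letI : Algebra P K := (MvPolynomial.aeval (R := k) ((↑) : s → K)).toAlgebra
  have : IsScalarTower k P K := IsScalarTower.of_algebraMap_eq fun c ↦
    (MvPolynomial.aeval_C (R := k) ((↑) : s → K) c).symm
  have : Algebra.FormallyEtale P K := by
    let A₀ := Algebra.adjoin k (Set.range ((↑) : s → K))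
    let E := IntermediateField.adjoin k (Set.range ((↑) : s → K))
    have hE : Algebra.IsSeparable E K := by
      convert! hsep <;> simp [E]
    have h1 : Algebra.FormallyEtale A₀ E := .of_isLocalization (nonZeroDivisors _)
    have h2 : Algebra.FormallyEtale E K := .of_isSeparable E K
    have h3 : Algebra.FormallyEtale A₀ K := .comp A₀ E K
    let e : P ≃ₐ[k] A₀ := hs.1.aevalEquiv
    letI : Algebra P A₀ := e.toAlgHom.toRingHom.toAlgebra
    have h4 : Algebra.FormallyEtale P A₀ :=
      .of_equiv (AlgEquiv.ofRingEquiv (f := e.toRingEquiv) fun _ ↦ rfl)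
    have : IsScalarTower P A₀ K := IsScalarTower.of_algebraMap_eq fun q ↦ 
      (hs.1.algebraMap_aevalEquiv q).symm
    exact .comp P A₀ K
  have e := tensorKaehlerEquivOfFormallyEtale k P K
  rw [← e.finrank_eq]
  have b := (mvPolynomialBasis k s).baseChange K
  rw [Module.finrank_eq_card_basis b]
  simpa using hcard

end Differentials

/-! ### Jacobian determinants of monomials -/

section Jacobian

variable {k : Type u} [Field k] {S : Type u} [CommRing S] [Algebra k S]

/-- The Jacobian determinant of `a, b` with respect to a pair of derivations. -/
def jac (d₁ d₂ : Derivation k S S) (a b : S) : S := d₁ a * d₂ b - d₁ b * d₂ a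

variable (d₁ d₂ : Derivation k S S)

theorem jac_swap (a b : S) : jac d₁ d₂ a b = -jac d₁ d₂ b a := by unfold jac; ring

@[simp] theorem jac_zero_left (b : S) : jac d₁ d₂ 0 b = 0 := by simp [jac]

@[simp] theorem jac_zero_right (b : S) : jac d₁ d₂ b 0 = 0 := by simp [jac]

@[simp] theorem jac_one_left (b : S) : jac d₁ d₂ 1 b = 0 := by simp [jac]

@[simp] theorem jac_one_right (b : S) : jac d₁ d₂ b 1 = 0 := by simp [jac]

theorem deriv_pow_mul_self (d : Derivation k S S) (t : S) (a : ℕ) :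
    d (t ^ a) * t = a * t ^ a * d t := by
  rw [Derivation.leibniz_pow]
  cases a with
  | zero => simp
  | succ a => simp [pow_succ]; ring

theorem deriv_monomial (d : Derivation k S S) (γ x y : S) (a b : ℕ) :
    d (γ * (x ^ a * y ^ b)) * (x * y) =
      x ^ a * y ^ b * (d γ * (x * y) + a * γ * y * d x + b * γ * x * d y) := by
  have hx := deriv_pow_mul_self d x a
  have hy := deriv_pow_mul_self d y b
  simp only [Derivation.leibniz, smul_eq_mul]
  linear_combination γ * x ^ a * x * hy + γ * y ^ b * y * hx

variable [IsDomain S]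

/-- The Jacobian determinant of two monomials with coefficients: logarithmic differentiation. -/
theorem jac_monomial {x y : S} (hx : x ≠ 0) (hy : y ≠ 0) (γ δ : S) (a b c d : ℕ) :
    jac d₁ d₂ (γ * (x ^ a * y ^ b)) (δ * (x ^ c * y ^ d)) * (x * y) =
      x ^ (a + c) * y ^ (b + d) * (((a : S) * d - b * c) * (γ * δ) * jac d₁ d₂ x y +
        y * (a * γ * jac d₁ d₂ x δ + c * δ * jac d₁ d₂ γ x) +
        x * (b * γ * jac d₁ d₂ y δ + d * δ * jac d₁ d₂ γ y) + x * y * jac d₁ d₂ γ δ) := by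
  refine mul_right_cancel₀ (mul_ne_zero hx hy) ?_
  have h1 := deriv_monomial d₁ γ x y a b
  have h2 := deriv_monomial d₂ γ x y a b
  have h3 := deriv_monomial d₁ δ x y c d
  have h4 := deriv_monomial d₂ δ x y c d
  have e : jac d₁ d₂ (γ * (x ^ a * y ^ b)) (δ * (x ^ c * y ^ d)) * (x * y) * (x * y) =
      (d₁ (γ * (x ^ a * y ^ b)) * (x * y)) * (d₂ (δ * (x ^ c * y ^ d)) * (x * y)) -
      (d₁ (δ * (x ^ c * y ^ d)) * (x * y)) * (d₂ (γ * (x ^ a * y ^ b)) * (x * y)) := by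
    unfold jac; ring
  rw [e, h1, h2, h3, h4]
  simp only [jac, pow_add]
  ring

theorem jac_pow {t : S} (ht : t ≠ 0) (γ δ : S) (a c : ℕ) :
    jac d₁ d₂ (γ * t ^ a) (δ * t ^ c) * t =
      t ^ (a + c) * (a * γ * jac d₁ d₂ t δ + c * δ * jac d₁ d₂ γ t + t * jac d₁ d₂ γ δ) := by
  have := jac_monomial d₁ d₂ ht one_ne_zero γ δ a 0 c 0
  simpa using this

/-- The logarithmic form `du/u ∧ dv/v` has at most a simple pole along any prime divisor. -/
theorem pow_dvd_mul_jac {t u v : S} (ht : Prime t) [WfDvdMonoid S] {n : ℕ} (h : t ^ n ∣ u * v) :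
    t ^ n ∣ t * jac d₁ d₂ u v := by
  by_cases hu : u = 0
  · simp [hu]
  by_cases hv : v = 0
  · simp [hv]
  obtain ⟨a, g, hg, rfl⟩ := WfDvdMonoid.max_power_factor hu ht.irreducible
  obtain ⟨c, e, he, rfl⟩ := WfDvdMonoid.max_power_factor hv ht.irreducible
  have hn : n ≤ a + c := by
    by_contra hlt
    have h1 : t ^ (a + c) * t ∣ t ^ (a + c) * (g * e) := by
      rw [← pow_succ]
      refine (pow_dvd_pow t (by omega : a + c + 1 ≤ n)).trans (h.trans (dvd_of_eq ?_))
      ring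
    exact (ht.dvd_or_dvd ((mul_dvd_mul_iff_left (pow_ne_zero _ ht.ne_zero)).1 h1)).elim hg he
  have := jac_pow d₁ d₂ ht.ne_zero g e a c
  rw [mul_comm t, mul_comm (t ^ a), mul_comm (t ^ c), this]
  exact (pow_dvd_pow t hn).trans (dvd_mul_right _ _)

/-- The logarithmic form `du/u ∧ dv/v`, with Jacobian determinant `J` of `u, v`, has a pole along
the prime divisor `t = 0` if `t` divides `uv`; that is, the vanishing order of `u v` is that of
`t J`. -/
def IsOptimal (J t u v : S) : Prop := ∀ n, t ^ n ∣ t * J → t ^ n ∣ u * v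

end Jacobian

section Frame

variable {k : Type u} [Field k] {S : Type u} [CommRing S] [Algebra k S]

/-- A frame of derivations at a smooth point of a surface: `d₁, d₂` are the partial derivatives for
some regular parameters, and all regular parameters are coordinates. -/
structure IsFrame (d₁ d₂ : Derivation k S S) : Prop where
  coordinates : ∀ a b : S, IsRSP S a b → Coordinates k a b
  exists_dual : ∃ x y : S, IsRSP S x y ∧ d₁ x = 1 ∧ d₁ y = 0 ∧ d₂ x = 0 ∧ d₂ y = 1

variable {d₁ d₂ : Derivation k S S}

theorem IsFrame.isUnit_jac (hF : IsFrame d₁ d₂) {a b : S} (h : IsRSP S a b) :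
    IsUnit (jac d₁ d₂ a b) := by
  obtain ⟨x, y, -, h1, h2, h3, h4⟩ := hF.exists_dual
  obtain ⟨p, q, hx⟩ := (hF.coordinates a b h).exists_coeff x
  obtain ⟨r, s, hy⟩ := (hF.coordinates a b h).exists_coeff y
  have e1 := hx d₁
  have e2 := hx d₂
  have e3 := hy d₁
  have e4 := hy d₂
  simp only [h1, h2, h3, h4, smul_eq_mul] at e1 e2 e3 e4
  refine IsUnit.of_mul_eq_one (p * s - q * r) ?_
  unfold jac
  linear_combination (-(r * d₂ a + s * d₂ b)) * e1 - e4 + (p * d₂ a + q * d₂ b) * e3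

theorem isUnit_of_sub_mem [IsLocalRing S] {a b : S} (ha : IsUnit a)
    (h : a - b ∈ maximalIdeal S) : IsUnit b := by
  by_contra hb
  have := (maximalIdeal S).add_mem h (show b ∈ maximalIdeal S by simpa using hb)
  rw [sub_add_cancel] at this
  exact this ha

/-- The Jacobian criterion for regular parameters. -/
theorem IsFrame.isRSP_of_isUnit_jac [IsLocalRing S] (hF : IsFrame d₁ d₂) {a b : S}
    (ha : a ∈ maximalIdeal S) (hb : b ∈ maximalIdeal S) (hu : IsUnit (jac d₁ d₂ a b)) :
    IsRSP S a b := by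
  obtain ⟨x, y, hxy, h1, h2, h3, h4⟩ := hF.exists_dual
  obtain ⟨p, q, rfl⟩ := hxy.mem_iff.1 ha
  obtain ⟨r, s, rfl⟩ := hxy.mem_iff.1 hb
  have hdet : IsUnit (p * s - q * r) := by
    refine isUnit_of_sub_mem hu ?_
    have e : jac d₁ d₂ (p * x + q * y) (r * x + s * y) - (p * s - q * r) ∈
        Ideal.span {x, y} := by
      rw [Ideal.mem_span_pair]
      refine ⟨(p + x * d₁ p + y * d₁ q) * d₂ r + d₁ p * s - (r + x * d₁ r + y * d₁ s) * d₂ p -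
        d₁ r * q, (p + x * d₁ p + y * d₁ q) * d₂ s + d₁ q * s - (r + x * d₁ r + y * d₁ s) * d₂ q -
        d₁ s * q, ?_⟩
      simp only [jac, map_add, Derivation.leibniz, smul_eq_mul, h1, h2, h3, h4]
      ring
    rwa [hxy.span] at e
  obtain ⟨D, hD⟩ := hdet.exists_left_inv
  refine hxy.of_span (le_antisymm ?_ ?_)
  · rw [Ideal.span_le]
    rintro z (rfl | rfl) <;> assumption
  · rw [← hxy.span, Ideal.span_le]
    rintro z (rfl | rfl)
    · exact Ideal.mem_span_pair.2 ⟨D * s, -(D * q), by linear_combination z * hD⟩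
    · exact Ideal.mem_span_pair.2 ⟨-(D * r), D * p, by linear_combination z * hD⟩

/-- An element of the maximal ideal with nonzero differential at the closed point is part of a
regular system of parameters. -/
theorem IsFrame.exists_isRSP [IsDomain S] [IsLocalRing S] (hF : IsFrame d₁ d₂) {t c : S}
    (ht : t ∈ maximalIdeal S) (hu : IsUnit (jac d₁ d₂ t c)) : ∃ y, IsRSP S t y := by
  obtain ⟨x, y, hxy, -⟩ := hF.exists_dual
  obtain ⟨p, q, rfl⟩ := hxy.mem_iff.1 ht
  by_cases hp : IsUnit p
  · exact ⟨y, hxy.of_unit_combination hp⟩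
  by_cases hq : IsUnit q
  · exact ⟨x, by rw [add_comm]; exact hxy.symm.of_unit_combination hq⟩
  exfalso
  have hd : ∀ d : Derivation k S S, d (p * x + q * y) ∈ maximalIdeal S := by
    intro d
    simp only [map_add, Derivation.leibniz, smul_eq_mul]
    have hp' : p ∈ maximalIdeal S := by simpa using hp
    have hq' : q ∈ maximalIdeal S := by simpa using hq
    exact add_mem (add_mem (Ideal.mul_mem_right _ _ hp') (Ideal.mul_mem_right _ _ hxy.left_mem))
      (add_mem (Ideal.mul_mem_right _ _ hq') (Ideal.mul_mem_right _ _ hxy.right_mem))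
  have : jac d₁ d₂ (p * x + q * y) c ∈ maximalIdeal S :=
    sub_mem (Ideal.mul_mem_right _ _ (hd d₁)) (Ideal.mul_mem_left _ _ (hd d₂))
  exact this hu

/-- The derivation `∂/∂y` for the regular parameters `x, y` is `jac x · / jac x y`. -/
theorem IsFrame.exists_derivation (hF : IsFrame d₁ d₂) {x y : S} (h : IsRSP S x y) :
    ∃ (dy : Derivation k S S) (e : S), IsUnit e ∧ dy x = 0 ∧ dy y = 1 ∧
      ∀ a, dy a = e * jac d₁ d₂ x a := by
  obtain ⟨e, he⟩ := (hF.isUnit_jac h).exists_left_inv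
  have key : ∀ a, (e • (d₁ x • d₂ - d₂ x • d₁)) a = e * jac d₁ d₂ x a := by
    intro a
    simp only [Derivation.smul_apply, Derivation.sub_apply, smul_eq_mul, jac]
    ring
  refine ⟨e • (d₁ x • d₂ - d₂ x • d₁), e, IsUnit.of_mul_eq_one _ he, ?_, ?_, key⟩
  · rw [key]; simp [jac]
  · rw [key, he]

theorem IsFrame.derivation_eq (hF : IsFrame d₁ d₂) {x y : S} (h : IsRSP S x y)
    {dy : Derivation k S S} (hx : dy x = 0) (hy : dy y = 1) (a : S) :
    dy a * jac d₁ d₂ x y = jac d₁ d₂ x a := by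
  obtain ⟨p, q, hpq⟩ := (hF.coordinates x y h).exists_coeff a
  have e0 := hpq dy
  have e1 := hpq d₁
  have e2 := hpq d₂
  simp only [hx, hy, smul_eq_mul, mul_zero, mul_one, zero_add] at e0 e1 e2
  rw [e0]
  unfold jac
  rw [e1, e2]
  ring

theorem not_ringChar_dvd_of_isUnit [Nontrivial S] {n : ℤ} {c : S} (h : IsUnit ((n : S) * c)) :
    ¬ ((ringChar k : ℤ) ∣ n) := by
  intro hd
  have h1 : (n : k) = 0 := (CharP.intCast_eq_zero_iff k (ringChar k) n).2 hd
  have h2 : (n : S) = 0 := by rw [← map_intCast (algebraMap k S), h1, map_zero]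
  rw [h2, zero_mul] at h
  exact not_isUnit_zero h

theorem isUnit_intCast_of_not_ringChar_dvd {n : ℤ} (h : ¬ ((ringChar k : ℤ) ∣ n)) :
    IsUnit (n : S) := by
  have h1 : (n : k) ≠ 0 := fun h0 ↦ h ((CharP.intCast_eq_zero_iff k (ringChar k) n).1 h0)
  rw [← map_intCast (algebraMap k S)]
  exact (IsUnit.mk0 _ h1).map _

variable [IsDomain S]

/-- If the form `du/u ∧ dv/v` has exact logarithmic poles along the branches `x = 0` and `y = 0`,
and `u, v` are monomials in `x, y` up to the factors `γ, δ`, then `x, y` are regular parameters and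
`u, v` have the first monomial form. -/
theorem IsFrame.formOne [IsLocalRing S] (hF : IsFrame d₁ d₂) {x y γ δ ε : S}
    (hx : x ∈ maximalIdeal S) (hy : y ∈ maximalIdeal S) (hx0 : x ≠ 0) (hy0 : y ≠ 0)
    (hε : IsUnit ε) {a b c d : ℕ}
    (h : jac d₁ d₂ (γ * (x ^ a * y ^ b)) (δ * (x ^ c * y ^ d)) * (x * y) =
      ε * (x ^ (a + c) * y ^ (b + d))) :
    IsRSP S x y ∧ FormOne k (γ * (x ^ a * y ^ b)) (δ * (x ^ c * y ^ d)) x y := by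
  rw [jac_monomial d₁ d₂ hx0 hy0, mul_comm ε] at h
  have h := mul_left_cancel₀ (mul_ne_zero (pow_ne_zero _ hx0) (pow_ne_zero _ hy0)) h
  have hu : IsUnit (((((a : ℤ) * d - (b : ℤ) * c : ℤ) : S)) * (γ * δ * jac d₁ d₂ x y)) := by
    refine isUnit_of_sub_mem hε ?_
    rw [← h]
    push_cast
    convert_to y * (a * γ * jac d₁ d₂ x δ + c * δ * jac d₁ d₂ γ x) +
        x * (b * γ * jac d₁ d₂ y δ + d * δ * jac d₁ d₂ γ y) + x * (y * jac d₁ d₂ γ δ) ∈ _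
    · ring
    exact add_mem (add_mem (Ideal.mul_mem_right _ _ hy) (Ideal.mul_mem_right _ _ hx))
      (Ideal.mul_mem_right _ _ hx)
  have h1 := isUnit_of_mul_isUnit_right hu
  exact ⟨hF.isRSP_of_isUnit_jac hx hy (isUnit_of_mul_isUnit_right h1), γ, δ, a, b, c, d, rfl, rfl,
    isUnit_of_mul_isUnit_left h1, not_ringChar_dvd_of_isUnit hu⟩

/-- If the form `du/u ∧ dv/v` has an exact logarithmic pole along the branch `t = 0`, and `u, v` are
powers of `t` up to the factors `γ, δ`, then `u, v` have a monomial form. If `γ` or `δ` is not a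
unit, it is the second parameter of the first monomial form. -/
theorem IsFrame.form_of_pow [IsLocalRing S] (hF : IsFrame d₁ d₂) {t γ δ ε : S}
    (ht : t ∈ maximalIdeal S) (ht0 : t ≠ 0) (hε : IsUnit ε) {a c : ℕ}
    (h : jac d₁ d₂ (γ * t ^ a) (δ * t ^ c) * t = ε * t ^ (a + c)) :
    ∃ x y, IsRSP S x y ∧ (FormOne k (γ * t ^ a) (δ * t ^ c) x y ∨
      FormTwo k (γ * t ^ a) (δ * t ^ c) x y) := by
  rw [jac_pow d₁ d₂ ht0, mul_comm ε] at h
  have h := mul_left_cancel₀ (pow_ne_zero _ ht0) h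
  have hu : IsUnit (a * γ * jac d₁ d₂ t δ - c * δ * jac d₁ d₂ t γ) := by
    refine isUnit_of_sub_mem hε ?_
    rw [← h, jac_swap d₁ d₂ γ t]
    convert_to t * jac d₁ d₂ γ δ ∈ _
    · ring
    exact Ideal.mul_mem_right _ _ ht
  by_cases hδ : δ ∈ maximalIdeal S
  · have h1 : IsUnit (((a : ℤ) : S) * (γ * jac d₁ d₂ t δ)) := by
      refine isUnit_of_sub_mem hu ?_
      convert_to δ * (-(c * jac d₁ d₂ t γ)) ∈ _
      · push_cast; ring
      exact Ideal.mul_mem_right _ _ hδ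
    have h2 := isUnit_of_mul_isUnit_right h1
    refine ⟨t, δ, hF.isRSP_of_isUnit_jac ht hδ (isUnit_of_mul_isUnit_right h2), Or.inl
      ⟨γ, 1, a, 0, c, 1, by simp, by ring, by simpa using isUnit_of_mul_isUnit_left h2, ?_⟩⟩
    simpa using not_ringChar_dvd_of_isUnit (k := k) h1
  by_cases hγ : γ ∈ maximalIdeal S
  · have h1 : IsUnit (((-(c : ℤ) : ℤ) : S) * (δ * jac d₁ d₂ t γ)) := by
      refine isUnit_of_sub_mem hu ?_
      convert_to γ * (a * jac d₁ d₂ t δ) ∈ _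
      · push_cast; ring
      exact Ideal.mul_mem_right _ _ hγ
    have h2 := isUnit_of_mul_isUnit_right h1
    refine ⟨t, γ, hF.isRSP_of_isUnit_jac ht hγ (isUnit_of_mul_isUnit_right h2), Or.inl
      ⟨1, δ, a, 1, c, 0, by ring, by simp, by simpa using isUnit_of_mul_isUnit_left h2, ?_⟩⟩
    simpa using not_ringChar_dvd_of_isUnit (k := k) h1
  have hγδ : IsUnit (γ * δ) := by
    simp only [mem_maximalIdeal, mem_nonunits_iff, not_not] at hδ hγ
    exact hγ.mul hδ
  obtain ⟨y, hy⟩ : ∃ y, IsRSP S t y := by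
    have h3 : IsUnit (jac d₁ d₂ t δ) ∨ IsUnit (jac d₁ d₂ t γ) := by
      rw [sub_eq_add_neg] at hu
      rcases IsLocalRing.isUnit_or_isUnit_of_isUnit_add hu with h4 | h4
      · exact Or.inl (isUnit_of_mul_isUnit_right h4)
      · exact Or.inr (isUnit_of_mul_isUnit_right (IsUnit.neg_iff _ |>.1 h4))
    rcases h3 with h3 | h3
    · exact hF.exists_isRSP ht h3
    · exact hF.exists_isRSP ht h3
  obtain ⟨dy, e, he, hdx, hdy, hd⟩ := hF.exists_derivation hy
  refine ⟨t, y, hy, Or.inr ⟨γ, δ, a, c, rfl, rfl, hγδ, dy, hdx, hdy, ?_⟩⟩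
  rw [hd, hd]
  convert he.mul hu using 1
  ring

/-- In the first monomial form the logarithmic form `du/u ∧ dv/v` is a generator of the forms with
logarithmic poles along `xy = 0`. -/
theorem IsFrame.jac_of_formOne [IsLocalRing S] (hF : IsFrame d₁ d₂) {u v x y : S}
    (h : IsRSP S x y) (hf : FormOne k u v x y) :
    ∃ ε, IsUnit ε ∧ jac d₁ d₂ u v * (x * y) = ε * (u * v) := by
  obtain ⟨γ, δ, a, b, c, d, rfl, rfl, hγδ, hp⟩ := hf
  obtain ⟨ρ, hρ⟩ := hγδ.exists_left_inv
  have hu : IsUnit (((((a : ℤ) * d - (b : ℤ) * c : ℤ) : S)) * (γ * δ * jac d₁ d₂ x y)) :=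
    (isUnit_intCast_of_not_ringChar_dvd hp).mul (hγδ.mul (hF.isUnit_jac h))
  have hE : IsUnit (((a : S) * d - b * c) * (γ * δ) * jac d₁ d₂ x y +
        y * (a * γ * jac d₁ d₂ x δ + c * δ * jac d₁ d₂ γ x) +
        x * (b * γ * jac d₁ d₂ y δ + d * δ * jac d₁ d₂ γ y) + x * y * jac d₁ d₂ γ δ) := by
    refine isUnit_of_sub_mem hu ?_
    push_cast
    convert_to y * (-(a * γ * jac d₁ d₂ x δ + c * δ * jac d₁ d₂ γ x)) +
        x * (-(b * γ * jac d₁ d₂ y δ + d * δ * jac d₁ d₂ γ y)) + x * (-(y * jac d₁ d₂ γ δ)) ∈ _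
    · ring
    exact add_mem (add_mem (Ideal.mul_mem_right _ _ h.right_mem)
      (Ideal.mul_mem_right _ _ h.left_mem)) (Ideal.mul_mem_right _ _ h.left_mem)
  refine ⟨ρ * _, (IsUnit.of_mul_eq_one _ hρ).mul hE, ?_⟩
  rw [jac_monomial d₁ d₂ h.prime_left.ne_zero h.prime_right.ne_zero, pow_add, pow_add]
  linear_combination (-(x ^ a * x ^ c * (y ^ b * y ^ d)) * (((a : S) * d - b * c) * (γ * δ) *
    jac d₁ d₂ x y + y * (a * γ * jac d₁ d₂ x δ + c * δ * jac d₁ d₂ γ x) +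
    x * (b * γ * jac d₁ d₂ y δ + d * δ * jac d₁ d₂ γ y) + x * y * jac d₁ d₂ γ δ)) * hρ

theorem IsFrame.jac_of_formTwo [IsLocalRing S] (hF : IsFrame d₁ d₂) {u v x y : S}
    (h : IsRSP S x y) (hf : FormTwo k u v x y) :
    ∃ ε, IsUnit ε ∧ jac d₁ d₂ u v * x = ε * (u * v) := by
  obtain ⟨γ, δ, a, c, rfl, rfl, hγδ, dy, hdx, hdy, hu⟩ := hf
  obtain ⟨ρ, hρ⟩ := hγδ.exists_left_inv
  have hE : IsUnit (a * γ * jac d₁ d₂ x δ + c * δ * jac d₁ d₂ γ x + x * jac d₁ d₂ γ δ) := by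
    refine isUnit_of_sub_mem (hu.mul (hF.isUnit_jac h)) ?_
    have e1 := hF.derivation_eq h hdx hdy δ
    have e2 := hF.derivation_eq h hdx hdy γ
    rw [jac_swap d₁ d₂ γ x]
    convert_to x * (-jac d₁ d₂ γ δ) ∈ _
    · linear_combination (a * γ) * e1 - (c * δ) * e2
    exact Ideal.mul_mem_right _ _ h.left_mem
  refine ⟨ρ * _, (IsUnit.of_mul_eq_one _ hρ).mul hE, ?_⟩
  rw [jac_pow d₁ d₂ h.prime_left.ne_zero, pow_add]
  linear_combination (-(x ^ a * x ^ c) * (a * γ * jac d₁ d₂ x δ + c * δ * jac d₁ d₂ γ x +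
    x * jac d₁ d₂ γ δ)) * hρ

end Frame

/-! ### Optimal parameters and monomial forms -/

section Optimal

variable {k : Type u} [Field k] {S : Type u} [CommRing S] [Algebra k S]
  {d₁ d₂ : Derivation k S S}

theorem IsOptimal.mono {J t u v u' v' : S} (h : IsOptimal J t u v) (hd : u * v ∣ u' * v') :
    IsOptimal J t u' v' := fun n hn ↦ (h n hn).trans hd

theorem IsOptimal.of_associated {J J' t u v : S} (h : IsOptimal J t u v) (hJ : Associated J J') :
    IsOptimal J' t u v :=
  fun n hn ↦ h n (hn.trans (mul_dvd_mul_left t hJ.symm.dvd))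

theorem isOptimal_of_not_dvd [IsDomain S] {J t u v : S} (ht : Prime t) (hJ : ¬ t ∣ J)
    (h : t ∣ u * v) : IsOptimal J t u v := by
  intro n hn
  rcases Nat.lt_or_ge n 2 with h2 | h2
  · exact (pow_dvd_pow t (by omega : n ≤ 1)).trans (by simpa using h)
  · exact absurd ((mul_dvd_mul_iff_left ht.ne_zero).1
      ((by simpa [sq] using (pow_dvd_pow t h2).trans hn : t * t ∣ t * J))) hJ

/-- Passing to `u, v'` does not affect optimality at `t` if `v'` vanishes along `t = 0` at least to
the same order as `v`. -/
theorem IsOptimal.of_pow_dvd [IsDomain S] [WfDvdMonoid S] {J t u v : S} (ht : Prime t)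
    (hv : v ≠ 0) (h : IsOptimal J t u v) :
    ∃ m, t ^ m ∣ v ∧ ∀ v', t ^ m ∣ v' → IsOptimal J t u v' := by
  obtain ⟨m, g, hg, rfl⟩ := WfDvdMonoid.max_power_factor hv ht.irreducible
  refine ⟨m, dvd_mul_right _ _, fun v' hv' n hn ↦ ?_⟩
  have := h n hn
  rw [← mul_assoc] at this
  exact (ht.pow_dvd_of_dvd_mul_right n hg this).trans (mul_dvd_mul_left u hv')

theorem jac_mul_right (z a b : S) :
    jac d₁ d₂ z (a * b) = a * jac d₁ d₂ z b + b * jac d₁ d₂ z a := by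
  simp only [jac, Derivation.leibniz, smul_eq_mul]; ring

theorem jac_pow_mul_self (z r : S) (e : ℕ) :
    jac d₁ d₂ z (r ^ e) * r = e * r ^ e * jac d₁ d₂ z r := by
  have h1 := deriv_pow_mul_self d₁ r e
  have h2 := deriv_pow_mul_self d₂ r e
  unfold jac
  linear_combination d₁ z * h2 - d₂ z * h1

theorem jac_mul_pow_right (z u r : S) (e : ℕ) :
    jac d₁ d₂ z (u * r ^ e) * r =
      r ^ e * (r * jac d₁ d₂ z u + e * u * jac d₁ d₂ z r) := by
  rw [jac_mul_right]
  linear_combination u * jac_pow_mul_self (d₁ := d₁) (d₂ := d₂) z r e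

theorem jac_mul_pow (u v r : S) (e f : ℕ) :
    jac d₁ d₂ (u * r ^ e) (v * r ^ f) * r =
      r ^ e * r ^ f * (r * jac d₁ d₂ u v + f * v * jac d₁ d₂ u r - e * u * jac d₁ d₂ v r) := by
  have h1 := deriv_pow_mul_self d₁ r e
  have h2 := deriv_pow_mul_self d₂ r e
  have h3 := deriv_pow_mul_self d₁ r f
  have h4 := deriv_pow_mul_self d₂ r f
  have h5 : d₁ r * d₂ (r ^ f) = d₂ r * d₁ (r ^ f) := by
    simp only [Derivation.leibniz_pow, smul_eq_mul, nsmul_eq_mul]; ring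
  simp only [jac, Derivation.leibniz, smul_eq_mul]
  linear_combination (v * d₂ (r ^ f) * u + u * r ^ f * d₂ v) * h1 -
    (v * d₁ (r ^ f) * u + u * r ^ f * d₁ v) * h2 - r ^ e * v * d₂ u * h3 +
    r ^ e * v * d₁ u * h4 + u * v * e * r ^ e * h5

theorem exists_prod_mul_jac_left [IsLocalRing S] [DecidableEq S] (z g : S) (a : S → ℕ)
    (F : Finset S) (hF : ∀ t ∈ F, t ∈ maximalIdeal S) :
    ∃ E, (2 ≤ F.card → E ∈ maximalIdeal S) ∧
      (∏ t ∈ F, t) * jac d₁ d₂ z (g * ∏ t ∈ F, t ^ a t) = (∏ t ∈ F, t ^ a t) * E := by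
  induction F using Finset.induction_on with
  | empty => exact ⟨jac d₁ d₂ z g, by simp, by simp⟩
  | insert r F hr ih =>
    obtain ⟨E, hE, h⟩ := ih fun t ht ↦ hF t (Finset.mem_insert_of_mem ht)
    have hrm := hF r (Finset.mem_insert_self r F)
    refine ⟨r * E + a r * g * (∏ t ∈ F, t) * jac d₁ d₂ z r, fun h2 ↦ ?_, ?_⟩
    · rw [Finset.card_insert_of_notMem hr] at h2
      obtain ⟨t, ht⟩ := Finset.card_pos.1 (by omega : 0 < F.card)
      refine add_mem (Ideal.mul_mem_right _ _ hrm) (Ideal.mul_mem_right _ _ (Ideal.mul_mem_left _ _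
        ?_))
      exact Ideal.mem_of_dvd _ (Finset.dvd_prod_of_mem _ ht)
        (hF t (Finset.mem_insert_of_mem ht))
    · rw [Finset.prod_insert hr, Finset.prod_insert hr, mul_comm (r ^ a r), ← mul_assoc g]
      have := jac_mul_pow_right (d₁ := d₁) (d₂ := d₂) z (g * ∏ t ∈ F, t ^ a t) r (a r)
      linear_combination (∏ t ∈ F, t) * this + r ^ a r * r * h

/-- Logarithmic differentiation of monomials in several branches: the logarithmic Jacobian
determinant is a combination of products of all but two of the branches, so it is not a unit if
there are more than two. -/
theorem exists_prod_mul_jac [IsLocalRing S] [DecidableEq S] (g h : S) (a c : S → ℕ) (F : Finset S)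
    (hF : ∀ t ∈ F, t ∈ maximalIdeal S) :
    ∃ E, (3 ≤ F.card → E ∈ maximalIdeal S) ∧
      (∏ t ∈ F, t) * jac d₁ d₂ (g * ∏ t ∈ F, t ^ a t) (h * ∏ t ∈ F, t ^ c t) =
        (∏ t ∈ F, t ^ a t) * (∏ t ∈ F, t ^ c t) * E := by
  induction F using Finset.induction_on with
  | empty => exact ⟨jac d₁ d₂ g h, by simp, by simp⟩
  | insert r F hr ih =>
    have hF' : ∀ t ∈ F, t ∈ maximalIdeal S := fun t ht ↦ hF t (Finset.mem_insert_of_mem ht)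
    obtain ⟨E, hE, hE'⟩ := ih hF'
    obtain ⟨E₁, hE₁, hE₁'⟩ := exists_prod_mul_jac_left (d₁ := d₁) (d₂ := d₂) r g a F hF'
    obtain ⟨E₂, hE₂, hE₂'⟩ := exists_prod_mul_jac_left (d₁ := d₁) (d₂ := d₂) r h c F hF'
    have hrm := hF r (Finset.mem_insert_self r F)
    refine ⟨r * E + a r * g * E₂ - c r * h * E₁, fun h2 ↦ ?_, ?_⟩
    · rw [Finset.card_insert_of_notMem hr] at h2
      exact sub_mem (add_mem (Ideal.mul_mem_right _ _ hrm) (Ideal.mul_mem_left _ _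
        (hE₂ (by omega)))) (Ideal.mul_mem_left _ _ (hE₁ (by omega)))
    · rw [Finset.prod_insert hr, Finset.prod_insert hr, Finset.prod_insert hr,
        mul_comm (r ^ a r), mul_comm (r ^ c r), ← mul_assoc g, ← mul_assoc h]
      have := jac_mul_pow (d₁ := d₁) (d₂ := d₂) (g * ∏ t ∈ F, t ^ a t) (h * ∏ t ∈ F, t ^ c t) r
        (a r) (c r)
      rw [jac_swap d₁ d₂ _ r, jac_swap d₁ d₂ _ r] at this
      linear_combination (∏ t ∈ F, t) * this + r ^ a r * r ^ c r * r * hE' -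
        r ^ a r * r ^ c r * c r * h * (∏ t ∈ F, t ^ c t) * hE₁' +
        r ^ a r * r ^ c r * a r * g * (∏ t ∈ F, t ^ a t) * hE₂'

variable [IsDomain S]

/-- Extraction of the full powers of finitely many primes from a nonzero element. -/
theorem exists_eq_mul_prod_pow [WfDvdMonoid S] [DecidableEq S] (F : Finset S)
    (hF : ∀ t ∈ F, Prime t) (hne : ∀ t ∈ F, ∀ r ∈ F, t ∣ r → t = r) {u : S} (hu : u ≠ 0) :
    ∃ (a : S → ℕ) (g : S), (∀ t ∈ F, ¬ t ∣ g) ∧ u = g * ∏ t ∈ F, t ^ a t := by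
  induction F using Finset.induction_on with
  | empty => exact ⟨0, u, by simp, by simp⟩
  | insert r F hr ih =>
    obtain ⟨a, g, hg, rfl⟩ := ih (fun t ht ↦ hF t (Finset.mem_insert_of_mem ht))
      (fun t ht s hs ↦ hne t (Finset.mem_insert_of_mem ht) s (Finset.mem_insert_of_mem hs))
    have hg0 := left_ne_zero_of_mul hu
    obtain ⟨n, g', hg', rfl⟩ :=
      WfDvdMonoid.max_power_factor hg0 (hF r (Finset.mem_insert_self r F)).irreducible
    refine ⟨Function.update a r n, g', ?_, ?_⟩
    · intro t ht
      rcases Finset.mem_insert.1 ht with rfl | ht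
      · exact hg'
      · exact fun h ↦ hg t ht (h.mul_left _)
    · rw [Finset.prod_insert hr, Function.update_self]
      have : ∏ t ∈ F, t ^ Function.update a r n t = ∏ t ∈ F, t ^ a t := by
        refine Finset.prod_congr rfl fun t ht ↦ ?_
        rw [Function.update_of_ne (by rintro rfl; exact hr ht)]
      rw [this]; ring

theorem pow_dvd_prod_pow_mul_iff [DecidableEq S] {F : Finset S} (hF : ∀ t ∈ F, Prime t)
    (hne : ∀ t ∈ F, ∀ r ∈ F, t ∣ r → t = r) {a : S → ℕ} {g : S} {t : S} (ht : t ∈ F)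
    (hg : ¬ t ∣ g) (n : ℕ) : t ^ n ∣ g * ∏ r ∈ F, r ^ a r ↔ n ≤ a t := by
  have h1 : ∏ r ∈ F, r ^ a r = t ^ a t * ∏ r ∈ F.erase t, r ^ a r :=
    (Finset.mul_prod_erase F _ ht).symm
  rw [h1]
  constructor
  · intro h
    by_contra hlt
    have h2 : t ^ a t * t ∣ t ^ a t * (g * ∏ r ∈ F.erase t, r ^ a r) := by
      rw [← pow_succ]
      refine (pow_dvd_pow t (by omega)).trans (h.trans (dvd_of_eq ?_))
      ring
    have h3 := (mul_dvd_mul_iff_left (pow_ne_zero _ (hF t ht).ne_zero)).1 h2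
    rcases (hF t ht).dvd_or_dvd h3 with h4 | h4
    · exact hg h4
    · obtain ⟨r, hr, h5⟩ := (hF t ht).exists_mem_finset_dvd h4
      have h6 := hne t ht r (Finset.mem_of_mem_erase hr) ((hF t ht).dvd_of_dvd_pow h5)
      exact (Finset.ne_of_mem_erase hr) h6.symm
  · intro h
    exact ((pow_dvd_pow t h).mul_right _).mul_left _

/-- Monomiality criterion: if `u, v` are optimal along all branches of a curve that contains the
zeros of their Jacobian determinant, they have a monomial form. -/
theorem IsFrame.exists_form_of_isOptimal [IsLocalRing S] [UniqueFactorizationMonoid S]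
    (hF : IsFrame d₁ d₂) {u v : S} (hu : u ∈ maximalIdeal S) (hv : v ∈ maximalIdeal S)
    (hJ : jac d₁ d₂ u v ≠ 0) (T : Finset S) (hT : ∀ t ∈ T, Prime t)
    (hne : ∀ t ∈ T, ∀ r ∈ T, t ∣ r → t = r)
    (hopt : ∀ t ∈ T, IsOptimal (jac d₁ d₂ u v) t u v)
    (hall : ∀ t, Prime t → t ∣ jac d₁ d₂ u v → ∃ r ∈ T, Associated t r) :
    ∃ x y, IsRSP S x y ∧ (FormOne k u v x y ∨ FormTwo k u v x y) := by
  classical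
  have hu0 : u ≠ 0 := by rintro rfl; simp at hJ
  have hv0 : v ≠ 0 := by rintro rfl; simp at hJ
  have hTm : ∀ t ∈ T, t ∈ maximalIdeal S := fun t ht ↦ (hT t ht).not_isUnit
  obtain ⟨a, g, hg, hua⟩ := exists_eq_mul_prod_pow T hT hne hu0
  obtain ⟨c, h, hh, hvc⟩ := exists_eq_mul_prod_pow T hT hne hv0
  obtain ⟨n, j, hj, hJn⟩ := exists_eq_mul_prod_pow T hT hne hJ
  obtain ⟨E, hE, hE'⟩ := exists_prod_mul_jac (d₁ := d₁) (d₂ := d₂) g h a c T hTm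
  rw [← hua, ← hvc] at hE'
  have hju : IsUnit j := by
    by_contra hju
    have hj0 : j ≠ 0 := by rintro rfl; simp at hJn; exact hJ hJn
    obtain ⟨t, ht, htj⟩ := WfDvdMonoid.exists_irreducible_factor hju hj0
    obtain ⟨r, hr, htr⟩ := hall t ht.prime (hJn ▸ htj.mul_right _)
    exact hj r hr (htr.symm.dvd.trans htj)
  have hle : ∀ t ∈ T, n t + 1 ≤ a t + c t := by
    intro t ht
    have h1 := hopt t ht (n t + 1) (by
      rw [pow_succ', hJn]
      exact mul_dvd_mul_left _ ((pow_dvd_prod_pow_mul_iff hT hne ht (hj t ht) _).2 le_rfl))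
    have h2 : u * v = (g * h) * ∏ r ∈ T, r ^ ((a + c) r) := by
      rw [hua, hvc]; simp only [Pi.add_apply, pow_add, Finset.prod_mul_distrib]; ring
    rw [h2, pow_dvd_prod_pow_mul_iff hT hne ht] at h1
    · exact h1
    · exact fun h3 ↦ ((hT t ht).dvd_or_dvd h3).elim (hg t ht) (hh t ht)
  have hprod : ((∏ t ∈ T, t ^ a t) * ∏ t ∈ T, t ^ c t) =
      (∏ t ∈ T, t ^ (n t + 1)) * ∏ t ∈ T, t ^ (a t + c t - (n t + 1)) := by
    rw [← Finset.prod_mul_distrib, ← Finset.prod_mul_distrib]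
    refine Finset.prod_congr rfl fun t ht ↦ ?_
    rw [← pow_add, ← pow_add]
    congr 1
    have := hle t ht
    omega
  have hEu : IsUnit E := by
    have h1 : (∏ t ∈ T, t ^ (n t + 1)) * j =
        (∏ t ∈ T, t ^ (n t + 1)) * ((∏ t ∈ T, t ^ (a t + c t - (n t + 1))) * E) := by
      rw [← mul_assoc, ← hprod, ← hE', hJn]
      simp only [pow_succ, Finset.prod_mul_distrib]; ring
    have h2 := mul_left_cancel₀
      (Finset.prod_ne_zero_iff.2 fun t ht ↦ pow_ne_zero _ (hT t ht).ne_zero) h1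
    rw [h2] at hju
    exact isUnit_of_mul_isUnit_right hju
  have hcard : T.card ≤ 2 := by
    by_contra hlt
    exact (hE (by omega)) hEu
  interval_cases hTc : T.card
  · rw [Finset.card_eq_zero] at hTc
    subst hTc
    simp only [Finset.prod_empty, mul_one, one_mul] at hE'
    rw [← hE'] at hEu
    exact ⟨u, v, hF.isRSP_of_isUnit_jac hu hv hEu, Or.inl ⟨1, 1, 1, 0, 0, 1, by simp, by simp,
      by simp, not_ringChar_dvd_of_isUnit (S := S) (c := 1) (by simp)⟩⟩
  · obtain ⟨t, rfl⟩ := Finset.card_eq_one.1 hTc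
    simp only [Finset.prod_singleton] at hE' hua hvc
    have h1 : jac d₁ d₂ (g * t ^ a t) (h * t ^ c t) * t = E * t ^ (a t + c t) := by
      rw [← hua, ← hvc, pow_add]; linear_combination hE'
    rw [hua, hvc]
    exact hF.form_of_pow (hTm t (by simp)) (hT t (by simp)).ne_zero hEu h1
  · obtain ⟨x, y, hxy, rfl⟩ := Finset.card_eq_two.1 hTc
    rw [Finset.prod_pair hxy] at hua hvc
    simp only [Finset.prod_pair hxy] at hE'
    have h1 : jac d₁ d₂ (g * (x ^ a x * y ^ a y)) (h * (x ^ c x * y ^ c y)) * (x * y) =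
        E * (x ^ (a x + c x) * y ^ (a y + c y)) := by
      rw [← hua, ← hvc, pow_add, pow_add]; linear_combination hE'
    rw [hua, hvc]
    obtain ⟨h2, h3⟩ := hF.formOne (hTm x (by simp)) (hTm y (by simp)) (hT x (by simp)).ne_zero
      (hT y (by simp)).ne_zero hEu h1
    exact ⟨x, y, h2, Or.inl h3⟩

/-- Conversely, parameters in monomial form are optimal along all zeros of the Jacobian
determinant. -/
theorem IsFrame.isOptimal_of_form [IsLocalRing S] (hF : IsFrame d₁ d₂) {u v x y t : S}
    (h : IsRSP S x y) (hf : FormOne k u v x y ∨ FormTwo k u v x y) (ht : Prime t)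
    (htJ : t ∣ jac d₁ d₂ u v) : IsOptimal (jac d₁ d₂ u v) t u v := by
  have key : ∀ z ε, IsUnit ε → jac d₁ d₂ u v * z = ε * (u * v) → t ∣ z →
      IsOptimal (jac d₁ d₂ u v) t u v := by
    intro z ε hε he hz n hn
    have h1 : t ^ n ∣ ε * (u * v) := by
      rw [← he, mul_comm]; exact hn.trans (mul_dvd_mul_right hz _)
    exact hε.dvd_mul_left.1 h1
  rcases hf with hf | hf
  · obtain ⟨ε, hε, he⟩ := hF.jac_of_formOne h hf
    refine key _ ε hε he ?_
    obtain ⟨γ, δ, a, b, c, d, rfl, rfl, hγδ, hp⟩ := hf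
    have h1 : t ∣ (ε * (γ * δ)) * (x ^ (a + c) * y ^ (b + d)) := by
      refine (htJ.mul_right (x * y)).trans (dvd_of_eq ?_)
      rw [he]; ring
    have h2 := (hε.mul hγδ).dvd_mul_left.1 h1
    rcases ht.dvd_or_dvd h2 with h3 | h3
    · exact (ht.dvd_of_dvd_pow h3).mul_right _
    · exact (ht.dvd_of_dvd_pow h3).mul_left _
  · obtain ⟨ε, hε, he⟩ := hF.jac_of_formTwo h hf
    refine key _ ε hε he ?_
    obtain ⟨γ, δ, a, c, rfl, rfl, hγδ, -⟩ := hf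
    have h1 : t ∣ (ε * (γ * δ)) * x ^ (a + c) := by
      refine (htJ.mul_right x).trans (dvd_of_eq ?_)
      rw [he]; ring
    exact ht.dvd_of_dvd_pow ((hε.mul hγδ).dvd_mul_left.1 h1)

end Optimal

/-! ### Common optimal parameters -/

section Common

variable {k : Type u} [Field k] {R S : Type u} [CommRing R] [CommRing S] [Algebra k S]
  {d₁ d₂ : Derivation k S S} {φ : R →+* S} {J : S}

/-- `J` is, up to units, the Jacobian determinant of `φ` in any regular parameters of `R`, and it is
not zero. -/
structure IsJacobian (φ : R →+* S) (d₁ d₂ : Derivation k S S) (J : S) : Prop where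
  ne_zero : J ≠ 0
  associated : ∀ u v, IsRSP R u v → Associated J (jac d₁ d₂ (φ u) (φ v))

theorem IsJacobian.map_ne_zero_left [IsDomain S] (hJ : IsJacobian φ d₁ d₂ J) {u v : R}
    (h : IsRSP R u v) : φ u ≠ 0 := by
  intro h0
  have := hJ.associated u v h
  rw [h0, jac_zero_left] at this
  exact hJ.ne_zero (associated_zero_iff_eq_zero J |>.1 this)

theorem IsJacobian.map_ne_zero_right [IsDomain S] (hJ : IsJacobian φ d₁ d₂ J) {u v : R}
    (h : IsRSP R u v) : φ v ≠ 0 := hJ.map_ne_zero_left h.symm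

variable [IsDomain S] [IsLocalRing R] [IsLocalRing S] [IsLocalHom φ]

theorem map_mem_maximalIdeal {u : R} (h : u ∈ maximalIdeal R) : φ u ∈ maximalIdeal S :=
  fun hu ↦ h (isUnit_of_map_unit φ u hu)

theorem IsJacobian.exists_form [UniqueFactorizationMonoid S] (hJ : IsJacobian φ d₁ d₂ J)
    (hF : IsFrame d₁ d₂) {u v : R} (h : IsRSP R u v) (T : Finset S) (hT : ∀ t ∈ T, Prime t)
    (hne : ∀ t ∈ T, ∀ r ∈ T, t ∣ r → t = r)
    (hopt : ∀ t ∈ T, IsOptimal J t (φ u) (φ v))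
    (hall : ∀ t, Prime t → t ∣ J → ∃ r ∈ T, Associated t r) :
    ∃ x y, IsRSP S x y ∧ (FormOne k (φ u) (φ v) x y ∨ FormTwo k (φ u) (φ v) x y) := by
  have ha := hJ.associated u v h
  refine hF.exists_form_of_isOptimal (map_mem_maximalIdeal h.left_mem)
    (map_mem_maximalIdeal h.right_mem) (fun h0 ↦ hJ.ne_zero ?_) T hT hne
    (fun t ht ↦ (hopt t ht).of_associated ha) (fun t ht htJ ↦ hall t ht (htJ.trans ha.symm.dvd))
  rw [h0] at ha
  exact (associated_zero_iff_eq_zero J).1 ha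

theorem IsJacobian.isOptimal_of_form (hJ : IsJacobian φ d₁ d₂ J)
    (hF : IsFrame d₁ d₂) {u v : R} (h : IsRSP R u v) {x y t : S} (hxy : IsRSP S x y)
    (hf : FormOne k (φ u) (φ v) x y ∨ FormTwo k (φ u) (φ v) x y) (ht : Prime t) (htJ : t ∣ J) :
    IsOptimal J t (φ u) (φ v) := by
  have ha := hJ.associated u v h
  exact (hF.isOptimal_of_form hxy hf ht (htJ.trans ha.dvd)).of_associated ha.symm

theorem prime_dvd_monomial {t γ x y : S} (ht : Prime t) (hγ : IsUnit γ) {a b : ℕ}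
    (hx : Prime x) (hy : Prime y) (h : t ∣ γ * (x ^ a * y ^ b)) :
    (Associated t x ∧ x ∣ γ * (x ^ a * y ^ b)) ∨ (Associated t y ∧ y ∣ γ * (x ^ a * y ^ b)) := by
  rcases ht.dvd_or_dvd (hγ.dvd_mul_left.1 h) with h1 | h1
  · have h2 := ht.associated_of_dvd hx (ht.dvd_of_dvd_pow h1)
    exact Or.inl ⟨h2, h2.symm.dvd.trans h⟩
  · have h2 := ht.associated_of_dvd hy (ht.dvd_of_dvd_pow h1)
    exact Or.inr ⟨h2, h2.symm.dvd.trans h⟩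

open Classical in
/-- The case of two branches `xy = 0` containing the zeros of the Jacobian determinant, where `w`
is a monomial in `x, y`. -/
theorem IsJacobian.exists_form_of_monomial [UniqueFactorizationMonoid S]
    (hJ : IsJacobian φ d₁ d₂ J) (hF : IsFrame d₁ d₂) {u v : R} (h : IsRSP R u v) {x y γ w : S}
    (hxy : IsRSP S x y) (hγ : IsUnit γ) {a b : ℕ} (hw : w = γ * (x ^ a * y ^ b))
    (hall : ∀ t, Prime t → t ∣ J → t ∣ w)
    (hx : x ∣ w → IsOptimal J x (φ u) (φ v)) (hy : y ∣ w → IsOptimal J y (φ u) (φ v)) :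
    ∃ x y, IsRSP S x y ∧ (FormOne k (φ u) (φ v) x y ∨ FormTwo k (φ u) (φ v) x y) := by
  refine hJ.exists_form hF h (({x, y} : Finset S).filter (· ∣ w)) ?_ ?_ ?_ ?_
  · intro t ht
    simp only [Finset.mem_filter, Finset.mem_insert, Finset.mem_singleton] at ht
    rcases ht with ⟨rfl | rfl, -⟩
    exacts [hxy.prime_left, hxy.prime_right]
  · intro t ht r hr htr
    simp only [Finset.mem_filter, Finset.mem_insert, Finset.mem_singleton] at ht hr
    rcases ht with ⟨rfl | rfl, -⟩ <;> rcases hr with ⟨rfl | rfl, -⟩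
    exacts [rfl, (hxy.not_dvd htr).elim, (hxy.symm.not_dvd htr).elim, rfl]
  · intro t ht
    simp only [Finset.mem_filter, Finset.mem_insert, Finset.mem_singleton] at ht
    rcases ht with ⟨rfl | rfl, h2⟩
    exacts [hx h2, hy h2]
  · intro t ht htJ
    have h1 := hall t ht htJ
    rw [hw] at h1
    rcases prime_dvd_monomial ht hγ hxy.prime_left hxy.prime_right h1 with ⟨h2, h3⟩ | ⟨h2, h3⟩
    · exact ⟨x, by simpa [hw] using h3, h2⟩
    · exact ⟨y, by simpa [hw] using h3, h2⟩

/-- Two second parameters complementing the same first parameter `w`, which is a monomial in `x, y`: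
their orders of vanishing along `x = 0` and `y = 0` are comparable. -/
theorem pow_dvd_or_pow_dvd_of_compare [IsDomain R] {w v v' : R} (h : IsRSP R w v)
    (h' : IsRSP R w v') {x y γ : S} (hxy : IsRSP S x y) (hγ : IsUnit γ) {a b : ℕ}
    (hw : φ w = γ * (x ^ a * y ^ b)) {m n : ℕ} (hm : x ^ m ∣ φ v) (hn : y ^ n ∣ φ v') :
    y ^ n ∣ φ v ∨ x ^ m ∣ φ v' := by
  rcases h.compare h' with ⟨e, he, rfl⟩ | ⟨e, ε, s, he, hε, hs, rfl⟩
  · rw [map_mul] at hm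
    exact Or.inr ((he.map φ).dvd_mul_left.1 hm)
  have hws : φ ε * φ w ^ s = φ ε * γ ^ s * (x ^ (a * s) * y ^ (b * s)) := by
    rw [hw, mul_pow, mul_pow, pow_mul, pow_mul]; ring
  rw [map_add, map_mul, map_mul, map_pow, hws] at hm ⊢
  have hu : IsUnit (φ ε * γ ^ s) := (hε.map φ).mul (hγ.pow s)
  rcases Nat.lt_or_ge (b * s) n with hb | hb
  · right
    rcases Nat.lt_or_ge (a * s) m with ha | ha
    · -- now `φ v'` is divisible by `x ^ (a s) * y ^ (b s + 1)`, so `φ v` is a unit times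
      -- `x ^ (a s) * y ^ (b s)`, contradicting the divisibility by `x ^ m`
      exfalso
      have h1 : x ^ (a * s) ∣ φ v' := by
        have h2 : x ^ (a * s) ∣ φ e * φ v' :=
          (dvd_add_left (((dvd_mul_right _ _).mul_left _))).1 ((pow_dvd_pow x ha.le).trans hm)
        exact (he.map φ).dvd_mul_left.1 h2
      obtain ⟨c, hc⟩ := h1
      have h2 : y ^ (b * s + 1) ∣ c * x ^ (a * s) := by
        rw [mul_comm c, ← hc]; exact (pow_dvd_pow y hb).trans hn
      obtain ⟨c', rfl⟩ := hxy.prime_right.pow_dvd_of_dvd_mul_right _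
        (fun h3 ↦ hxy.symm.not_dvd (hxy.prime_right.dvd_of_dvd_pow h3)) h2
      have h3 : x ^ (a * s) * x ∣ x ^ (a * s) * ((φ ε * γ ^ s + y * (φ e * c')) * y ^ (b * s)) := by
        rw [← pow_succ]
        refine (pow_dvd_pow x ha).trans (hm.trans (dvd_of_eq ?_))
        rw [hc]; ring
      have h4 := (mul_dvd_mul_iff_left (pow_ne_zero _ hxy.prime_left.ne_zero)).1 h3
      rcases hxy.prime_left.dvd_or_dvd h4 with h5 | h5
      · have h6 : IsUnit (φ ε * γ ^ s + y * (φ e * c')) := by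
          refine isUnit_of_sub_mem hu ?_
          rw [sub_add_cancel_left]
          exact neg_mem (Ideal.mul_mem_right _ _ hxy.right_mem)
        exact hxy.prime_left.not_isUnit (isUnit_of_dvd_unit h5 h6)
      · exact hxy.not_dvd (hxy.prime_left.dvd_of_dvd_pow h5)
    · have h1 := (dvd_add_left (((pow_dvd_pow x ha).mul_right (y ^ (b * s))).mul_left
        (φ ε * γ ^ s))).1 hm
      exact (he.map φ).dvd_mul_left.1 h1
  · left
    exact dvd_add (hn.mul_left _) (((pow_dvd_pow y hb).mul_left _).mul_left _)

/-- If all parameters of `R` have images that are comparable with respect to divisibility, any two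
second parameters complementing the same first parameter have comparable images. -/
theorem dvd_or_dvd_of_compare [IsDomain R] {w v v' : R} (h : IsRSP R w v) (h' : IsRSP R w v')
    (hZ : ∀ s : ℕ, 1 ≤ s → φ w ^ s ∣ φ v' ∨ φ v' ∣ φ w ^ s) : φ v ∣ φ v' ∨ φ v' ∣ φ v := by
  rcases h.compare h' with ⟨e, he, rfl⟩ | ⟨e, ε, s, he, hε, hs, rfl⟩
  · rw [map_mul]
    exact Or.inr (dvd_mul_left _ _)
  rw [map_add, map_mul, map_mul, map_pow]
  rcases hZ s hs with ⟨c, hc⟩ | h1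
  · by_cases hcu : IsUnit c
    · obtain ⟨c', hc'⟩ := hcu.exists_left_inv
      have h1 : φ v' ∣ φ w ^ s := ⟨c', by rw [hc]; linear_combination (-(φ w ^ s)) * hc'⟩
      exact Or.inr (dvd_add (dvd_mul_left _ _) (h1.mul_left _))
    · left
      have hu : IsUnit (φ ε + φ e * c) := by
        refine isUnit_of_sub_mem (hε.map φ) ?_
        rw [sub_add_cancel_left]
        exact neg_mem (Ideal.mul_mem_left _ _ (by simpa using hcu))
      have : φ e * φ v' + φ ε * φ w ^ s = (φ ε + φ e * c) * φ w ^ s := by rw [hc]; ring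
      rw [this, hu.mul_left_dvd, hc]
      exact dvd_mul_right _ _
  · exact Or.inr (dvd_add (dvd_mul_left _ _) (h1.mul_left _))

/-- If `φ w` generates `𝔪_R S`, the first parameter of any regular system of parameters can be
replaced by `w` without decreasing the divisor of `u v`. -/
theorem exists_isRSP_mul_dvd [IsDomain R] {w u v : R} (h : IsRSP R u v) (hw : w ∉
    maximalIdeal R ^ 2) (hwm : w ∈ maximalIdeal R) (hwd : ∀ a ∈ maximalIdeal R, φ w ∣ φ a)
    (hZ : φ u ∣ φ v ∨ φ v ∣ φ u) :
    ∃ v', IsRSP R w v' ∧ φ (u * v) ∣ φ (w * v') := by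
  wlog hd : φ u ∣ φ v generalizing u v
  · obtain ⟨v', h1, h2⟩ := this h.symm hZ.symm (hZ.resolve_left hd)
    exact ⟨v', h1, by rwa [mul_comm u v]⟩
  obtain ⟨α, β, rfl⟩ := h.mem_iff.1 hwm
  have hdw : φ u ∣ φ (α * u + β * v) := by
    rw [map_add, map_mul, map_mul]
    exact dvd_add (dvd_mul_left _ _) (hd.mul_left _)
  by_cases hα : IsUnit α
  · exact ⟨v, h.of_unit_combination hα, by
      rw [map_mul, map_mul]; exact mul_dvd_mul_right hdw _⟩
  have hβ : IsUnit β := by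
    by_contra hβ
    refine hw (add_mem ?_ ?_)
    · rw [sq]; exact Ideal.mul_mem_mul (by simpa using hα) h.left_mem
    · rw [sq]; exact Ideal.mul_mem_mul (by simpa using hβ) h.right_mem
  refine ⟨u, by rw [add_comm]; exact h.symm.of_unit_combination hβ, ?_⟩
  -- here `φ w` is a unit multiple of `φ u` and of `φ v`
  have hvu : φ v ∣ φ (α * u + β * v) := by
    obtain ⟨c, hc⟩ := hd
    obtain ⟨e, he⟩ := hwd u h.left_mem
    rw [map_add, map_mul, map_mul, hc] at he
    by_cases hu0 : φ u = 0
    · rw [hc, map_add, map_mul, map_mul, hc, hu0]; simp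
    have h1 : IsUnit (φ α + φ β * c) := by
      refine IsUnit.of_mul_eq_one e (mul_left_cancel₀ hu0 ?_)
      linear_combination -he
    have h2 : IsUnit c := by
      have h3 : IsUnit (φ β * c) := by
        refine isUnit_of_sub_mem h1 ?_
        rw [add_sub_cancel_right]
        exact map_mem_maximalIdeal (by simpa using hα)
      exact isUnit_of_mul_isUnit_right h3
    rw [hc, h2.mul_right_dvd]
    exact hdw
  rw [mul_comm u v, map_mul, map_mul]
  exact mul_dvd_mul_right hvu _

open Classical in
/-- The case of a point outside the branch divisor, where all zeros of the Jacobian determinant lie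
on contracted curves. -/
theorem IsJacobian.exists_form_of_contracted [IsDomain R] [UniqueFactorizationMonoid S]
    (hJ : IsJacobian φ d₁ d₂ J) (hF : IsFrame d₁ d₂) (hR : ∃ u v, IsRSP R u v)
    (hm : ∀ t, Prime t → t ∣ J → ∀ a ∈ maximalIdeal R, t ∣ φ a)
    (hopt : ∀ t, Prime t → t ∣ J → ∃ u v, IsRSP R u v ∧ IsOptimal J t (φ u) (φ v))
    (hZ : ∀ w v, IsRSP R w v → ∀ s : ℕ, 1 ≤ s →
      (∃ s₁ ∈ maximalIdeal S, ∃ s₂ ∈ maximalIdeal S, φ w = s₁ * s₂) →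
      φ w ^ s ∣ φ v ∨ φ v ∣ φ w ^ s) :
    ∃ u v, IsRSP R u v ∧
      ∃ x y, IsRSP S x y ∧ (FormOne k (φ u) (φ v) x y ∨ FormTwo k (φ u) (φ v) x y) := by
  let _ : StrongNormalizationMonoid S := UniqueFactorizationMonoid.strongNormalizationMonoid
  set T : Finset S := (UniqueFactorizationMonoid.normalizedFactors J).toFinset
  have hTp : ∀ t ∈ T, Prime t ∧ t ∣ J ∧ normalize t = t := by
    intro t ht
    rw [Multiset.mem_toFinset] at ht
    exact ⟨UniqueFactorizationMonoid.prime_of_normalized_factor t ht,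
      UniqueFactorizationMonoid.dvd_of_mem_normalizedFactors ht,
      UniqueFactorizationMonoid.normalize_normalized_factor t ht⟩
  have hne : ∀ t ∈ T, ∀ r ∈ T, t ∣ r → t = r := by
    intro t ht r hr htr
    have h1 := (hTp t ht).1.associated_of_dvd (hTp r hr).1 htr
    rw [← (hTp t ht).2.2, ← (hTp r hr).2.2, normalize_eq_normalize_iff_associated]
    exact h1
  have hall : ∀ t, Prime t → t ∣ J → ∃ r ∈ T, Associated t r := by
    intro t ht htJ
    obtain ⟨r, hr, h⟩ := UniqueFactorizationMonoid.exists_mem_normalizedFactors_of_dvd hJ.ne_zero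
      ht.irreducible htJ
    exact ⟨r, Multiset.mem_toFinset.2 hr, h⟩
  -- it suffices to find common optimal parameters
  suffices ∃ u v, IsRSP R u v ∧ ∀ t ∈ T, IsOptimal J t (φ u) (φ v) by
    obtain ⟨u, v, h, ho⟩ := this
    exact ⟨u, v, h, hJ.exists_form hF h T (fun t ht ↦ (hTp t ht).1) hne ho hall⟩
  rcases Nat.lt_or_ge T.card 2 with hc | hc
  · rcases T.eq_empty_or_nonempty with h0 | ⟨t, ht⟩
    · obtain ⟨u, v, h⟩ := hR
      exact ⟨u, v, h, by simp [h0]⟩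
    · obtain ⟨u, v, h, ho⟩ := hopt t (hTp t ht).1 (hTp t ht).2.1
      refine ⟨u, v, h, fun r hr ↦ ?_⟩
      rw [Finset.card_le_one.1 (by omega) r hr t ht]
      exact ho
  obtain ⟨t₁, h₁, t₂, h₂, h12⟩ := Finset.one_lt_card.1 hc
  have hsq : ∀ a ∈ maximalIdeal R,
      ∃ s₁ ∈ maximalIdeal S, ∃ s₂ ∈ maximalIdeal S, φ a = s₁ * s₂ := by
    intro a ha
    obtain ⟨c, hc⟩ := hm t₁ (hTp t₁ h₁).1 (hTp t₁ h₁).2.1 a ha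
    obtain ⟨c', rfl⟩ : t₂ ∣ c := by
      have := hm t₂ (hTp t₂ h₂).1 (hTp t₂ h₂).2.1 a ha
      rw [hc] at this
      exact ((hTp t₂ h₂).1.dvd_or_dvd this).resolve_left fun h ↦ h12 (hne t₂ h₂ t₁ h₁ h).symm
    exact ⟨t₁, (hTp t₁ h₁).1.not_isUnit, t₂ * c',
      Ideal.mul_mem_right _ _ (hTp t₂ h₂).1.not_isUnit, hc⟩
  have hZ' : ∀ w v, IsRSP R w v → ∀ s : ℕ, 1 ≤ s → φ w ^ s ∣ φ v ∨ φ v ∣ φ w ^ s :=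
    fun w v h s hs ↦ hZ w v h s hs (hsq w h.left_mem)
  have hZ1 : ∀ w v, IsRSP R w v → φ w ∣ φ v ∨ φ v ∣ φ w := by
    intro w v h
    simpa using hZ' w v h 1 le_rfl
  obtain ⟨w, v₀, h₀, hwd⟩ : ∃ w v₀, IsRSP R w v₀ ∧ ∀ a ∈ maximalIdeal R, φ w ∣ φ a := by
    obtain ⟨u, v, h⟩ := hR
    have key : ∀ u v, IsRSP R u v → φ u ∣ φ v → ∀ a ∈ maximalIdeal R, φ u ∣ φ a := by
      intro u v h hd a ha
      obtain ⟨p, q, rfl⟩ := h.mem_iff.1 ha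
      rw [map_add, map_mul, map_mul]
      exact dvd_add (dvd_mul_left _ _) (hd.mul_left _)
    rcases hZ1 u v h with hd | hd
    · exact ⟨u, v, h, key u v h hd⟩
    · exact ⟨v, u, h.symm, key v u h.symm hd⟩
  have hw2 : w ∉ maximalIdeal R ^ 2 := by
    intro hw
    have := h₀.isNoetherianRing
    refine h₀.ne_span_singleton v₀ (le_antisymm ?_ ((Ideal.span_singleton_le_iff_mem _).2
      h₀.right_mem))
    refine Submodule.le_of_le_smul_of_le_jacobson_bot (I := maximalIdeal R)
      (IsNoetherian.noetherian _) (by rw [IsLocalRing.jacobson_eq_maximalIdeal _ bot_ne_top]) ?_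
    intro a ha
    obtain ⟨p, q, rfl⟩ := h₀.mem_iff.1 ha
    rw [add_comm]
    refine Submodule.add_mem_sup (Ideal.mul_mem_left _ _ (Ideal.mem_span_singleton_self _))
      (Ideal.mul_mem_left _ _ ?_)
    rwa [smul_eq_mul, ← sq]
  have hopt' : ∀ t ∈ T, ∃ v, IsRSP R w v ∧ IsOptimal J t (φ w) (φ v) := by
    intro t ht
    obtain ⟨u, v, h, ho⟩ := hopt t (hTp t ht).1 (hTp t ht).2.1
    obtain ⟨v', h', hd⟩ := exists_isRSP_mul_dvd (φ := φ) h hw2 h₀.left_mem hwd (hZ1 u v h)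
    exact ⟨v', h', ho.mono (by rw [← map_mul, ← map_mul]; exact hd)⟩
  -- a second parameter whose image is divisible by the chosen ones for all branches
  have key : ∀ F : Finset S, F ⊆ T → ∃ v, IsRSP R w v ∧ ∀ t ∈ F, IsOptimal J t (φ w) (φ v) := by
    intro F
    induction F using Finset.induction_on with
    | empty => exact fun _ ↦ ⟨v₀, h₀, by simp⟩
    | insert t F htF ih =>
      intro hsub
      obtain ⟨v, hv, hvo⟩ := ih fun r hr ↦ hsub (Finset.mem_insert_of_mem hr)
      obtain ⟨v', hv', hvo'⟩ := hopt' t (hsub (Finset.mem_insert_self t F))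
      rcases dvd_or_dvd_of_compare hv hv' (hZ' w v' hv') with hd | hd
      · refine ⟨v', hv', fun r hr ↦ ?_⟩
        rcases Finset.mem_insert.1 hr with rfl | hr
        · exact hvo'
        · exact (hvo r hr).mono (mul_dvd_mul_left _ hd)
      · refine ⟨v, hv, fun r hr ↦ ?_⟩
        rcases Finset.mem_insert.1 hr with rfl | hr
        · exact hvo'.mono (mul_dvd_mul_left _ hd)
        · exact hvo r hr
  obtain ⟨v, hv, ho⟩ := key T subset_rfl
  exact ⟨w, v, hv, ho⟩

/-- The case of a double point of the branch divisor. -/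
theorem IsJacobian.exists_form_of_double [UniqueFactorizationMonoid S]
    (hJ : IsJacobian φ d₁ d₂ J) (hF : IsFrame d₁ d₂) {u v : R} (h : IsRSP R u v) {x y γ : S}
    (hxy : IsRSP S x y) (hγ : IsUnit γ) {a b : ℕ} (hw : φ (u * v) = γ * (x ^ a * y ^ b))
    (hall : ∀ t, Prime t → t ∣ J → t ∣ φ (u * v))
    (hopt : ∀ t, Prime t → t ∣ J → IsOptimal J t (φ u) (φ v)) :
    ∃ x y, IsRSP S x y ∧ (FormOne k (φ u) (φ v) x y ∨ FormTwo k (φ u) (φ v) x y) := by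
  have key : ∀ t, Prime t → t ∣ φ (u * v) → IsOptimal J t (φ u) (φ v) := by
    intro t ht htw
    by_cases htJ : t ∣ J
    · exact hopt t ht htJ
    · exact isOptimal_of_not_dvd ht htJ (by rwa [map_mul] at htw)
  exact hJ.exists_form_of_monomial hF h hxy hγ hw hall (key x hxy.prime_left)
    (key y hxy.prime_right)

/-- The case of a simple point of the branch divisor. -/
theorem IsJacobian.exists_form_of_simple [IsDomain R] [UniqueFactorizationMonoid S]
    (hJ : IsJacobian φ d₁ d₂ J) (hF : IsFrame d₁ d₂) {u v₀ : R} (h₀ : IsRSP R u v₀) {x y γ : S}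
    (hxy : IsRSP S x y) (hγ : IsUnit γ) {a b : ℕ} (hw : φ u = γ * (x ^ a * y ^ b))
    (hall : ∀ t, Prime t → t ∣ J → t ∣ φ u)
    (hopt : ∀ t, Prime t → t ∣ J → ∃ v, IsRSP R u v ∧ IsOptimal J t (φ u) (φ v)) :
    ∃ v, IsRSP R u v ∧
      ∃ x y, IsRSP S x y ∧ (FormOne k (φ u) (φ v) x y ∨ FormTwo k (φ u) (φ v) x y) := by
  have key : ∀ t, Prime t → t ∣ φ u → ∃ v, IsRSP R u v ∧ IsOptimal J t (φ u) (φ v) := by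
    intro t ht htw
    by_cases htJ : t ∣ J
    · exact hopt t ht htJ
    · exact ⟨v₀, h₀, isOptimal_of_not_dvd ht htJ (htw.mul_right _)⟩
  suffices ∃ v, IsRSP R u v ∧ (x ∣ φ u → IsOptimal J x (φ u) (φ v)) ∧
      (y ∣ φ u → IsOptimal J y (φ u) (φ v)) by
    obtain ⟨v, h, h1, h2⟩ := this
    exact ⟨v, h, hJ.exists_form_of_monomial hF h hxy hγ hw hall h1 h2⟩
  by_cases hx : x ∣ φ u
  · obtain ⟨v, hv, ho⟩ := key x hxy.prime_left hx
    by_cases hy : y ∣ φ u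
    · obtain ⟨v', hv', ho'⟩ := key y hxy.prime_right hy
      obtain ⟨m, hm, hm'⟩ := ho.of_pow_dvd hxy.prime_left (hJ.map_ne_zero_right hv)
      obtain ⟨n, hn, hn'⟩ := ho'.of_pow_dvd hxy.prime_right (hJ.map_ne_zero_right hv')
      rcases pow_dvd_or_pow_dvd_of_compare hv hv' hxy hγ hw hm hn with h1 | h1
      · exact ⟨v, hv, fun _ ↦ ho, fun _ ↦ hn' _ h1⟩
      · exact ⟨v', hv', fun _ ↦ hm' _ h1, fun _ ↦ ho'⟩
    · exact ⟨v, hv, fun _ ↦ ho, fun h ↦ (hy h).elim⟩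
  · by_cases hy : y ∣ φ u
    · obtain ⟨v', hv', ho'⟩ := key y hxy.prime_right hy
      exact ⟨v', hv', fun h ↦ (hx h).elim, fun _ ↦ ho'⟩
    · exact ⟨v₀, h₀, fun h ↦ (hx h).elim, fun h ↦ (hy h).elim⟩

end Common

/-! ### Comparability of parameters in a normal birational extension -/

section Seidenberg

open Polynomial

variable {S L : Type u} [CommRing S] [IsDomain S] [IsLocalRing S] [IsIntegrallyClosed S] [Field L]
  [Algebra S L] [IsFractionRing S L]

/-- If neither `θ` nor `θ⁻¹` lies in the normal local domain `S`, all polynomials over `S` vanishing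
at `θ` have their coefficients in the maximal ideal. -/
theorem coeff_mem_maximalIdeal_of_aeval_eq_zero {θ : L}
    (h₁ : ∀ s : S, algebraMap S L s ≠ θ) (h₂ : ∀ s : S, algebraMap S L s * θ ≠ 1)
    (n : ℕ) (F : S[X]) (hn : F.natDegree ≤ n) (hF : aeval θ F = 0) (j : ℕ) :
    F.coeff j ∈ maximalIdeal S := by
  induction n generalizing F j with
  | zero =>
    rw [Polynomial.eq_C_of_natDegree_le_zero hn, aeval_C] at hF
    have h0 : F.coeff 0 = 0 := (IsFractionRing.injective S L) (by rw [hF, map_zero])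
    rw [Polynomial.eq_C_of_natDegree_le_zero hn, h0]
    simp
  | succ n ih =>
    rcases Nat.lt_or_ge n F.natDegree with hlt | hle
    · have hdeg : F.natDegree = n + 1 := by omega
      obtain ⟨b, hb⟩ := IsIntegrallyClosed.isIntegral_iff.1
        (isIntegral_leadingCoeff_smul F θ hF)
      rw [Algebra.smul_def] at hb
      have hlc : F.leadingCoeff = F.coeff (n + 1) := by rw [leadingCoeff, hdeg]
      have ha : F.coeff (n + 1) ∈ maximalIdeal S := by
        intro hu
        rw [← hlc] at hu
        obtain ⟨c, hc⟩ := hu.exists_left_inv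
        refine h₁ (c * b) ?_
        rw [map_mul, hb, ← mul_assoc, ← map_mul, hc, map_one, one_mul]
      have hbm : b ∈ maximalIdeal S := by
        intro hu
        obtain ⟨c, hc⟩ := hu.exists_left_inv
        refine h₂ (c * F.leadingCoeff) ?_
        rw [map_mul, mul_assoc, ← hb, ← map_mul, hc, map_one]
      set G : S[X] := F.eraseLead + C b * X ^ n
      have hG : aeval θ G = 0 := by
        have h3 := F.eraseLead_add_C_mul_X_pow
        rw [← h3, hdeg] at hF
        simp only [map_add, map_mul, aeval_C, map_pow, aeval_X] at hF
        simp only [G, map_add, map_mul, aeval_C, map_pow, aeval_X]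
        rw [hb, ← hF]
        ring
      have hGd : G.natDegree ≤ n := by
        refine (natDegree_add_le _ _).trans (max_le ?_ (natDegree_C_mul_X_pow_le b n))
        have := F.eraseLead_natDegree_le
        omega
      have hGc := ih G hGd hG j
      by_cases hj : j = n + 1
      · rw [hj]; exact ha
      · have h4 : G.coeff j = F.coeff j + b * (if j = n then 1 else 0) := by
          simp only [G, coeff_add, coeff_C_mul, coeff_X_pow]
          rw [eraseLead_coeff_of_ne _ (by rw [hdeg]; exact hj)]
        have h5 : F.coeff j = G.coeff j - b * (if j = n then 1 else 0) := by rw [h4]; ring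
        rw [h5]
        exact sub_mem hGc (Ideal.mul_mem_right _ _ hbm)
    · exact ih F hle hF j

variable {T : Type u} [CommRing T] [IsLocalRing T]

/-- The weighted powers of the maximal ideal `(w, v)`, where `w` has weight one and `v` has
weight `s`. -/
def weightedPow (w v : T) (s n : ℕ) : Ideal T :=
  Ideal.span (Set.range fun j : Fin (n + 1) ↦ w ^ (n - s * j) * v ^ (j : ℕ))

theorem monomial_mem_weightedPow (w v : T) {s n i j : ℕ} (hs : 1 ≤ s) (h : n ≤ i + s * j) :
    w ^ i * v ^ j ∈ weightedPow w v s n := by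
  rcases Nat.lt_or_ge j (n + 1) with hj | hj
  · have h1 : w ^ (n - s * j) * v ^ j ∈ weightedPow w v s n :=
      Ideal.subset_span ⟨⟨j, hj⟩, rfl⟩
    refine Ideal.mem_of_dvd _ (mul_dvd_mul_right (pow_dvd_pow w ?_) _) h1
    omega
  · have h1 : w ^ (n - s * n) * v ^ n ∈ weightedPow w v s n :=
      Ideal.subset_span ⟨⟨n, by omega⟩, rfl⟩
    have h2 : n - s * n = 0 := Nat.sub_eq_zero_of_le (Nat.le_mul_of_pos_left n hs)
    rw [h2, pow_zero, one_mul] at h1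
    exact Ideal.mem_of_dvd _ ((pow_dvd_pow v (by omega)).mul_left _) h1

theorem weightedPow_le {w v : T} (hw : w ∈ maximalIdeal T) (hv : v ∈ maximalIdeal T) {s : ℕ}
    (hs : 1 ≤ s) (n : ℕ) : weightedPow w v s (s * n) ≤ maximalIdeal T ^ n := by
  rw [weightedPow, Ideal.span_le]
  rintro _ ⟨⟨j, hj⟩, rfl⟩
  have h1 : w ^ (s * n - s * j) * v ^ j ∈ maximalIdeal T ^ (s * n - s * j + j) := by
    rw [pow_add]
    exact Ideal.mul_mem_mul (Ideal.pow_mem_pow hw _) (Ideal.pow_mem_pow hv _)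
  refine Ideal.pow_le_pow_right ?_ h1
  rw [← Nat.mul_sub]
  have := Nat.le_mul_of_pos_left (n - j) hs
  omega

theorem exists_weightedPow_expansion [IsNoetherianRing T] {w v : T}
    (hm : Ideal.span {w, v} = maximalIdeal T) {s : ℕ} (hs : 1 ≤ s) {t : T} (ht : t ≠ 0) :
    ∃ (n : ℕ) (c : Fin (n + 1) → T), t = ∑ j, c j * (w ^ (n - s * j) * v ^ (j : ℕ)) ∧
      ∃ j, IsUnit (c j * w ^ (s * j - n)) := by
  classical
  have hw : w ∈ maximalIdeal T := by rw [← hm]; exact Ideal.subset_span (by simp)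
  have hv : v ∈ maximalIdeal T := by rw [← hm]; exact Ideal.subset_span (by simp)
  have hex : ∃ n, t ∉ weightedPow w v s n := by
    by_contra! hall
    refine ht ?_
    rw [← Ideal.mem_bot, ← Ideal.iInf_pow_eq_bot_of_isLocalRing _ (maximalIdeal.isMaximal T).ne_top]
    exact Submodule.mem_iInf _ |>.2 fun n ↦ weightedPow_le hw hv hs n (hall _)
  obtain ⟨n, hn, hn'⟩ : ∃ n, t ∈ weightedPow w v s n ∧ t ∉ weightedPow w v s (n + 1) := by
    have h0 : Nat.find hex ≠ 0 := by
      intro h0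
      refine (h0 ▸ Nat.find_spec hex : t ∉ weightedPow w v s 0) ?_
      have := monomial_mem_weightedPow w v (n := 0) (i := 0) (j := 0) hs (by omega)
      simpa using Ideal.mul_mem_left _ t this
    obtain ⟨n, hn⟩ := Nat.exists_eq_succ_of_ne_zero h0
    exact ⟨n, not_not.1 (Nat.find_min hex (by omega)), by
      rw [← Nat.succ_eq_add_one, ← hn]; exact Nat.find_spec hex⟩
  obtain ⟨c, rfl⟩ := (Ideal.mem_span_range_iff_exists_fun).1 hn
  refine ⟨n, c, rfl, ?_⟩
  by_contra! hnu
  refine hn' (sum_mem fun j _ ↦ ?_)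
  rcases Nat.lt_or_ge n (s * j) with hj | hj
  · exact Ideal.mul_mem_left _ _ (monomial_mem_weightedPow w v hs (by omega))
  · have h1 : c j ∈ Ideal.span {w, v} := by
      rw [hm]
      have := hnu j
      rwa [Nat.sub_eq_zero_of_le hj, pow_zero, mul_one] at this
    obtain ⟨α, β, h2⟩ := Ideal.mem_span_pair.1 h1
    have h3 : c j * (w ^ (n - s * j) * v ^ (j : ℕ)) =
        α * (w ^ (n - s * j + 1) * v ^ (j : ℕ)) + β * (w ^ (n - s * j) * v ^ ((j : ℕ) + 1)) := by
      rw [← h2]; ring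
    rw [h3]
    refine add_mem (Ideal.mul_mem_left _ _ (monomial_mem_weightedPow w v hs (by omega)))
      (Ideal.mul_mem_left _ _ (monomial_mem_weightedPow w v hs ?_))
    rw [mul_add]
    omega

/-- Every nonzero element of `T` is a power of `w` times a primitive polynomial expression in
`θ = v / w ^ s`. -/
theorem exists_eq_pow_mul_aeval [IsNoetherianRing T] [Algebra T S] {w v : T}
    (hm : Ideal.span {w, v} = maximalIdeal T) {s : ℕ} (hs : 1 ≤ s) {θ : L}
    (hθ : algebraMap S L (algebraMap T S w) ^ s * θ = algebraMap S L (algebraMap T S v))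
    {t : T} (ht : t ≠ 0) :
    ∃ (n : ℕ) (F : S[X]), (∃ j, IsUnit (F.coeff j)) ∧
      algebraMap S L (algebraMap T S t) =
        algebraMap S L (algebraMap T S w) ^ n * aeval θ F := by
  obtain ⟨n, c, h, j, hj⟩ := exists_weightedPow_expansion hm hs ht
  refine ⟨n, ∑ i : Fin (n + 1), C (algebraMap T S (c i * w ^ (s * i - n))) * X ^ (i : ℕ),
    ⟨j, ?_⟩, ?_⟩
  · have : (∑ i : Fin (n + 1), C (algebraMap T S (c i * w ^ (s * i - n))) * X ^ (i : ℕ)).coeff j =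
        algebraMap T S (c j * w ^ (s * j - n)) := by
      rw [finsetSum_coeff, Finset.sum_eq_single j]
      · rw [coeff_C_mul_X_pow, if_pos rfl]
      · intro i _ hi
        rw [coeff_C_mul_X_pow, if_neg]
        exact fun h ↦ hi (Fin.ext h.symm)
      · simp
    rw [this]
    exact hj.map _
  · rw [h, map_sum, map_sum, map_sum, Finset.mul_sum]
    refine Finset.sum_congr rfl fun i _ ↦ ?_
    simp only [map_mul, map_pow, aeval_C, aeval_X, ← hθ]
    rw [mul_pow, ← pow_mul]
    generalize algebraMap S L (algebraMap T S w) = W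
    have : W ^ (n - s * i) * W ^ (s * (i : ℕ)) = W ^ n * W ^ (s * i - n) := by
      rw [← pow_add, ← pow_add]; congr 1; omega
    linear_combination (algebraMap S L (algebraMap T S (c i)) * θ ^ (i : ℕ)) * this

theorem exists_isUnit_coeff_iff {F : S[X]} :
    (∃ j, IsUnit (F.coeff j)) ↔ F.map (residue S) ≠ 0 := by
  rw [Ne, Polynomial.ext_iff]
  push Not
  simp only [coeff_map, coeff_zero, ne_eq, residue_eq_zero_iff, mem_maximalIdeal, mem_nonunits_iff,
    not_not]

/-- Let `T ⊆ S` be a birational local extension with `S` normal and `𝔪_T = (w, v)`. If the divisor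
of `w` on `S` is not prime, `w ^ s` and `v` are comparable with respect to divisibility in `S`:
otherwise every element of `𝔪_S` has positive weight, which is impossible for both factors of an
element `w` of weight one. -/
theorem pow_dvd_or_dvd_pow_of_eq_mul [IsNoetherianRing T] [Algebra T S]
    (hfrac : ∀ a : S, a ≠ 0 → ∃ t t' : T, t ≠ 0 ∧ t' ≠ 0 ∧ a * algebraMap T S t' = algebraMap T S t)
    {w v : T} (hm : Ideal.span {w, v} = maximalIdeal T)
    (hw0 : algebraMap T S w ≠ 0) (hwm : algebraMap T S w ∈ maximalIdeal S) {s : ℕ} (hs : 1 ≤ s)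
    {s₁ s₂ : S} (h₁ : s₁ ∈ maximalIdeal S) (h₂ : s₂ ∈ maximalIdeal S)
    (h : algebraMap T S w = s₁ * s₂) :
    algebraMap T S w ^ s ∣ algebraMap T S v ∨ algebraMap T S v ∣ algebraMap T S w ^ s := by
  let L := FractionRing S
  have hinj := IsFractionRing.injective S L
  have hW0 : algebraMap S L (algebraMap T S w) ≠ 0 := fun h0 ↦ hw0 (hinj (by rw [h0, map_zero]))
  by_contra! hcon
  obtain ⟨hc1, hc2⟩ := hcon
  set θ : L := algebraMap S L (algebraMap T S v) / algebraMap S L (algebraMap T S w) ^ s with hθd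
  have hθ : algebraMap S L (algebraMap T S w) ^ s * θ = algebraMap S L (algebraMap T S v) :=
    mul_div_cancel₀ _ (pow_ne_zero _ hW0)
  have hθ₁ : ∀ a : S, algebraMap S L a ≠ θ := by
    rintro a ha
    refine hc1 ⟨a, hinj ?_⟩
    rw [map_mul, map_pow, ha, hθ]
  have hθ₂ : ∀ a : S, algebraMap S L a * θ ≠ 1 := by
    rintro a ha
    refine hc2 ⟨a, hinj ?_⟩
    rw [map_mul, map_pow, ← hθ]
    linear_combination (-algebraMap S L (algebraMap T S w) ^ s) * ha
  have key : ∀ F G : S[X], (∃ j, IsUnit (F.coeff j)) → ∀ a ∈ maximalIdeal S,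
      aeval θ F ≠ algebraMap S L a * aeval θ G := by
    rintro F G ⟨j, hj⟩ a ha he
    have h3 : aeval θ (F - C a * G) = 0 := by
      rw [map_sub, map_mul, aeval_C, he, sub_self]
    have h4 := coeff_mem_maximalIdeal_of_aeval_eq_zero hθ₁ hθ₂ _ _ le_rfl h3 j
    rw [coeff_sub, coeff_C_mul] at h4
    have h5 := add_mem h4 (Ideal.mul_mem_right (G.coeff j) _ ha)
    rw [sub_add_cancel] at h5
    exact h5 hj
  have hne : ∀ F : S[X], (∃ j, IsUnit (F.coeff j)) → aeval θ F ≠ 0 := by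
    intro F hF
    simpa using key F 0 hF 0 (zero_mem _)
  -- elements of the maximal ideal of `S` have positive weight
  have hrep : ∀ a ∈ maximalIdeal S, a ≠ 0 → ∃ (n : ℕ) (F G : S[X]), (∃ j, IsUnit (F.coeff j)) ∧
      (∃ j, IsUnit (G.coeff j)) ∧ algebraMap S L a * aeval θ G =
        algebraMap S L (algebraMap T S w) ^ (n + 1) * aeval θ F := by
    intro a ha ha0
    obtain ⟨t, t', ht, ht', h3⟩ := hfrac a ha0
    obtain ⟨n, F, hF, h4⟩ := exists_eq_pow_mul_aeval hm hs hθ ht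
    obtain ⟨n', G, hG, h5⟩ := exists_eq_pow_mul_aeval hm hs hθ ht'
    have h6 : algebraMap S L a * (algebraMap S L (algebraMap T S w) ^ n' * aeval θ G) =
        algebraMap S L (algebraMap T S w) ^ n * aeval θ F := by
      rw [← h4, ← h5, ← map_mul, h3]
    rcases Nat.lt_or_ge n' n with hn | hn
    · obtain ⟨m, rfl⟩ := Nat.exists_eq_add_of_lt hn
      refine ⟨m, F, G, hF, hG, mul_left_cancel₀ (pow_ne_zero n' hW0) ?_⟩
      linear_combination h6
    · obtain ⟨m, rfl⟩ := Nat.exists_eq_add_of_le hn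
      refine (key F G hF (a * algebraMap T S w ^ m) (Ideal.mul_mem_right _ _ ha) ?_).elim
      refine mul_left_cancel₀ (pow_ne_zero n hW0) ?_
      rw [← h6, map_mul, map_pow]
      ring
  obtain ⟨n₁, F₁, G₁, hF₁, hG₁, e₁⟩ := hrep s₁ h₁ (by rintro rfl; simp at h; exact hw0 h)
  obtain ⟨n₂, F₂, G₂, hF₂, hG₂, e₂⟩ := hrep s₂ h₂ (by rintro rfl; simp at h; exact hw0 h)
  refine key (G₁ * G₂) (F₁ * F₂) ?_ (algebraMap T S w ^ (n₁ + n₂ + 1))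
    (Ideal.pow_mem_of_mem _ hwm _ (by omega)) ?_
  · rw [exists_isUnit_coeff_iff, Polynomial.map_mul]
    exact mul_ne_zero (exists_isUnit_coeff_iff.1 hG₁) (exists_isUnit_coeff_iff.1 hG₂)
  · refine mul_left_cancel₀ hW0 ?_
    have h7 : algebraMap S L (algebraMap T S w) = algebraMap S L s₁ * algebraMap S L s₂ := by
      rw [h, map_mul]
    rw [map_mul, map_mul, map_pow]
    nth_rewrite 1 [h7]
    linear_combination e₁ * (algebraMap S L s₂ * aeval θ G₂) +
      algebraMap S L (algebraMap T S w) ^ (n₁ + 1) * aeval θ F₁ * e₂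

end Seidenberg

/-! ### Purity of the branch locus -/

section Purity

open Polynomial TensorProduct

theorem isIntegral_of_isIntegral_smul {R K L : Type u} [CommRing R] [IsDomain R]
    [UniqueFactorizationMonoid R] [Field K] [Field L] [Algebra R K] [IsFractionRing R K]
    [Algebra K L] [Algebra R L] [IsScalarTower R K L] [FiniteDimensional K L] {x r : R}
    (hx : Prime x) (hr : ¬ x ∣ r) {z : L} (h₁ : IsIntegral R (x • z)) (h₂ : IsIntegral R (r • z)) :
    IsIntegral R z := by
  have hz : IsIntegral K z := Algebra.IsIntegral.isIntegral z
  have hinj := IsFractionRing.injective R K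
  have key : ∀ a : R, a ≠ 0 → IsIntegral R (a • z) → ∀ i, ∃ α : R, (minpoly K z).coeff i *
      algebraMap R K a ^ ((minpoly K z).natDegree - i) = algebraMap R K α := by
    intro a ha h i
    have h3 := IsIntegrallyClosed.minpoly_smul (R := K)
      (fun h0 ↦ ha (hinj (by rw [h0, map_zero])) : algebraMap R K a ≠ 0) hz
    rw [algebraMap_smul, minpoly.isIntegrallyClosed_eq_field_fractions' K h] at h3
    have h4 := congrArg (fun p ↦ coeff p i) h3
    simp only [coeff_map, coeff_scaleRoots] at h4
    exact ⟨_, h4.symm⟩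
  have hlift : minpoly K z ∈ lifts (algebraMap R K) := by
    rw [lifts_iff_coeff_lifts]
    intro i
    obtain ⟨α, hα⟩ := key x hx.ne_zero h₁ i
    obtain ⟨β, hβ⟩ := key r (by rintro rfl; simp at hr) h₂ i
    set m := (minpoly K z).natDegree - i
    have h3 : α * r ^ m = β * x ^ m := by
      refine hinj ?_
      rw [map_mul, map_mul, map_pow, map_pow, ← hα, ← hβ]
      ring
    obtain ⟨c, rfl⟩ := hx.pow_dvd_of_dvd_mul_right m (fun h ↦ hr (hx.dvd_of_dvd_pow h))
      (show x ^ m ∣ α * r ^ m from h3 ▸ dvd_mul_left _ _)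
    refine ⟨c, ?_⟩
    have h4 : algebraMap R K x ^ m ≠ 0 :=
      pow_ne_zero _ fun h0 ↦ hx.ne_zero (hinj (by rw [h0, map_zero]))
    refine mul_right_cancel₀ h4 ?_
    rw [hα, map_mul, map_pow, mul_comm]
  obtain ⟨p, hp, -, hpm⟩ := lifts_and_natDegree_eq_and_monic hlift (minpoly.monic hz)
  refine ⟨p, hpm, ?_⟩
  have := minpoly.aeval K z
  rwa [← hp, aeval_map_algebraMap] at this

/-- The integral closure of a two-dimensional regular local ring in a finite separable extension of
its fraction field is free: for regular parameters `x, y` it has no `y`-torsion modulo `x`. -/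
theorem IsRSP.free_integralClosure (R K L C : Type u) [CommRing R] [IsDomain R] [IsLocalRing R]
    [Field K] [Field L] [CommRing C] [Algebra R K] [IsFractionRing R K] [Algebra K L] [Algebra R L]
    [IsScalarTower R K L] [FiniteDimensional K L] [Algebra R C] [Algebra C L] [IsScalarTower R C L]
    [IsIntegralClosure C R L] [Module.Finite R C] {x y : R} (h : IsRSP R x y) :
    Module.Free R C := by
  have := h.isNoetherianRing
  have := h.uniqueFactorizationMonoid
  have hCL : Function.Injective (algebraMap C L) := IsIntegralClosure.algebraMap_injective C R L
  have hRL : Function.Injective (algebraMap R L) := by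
    rw [IsScalarTower.algebraMap_eq R K L]
    exact (algebraMap K L).injective.comp (IsFractionRing.injective R K)
  have : Module.FinitePresentation R C := Module.finitePresentation_of_finite R C
  have hxm : x ∈ (⊥ : Ideal R).jacobson := by
    rw [IsLocalRing.jacobson_eq_maximalIdeal _ bot_ne_top]
    exact h.left_mem
  have hreg : IsSMulRegular C x := by
    intro a b hab
    refine hCL (mul_left_cancel₀ (show algebraMap R L x ≠ 0 from fun h0 ↦
      h.prime_left.ne_zero (hRL (by rw [h0, map_zero]))) ?_)
    have := congrArg (algebraMap C L) hab
    simpa only [Algebra.smul_def, map_mul, ← IsScalarTower.algebraMap_apply] using this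
  rw [← Module.free_quotSMulTop_iff_free R C hxm hreg]
  have hxp : (Ideal.span {x}).IsPrime := (Ideal.span_singleton_prime h.prime_left.ne_zero).2
    h.prime_left
  have : IsDomain (R ⧸ Ideal.span {x}) := Ideal.Quotient.isDomain _
  have : IsLocalRing (R ⧸ Ideal.span {x}) :=
    IsLocalRing.of_surjective' (Ideal.Quotient.mk _) Ideal.Quotient.mk_surjective
  have : IsPrincipalIdealRing (R ⧸ Ideal.span {x}) := by
    refine ((tfae_of_isNoetherianRing_of_isLocalRing_of_isDomain (R ⧸ Ideal.span {x})).out 0 4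
      rfl rfl).2 ⟨Ideal.Quotient.mk _ y, le_antisymm ?_ ?_⟩
    · intro z hz
      obtain ⟨z, rfl⟩ := Ideal.Quotient.mk_surjective z
      have hzm : z ∈ maximalIdeal R := fun hu ↦ hz (hu.map _)
      obtain ⟨p, q, rfl⟩ := h.mem_iff.1 hzm
      refine Submodule.mem_span_singleton.2 ⟨Ideal.Quotient.mk _ q, ?_⟩
      rw [smul_eq_mul, ← map_mul, Ideal.Quotient.eq]
      exact Ideal.mem_span_singleton.2 ⟨-p, by ring⟩
    · rw [Submodule.span_singleton_le_iff_mem]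
      intro hu
      have h3 : IsLocalHom (Ideal.Quotient.mk (Ideal.span {x})) :=
        IsLocalHom.of_surjective _ Ideal.Quotient.mk_surjective
      exact h.right_mem (isUnit_of_map_unit _ _ hu)
  have : Module.Finite (R ⧸ Ideal.span {x}) (QuotSMulTop x C) :=
    Module.Finite.of_restrictScalars_finite R _ _
  have : Module.IsTorsionFree (R ⧸ Ideal.span {x}) (QuotSMulTop x C) := by
    refine .of_smul_eq_zero ?_
    intro r m hrm
    obtain ⟨r, rfl⟩ := Ideal.Quotient.mk_surjective r
    obtain ⟨c, rfl⟩ := Submodule.Quotient.mk_surjective _ m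
    by_cases hr : x ∣ r
    · exact Or.inl (Ideal.Quotient.eq_zero_iff_dvd _ _ |>.2 hr)
    right
    have h3 : (Submodule.Quotient.mk (r • c) : QuotSMulTop x C) = 0 := hrm
    rw [Submodule.Quotient.mk_eq_zero, Submodule.mem_smul_pointwise_iff_exists] at h3 ⊢
    obtain ⟨d, -, hd⟩ := h3
    have hx0 : algebraMap R L x ≠ 0 := fun h0 ↦ h.prime_left.ne_zero (hRL (by rw [h0, map_zero]))
    obtain ⟨e, he⟩ : ∃ e : C, algebraMap C L e = algebraMap C L c / algebraMap R L x := by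
      refine (IsIntegralClosure.isIntegral_iff (A := C)).1
        (isIntegral_of_isIntegral_smul (K := K) h.prime_left hr ?_ ?_)
      · rw [Algebra.smul_def, mul_div_cancel₀ _ hx0]
        exact (IsIntegralClosure.isIntegral_iff (A := C)).2 ⟨c, rfl⟩
      · refine (IsIntegralClosure.isIntegral_iff (A := C)).2 ⟨d, ?_⟩
        have h4 := congrArg (algebraMap C L) hd
        simp only [Algebra.smul_def, map_mul, ← IsScalarTower.algebraMap_apply] at h4
        rw [Algebra.smul_def, ← mul_div_assoc, ← h4, mul_div_cancel_left₀ _ hx0]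
    refine ⟨e, trivial, hCL ?_⟩
    rw [Algebra.smul_def, map_mul, ← IsScalarTower.algebraMap_apply, he, mul_div_cancel₀ _ hx0]
  infer_instance

variable {R C : Type u} [CommRing R] [CommRing C] [Algebra R C]

/-- If `s` annihilates the differentials, a power of `s` is the value of an element of `C ⊗ C` that
annihilates the ideal of the diagonal. -/
theorem exists_mul_ideal_eq_zero_of_smul_eq_zero [IsNoetherianRing R] [Module.Finite R C] {s : R}
    (hs : ∀ ω : Ω[C⁄R], s • ω = 0) :
    ∃ (n : ℕ) (c : C ⊗[R] C), (∀ i ∈ KaehlerDifferential.ideal R C, c * i = 0) ∧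
      Algebra.TensorProduct.lmul' R c = algebraMap R C (s ^ n) := by
  set I := KaehlerDifferential.ideal R C
  set a : C ⊗[R] C := algebraMap R (C ⊗[R] C) s
  have : IsNoetherianRing (C ⊗[R] C) := .of_finite R _
  have hfin : Module.Finite (C ⊗[R] C) I := Module.IsNoetherian.finite _ _
  have hI : ∀ i : I, a * (i : C ⊗[R] C) ∈ I ^ 2 := by
    intro i
    have h1 : s • (show Ω[C⁄R] from I.toCotangent i) = 0 := hs _
    have h2 : I.toCotangent (a • i) = 0 := by
      rw [map_smul]
      have : a • (show Ω[C⁄R] from I.toCotangent i) = s • (show Ω[C⁄R] from I.toCotangent i) :=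
        algebraMap_smul _ _ _
      exact this.trans h1
    rw [Ideal.toCotangent_eq_zero] at h2
    exact h2
  obtain ⟨p, hpm, -, hpc, hp0⟩ :=
    LinearMap.exists_monic_and_natDegree_eq_and_coeff_mem_pow_and_aeval_eq_zero (C ⊗[R] C)
      (algebraMap (C ⊗[R] C) (Module.End (C ⊗[R] C) I) a) I (by
        rintro _ ⟨i, rfl⟩
        rw [Submodule.mem_smul_top_iff]
        have := hI i
        rw [sq] at this
        exact this)
  refine ⟨p.natDegree, p.eval a, ?_, ?_⟩
  · intro i hi
    rw [aeval_algebraMap_apply] at hp0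
    have := congrArg (fun f : Module.End (C ⊗[R] C) I ↦ ((f ⟨i, hi⟩ : I) : C ⊗[R] C)) hp0
    simpa using this
  · have h1 : p.map (Algebra.TensorProduct.lmul' R (S := C)).toRingHom = X ^ p.natDegree := by
      ext k
      rw [coeff_map, coeff_X_pow]
      split_ifs with hk
      · rw [hk, coeff_natDegree, hpm.leadingCoeff, map_one]
      · rcases Nat.lt_or_ge k p.natDegree with hlt | hge
        · have h2 := Ideal.pow_le_self (by omega : p.natDegree - k ≠ 0) (hpc k)
          exact h2
        · rw [coeff_eq_zero_of_natDegree_lt (by omega), map_zero]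
    have h2 : Algebra.TensorProduct.lmul' R (p.eval a) =
        (p.map (Algebra.TensorProduct.lmul' R (S := C)).toRingHom).eval
          ((Algebra.TensorProduct.lmul' R (S := C)).toRingHom a) := by
      rw [Polynomial.eval_map, eval₂_at_apply]; rfl
    rw [h2, h1, eval_pow, eval_X, map_pow]
    congr 1
    exact (Algebra.TensorProduct.lmul' R (S := C)).commutes s

theorem Module.Free.exists_smul_eq_of_prime {M : Type*} [AddCommGroup M] [Module R M]
    [IsDomain R] [Module.Free R M] {π s : R} (hπ : Prime π) (hs : ¬ π ∣ s) {m m' : M}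
    (h : s • m = π • m') : ∃ m'', m = π • m'' := by
  let b := Module.Free.chooseBasis R M
  have h1 : ∀ i, π ∣ b.repr m i := by
    intro i
    have h2 := congrArg (fun m ↦ b.repr m i) h
    simp only [map_smul, Finsupp.smul_apply, smul_eq_mul] at h2
    exact (hπ.dvd_or_dvd (Dvd.intro _ h2.symm)).resolve_left hs
  choose g hg using h1
  refine ⟨∑ i ∈ (b.repr m).support, g i • b i, ?_⟩
  rw [Finset.smul_sum]
  conv_lhs => rw [← b.linearCombination_repr m, Finsupp.linearCombination_apply, Finsupp.sum]
  refine Finset.sum_congr rfl fun i _ ↦ ?_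
  rw [hg, mul_smul]

/-- A finite free algebra over a factorial domain that is unramified in codimension one is
unramified: from an element of `C ⊗ C` annihilating the ideal of the diagonal, with value `s ∈ R`,
all prime factors of `s` can be divided out. -/
theorem formallyUnramified_of_forall_prime [IsDomain R] [IsNoetherianRing R]
    [UniqueFactorizationMonoid R] [Module.Finite R C] [Module.Free R C]
    (h0 : ∃ s : R, s ≠ 0 ∧ ∀ ω : Ω[C⁄R], s • ω = 0)
    (hπ : ∀ π : R, Prime π → ∃ s : R, ¬ π ∣ s ∧ ∀ ω : Ω[C⁄R], s • ω = 0) :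
    Algebra.FormallyUnramified R C := by
  set I := KaehlerDifferential.ideal R C
  have hbase : ∀ (r : R) (c : C ⊗[R] C), Algebra.TensorProduct.lmul' R (r • c) =
      algebraMap R C r * Algebra.TensorProduct.lmul' R c := by
    intro r c; rw [map_smul, Algebra.smul_def]
  have hann : ∀ c : C ⊗[R] C, (∀ i ∈ I, c * i = 0) → ∀ r : R,
      Algebra.TensorProduct.lmul' R c = algebraMap R C r → ∀ e : C ⊗[R] C, (∀ i ∈ I, e * i = 0) →
      e * c = r • e := by
    intro c _ r hr e he
    have h1 : c - algebraMap R (C ⊗[R] C) r ∈ I := by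
      change Algebra.TensorProduct.lmul' R (c - algebraMap R (C ⊗[R] C) r) = 0
      rw [map_sub, hr, AlgHom.commutes, sub_self]
    have h2 := he _ h1
    rw [mul_sub, sub_eq_zero] at h2
    rw [h2, Algebra.smul_def, mul_comm]
  have key : ∀ s : R, s ≠ 0 → (∃ c : C ⊗[R] C, (∀ i ∈ I, c * i = 0) ∧
      Algebra.TensorProduct.lmul' R c = algebraMap R C s) →
      ∃ c : C ⊗[R] C, (∀ i ∈ I, c * i = 0) ∧ Algebra.TensorProduct.lmul' R c = 1 := by
    intro s
    induction s using UniqueFactorizationMonoid.induction_on_prime with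
    | h₁ => exact fun h ↦ (h rfl).elim
    | h₂ s hs =>
      rintro - ⟨c, hc, hcs⟩
      obtain ⟨r, hr⟩ := hs.exists_left_inv
      refine ⟨r • c, fun i hi ↦ by rw [smul_mul_assoc, hc i hi, smul_zero], ?_⟩
      rw [hbase, hcs, ← map_mul, hr, map_one]
    | h₃ s π hs hp ih =>
      rintro - ⟨c, hc, hcs⟩
      refine ih hs ?_
      obtain ⟨t, ht, htω⟩ := hπ π hp
      obtain ⟨n, c₂, hc₂, hc₂t⟩ := exists_mul_ideal_eq_zero_of_smul_eq_zero htω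
      have htn : ¬ π ∣ t ^ n := fun h ↦ ht (hp.dvd_of_dvd_pow h)
      -- both sides agree as `c * c₂` can be computed in two ways
      have h1 : t ^ n • c = π • (s • c₂) := by
        rw [← hann c₂ hc₂ _ hc₂t c hc, mul_comm, hann c hc _ hcs c₂ hc₂, mul_smul]
      obtain ⟨d, rfl⟩ := Module.Free.exists_smul_eq_of_prime hp htn h1
      refine ⟨d, fun i hi ↦ ?_, ?_⟩
      · have h2 := hc i hi
        rw [smul_mul_assoc] at h2
        exact (smul_eq_zero_iff_right hp.ne_zero).1 h2
      · rw [hbase, map_mul] at hcs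
        have h3 : π • (Algebra.TensorProduct.lmul' R d - algebraMap R C s) = 0 := by
          rw [smul_sub, Algebra.smul_def, Algebra.smul_def, hcs, sub_self]
        exact sub_eq_zero.1 ((smul_eq_zero_iff_right hp.ne_zero).1 h3)
  obtain ⟨s, hs0, hs⟩ := h0
  obtain ⟨n, c, hc, hcs⟩ := exists_mul_ideal_eq_zero_of_smul_eq_zero hs
  obtain ⟨c, hc, hc1⟩ := key (s ^ n) (pow_ne_zero _ hs0) ⟨c, hc, hcs⟩
  rw [Algebra.FormallyUnramified.iff_exists_tensorProduct]
  refine ⟨c, fun a ↦ ?_, hc1⟩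
  rw [mul_comm]
  exact hc _ (KaehlerDifferential.one_smul_sub_smul_one_mem_ideal R a)

/-- If all primes over `p` are unramified, some element outside `p` annihilates the
differentials. -/
theorem exists_notMem_smul_eq_zero [Module.Finite R C] (p : Ideal R) [p.IsPrime]
    (h : ∀ q : Ideal C, ∀ [q.IsPrime], q.comap (algebraMap R C) = p →
      Algebra.IsUnramifiedAt R q) : ∃ s ∉ p, ∀ ω : Ω[C⁄R], s • ω = 0 := by
  by_contra! hcon
  have hle : (Module.annihilator C (Ω[C⁄R])).comap (algebraMap R C) ≤ p := by
    intro s hs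
    by_contra hsp
    obtain ⟨ω, hω⟩ := hcon s hsp
    refine hω ?_
    have := Module.mem_annihilator.1 (Ideal.mem_comap.1 hs) ω
    rwa [algebraMap_smul] at this
  obtain ⟨q, hq, hqp, hqc⟩ := Ideal.exists_ideal_over_prime_of_isIntegral p _ hle
  have h1 : (⟨q, hqp⟩ : PrimeSpectrum C) ∈ Algebra.unramifiedLocus R C := h q hqc
  rw [Algebra.unramifiedLocus_eq_compl_support] at h1
  exact h1 (Module.mem_support_iff_of_finite.2 hq)

end Purity

section Comparability

/-- At a point of a normal surface that is not on the branch divisor, parameters are comparable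
unless the divisor of the first is prime. By purity of the branch locus, the normalization `C`
is unramified over `R`, so the parameters of `R` are parameters of a local ring of `C`. -/
theorem IsRSP.pow_dvd_or_dvd_pow {R S K L : Type u} [CommRing R] [IsDomain R] [IsLocalRing R]
    [CommRing S] [IsDomain S] [IsLocalRing S] [IsIntegrallyClosed S] [Algebra R S]
    [IsLocalHom (algebraMap R S)] [Field K] [Field L] [Algebra R K] [IsFractionRing R K]
    [Algebra S L] [IsFractionRing S L] [Algebra R L] [IsScalarTower R S L] [Algebra K L]
    [IsScalarTower R K L] [FiniteDimensional K L] [Algebra.IsSeparable K L]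
    (hunr : ∀ π : R, Prime π → ∀ q : Ideal (integralClosure R L), ∀ [q.IsPrime],
      q.comap (algebraMap R (integralClosure R L)) = Ideal.span {π} → Algebra.IsUnramifiedAt R q)
    {w v : R} (h : IsRSP R w v) {s : ℕ} (hs : 1 ≤ s)
    (hw : ∃ s₁ ∈ maximalIdeal S, ∃ s₂ ∈ maximalIdeal S, algebraMap R S w = s₁ * s₂) :
    algebraMap R S w ^ s ∣ algebraMap R S v ∨ algebraMap R S v ∣ algebraMap R S w ^ s := by
  have := h.isNoetherianRing
  have := h.uniqueFactorizationMonoid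
  let C := integralClosure R L
  have : Module.Finite R C := IsIntegralClosure.finite R K L C
  have : Module.Free R C := IsRSP.free_integralClosure R K L C h
  have hRL : Function.Injective (algebraMap R L) := by
    rw [IsScalarTower.algebraMap_eq R K L]
    exact (algebraMap K L).injective.comp (IsFractionRing.injective R K)
  have hRS : Function.Injective (algebraMap R S) := by
    rw [IsScalarTower.algebraMap_eq R S L] at hRL
    exact Function.Injective.of_comp hRL
  have hunr' : ∀ π : R, Prime π → ∃ s : R, ¬ π ∣ s ∧ ∀ ω : Ω[C⁄R], s • ω = 0 := by
    intro π hπ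
    have := (Ideal.span_singleton_prime hπ.ne_zero).2 hπ
    obtain ⟨s, hs, hs'⟩ := exists_notMem_smul_eq_zero (C := C) (Ideal.span {π})
      fun q _ hq ↦ hunr π hπ q hq
    exact ⟨s, fun hd ↦ hs (Ideal.mem_span_singleton.2 hd), hs'⟩
  have hfu : Algebra.FormallyUnramified R C := by
    refine formallyUnramified_of_forall_prime ?_ hunr'
    obtain ⟨s, hs, hs'⟩ := hunr' w h.prime_left
    exact ⟨s, by rintro rfl; simp at hs, hs'⟩
  -- the homomorphism from the integral closure to the normal domain `S`
  have hCS : ∀ c : C, ∃ a : S, algebraMap S L a = c := fun c ↦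
    IsIntegrallyClosed.isIntegral_iff.1 (IsIntegral.tower_top (R := R) c.2)
  have hSL := IsFractionRing.injective S L
  let g : C →ₐ[R] S :=
    { toFun := fun c ↦ (hCS c).choose
      map_one' := hSL (by rw [(hCS 1).choose_spec, map_one]; rfl)
      map_zero' := hSL (by rw [(hCS 0).choose_spec, map_zero]; rfl)
      map_mul' := fun a b ↦ hSL (by
        rw [map_mul, (hCS _).choose_spec, (hCS _).choose_spec, (hCS _).choose_spec]; rfl)
      map_add' := fun a b ↦ hSL (by
        rw [map_add, (hCS _).choose_spec, (hCS _).choose_spec, (hCS _).choose_spec]; rfl)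
      commutes' := fun r ↦ hSL (by
        rw [(hCS _).choose_spec, ← IsScalarTower.algebraMap_apply]; rfl) }
  have hg : ∀ c : C, algebraMap S L (g c) = c := fun c ↦ (hCS c).choose_spec
  let m : Ideal C := (maximalIdeal S).comap g.toRingHom
  let T := Localization.AtPrime m
  let gT : T →+* S := IsLocalization.lift (M := m.primeCompl) (g := g.toRingHom) fun a ↦ by
    by_contra hu
    exact a.2 hu
  have hgT : ∀ c : C, gT (algebraMap C T c) = g c := fun c ↦ IsLocalization.lift_eq _ c
  let _ : Algebra T S := gT.toAlgebra
  have hRT : ∀ r : R, algebraMap T S (algebraMap R T r) = algebraMap R S r := by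
    intro r
    rw [IsScalarTower.algebraMap_apply R C T]
    exact (hgT _).trans (g.commutes r)
  have hgTl : IsLocalHom gT := by
    refine ⟨fun a ha ↦ ?_⟩
    obtain ⟨c, d, rfl⟩ := IsLocalization.exists_mk'_eq m.primeCompl a
    rw [IsLocalization.AtPrime.isUnit_mk'_iff T m c d]
    intro hc
    have h1 := IsLocalization.mk'_spec T c d
    have h2 := congrArg gT h1
    rw [map_mul, hgT, hgT] at h2
    have h3 : IsUnit (g d) := by by_contra hu; exact d.2 hu
    exact hc (h2 ▸ ha.mul h3)
  have hloc : IsLocalHom (algebraMap R T) := by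
    refine ⟨fun r hr ↦ isUnit_of_map_unit (algebraMap R S) r ?_⟩
    rw [← hRT]
    exact hr.map (algebraMap T S)
  have : IsNoetherianRing C := .of_finite R _
  have : IsNoetherianRing T := IsLocalization.isNoetherianRing m.primeCompl T inferInstance
  have : Algebra.FormallyUnramified C T := .of_isLocalization m.primeCompl
  have : Algebra.FormallyUnramified R T := .comp R C T
  have : Algebra.EssFiniteType C T := .of_isLocalization T m.primeCompl
  have : Algebra.EssFiniteType R T := .comp R C T
  have hmT : Ideal.span {algebraMap R T w, algebraMap R T v} = maximalIdeal T := by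
    rw [← Algebra.FormallyUnramified.map_maximalIdeal (R := R) (S := T), ← h.span, Ideal.map_span,
      Set.image_pair]
  obtain ⟨s₁, h₁, s₂, h₂, hw⟩ := hw
  rw [← hRT, ← hRT] at *
  refine pow_dvd_or_dvd_pow_of_eq_mul ?_ hmT ?_ ?_ hs h₁ h₂ hw
  · intro a ha
    have hCfrac : IsFractionRing C L := IsIntegralClosure.isFractionRing_of_finite_extension R K L C
    obtain ⟨c, d, hd, hcd⟩ := IsFractionRing.div_surjective (A := C) (algebraMap S L a)
    have hd0 : d ≠ 0 := nonZeroDivisors.ne_zero hd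
    have hinj : Function.Injective (algebraMap C T) :=
      IsLocalization.injective T m.primeCompl_le_nonZeroDivisors
    have hdL : algebraMap C L d ≠ 0 := fun h0 ↦ hd0 (IsFractionRing.injective C L
      (by rw [h0, map_zero]))
    have h3 : a * g d = g c := by
      refine hSL ?_
      rw [map_mul, ← hcd, hg, hg]
      exact div_mul_cancel₀ _ hdL
    refine ⟨algebraMap C T c, algebraMap C T d, ?_, ?_, ?_⟩
    · intro h0
      have hc0 : c = 0 := hinj (by rw [h0, map_zero])
      rw [hc0, map_zero, zero_div] at hcd
      exact ha (hSL (by rw [← hcd, map_zero]))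
    · intro h0
      exact hd0 (hinj (by rw [h0, map_zero]))
    · exact (congrArg (a * ·) (hgT d)).trans (h3.trans (hgT c).symm)
  · rw [hRT]
    intro h0
    exact h.prime_left.ne_zero (hRS (by rw [h0, map_zero]))
  · rw [hRT]
    exact map_mem_maximalIdeal h.left_mem

end Comparability

/-! ### Orders along prime divisors and tame ramification -/

section Order

variable {S V : Type u} [CommRing S] [IsDomain S] [CommRing V] [IsLocalRing V] [Algebra S V]
  {t : S}

theorem maximalIdeal_eq_span_of_isLocalization {P : Ideal S} [P.IsPrime]
    [IsLocalization.AtPrime V P] (hP : P = Ideal.span {t}) :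
    maximalIdeal V = Ideal.span {algebraMap S V t} := by
  rw [← IsLocalization.AtPrime.map_eq_maximalIdeal P V]
  conv_lhs => rw [hP]
  rw [Ideal.map_span, Set.image_singleton]

theorem algebraMap_mem_maximalIdeal_pow_iff {P : Ideal S} [P.IsPrime]
    [IsLocalization.AtPrime V P] (hP : P = Ideal.span {t}) (ht : Prime t) (s : S) (n : ℕ) :
    algebraMap S V s ∈ maximalIdeal V ^ n ↔ t ^ n ∣ s := by
  have hM : P.primeCompl ≤ nonZeroDivisors S := P.primeCompl_le_nonZeroDivisors
  rw [maximalIdeal_eq_span_of_isLocalization hP, Ideal.span_singleton_pow,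
    Ideal.mem_span_singleton]
  constructor
  · rintro ⟨c, hc⟩
    obtain ⟨b, a, rfl⟩ := IsLocalization.exists_mk'_eq P.primeCompl c
    rw [← map_pow, IsLocalization.mul_mk'_eq_mk'_of_mul, IsLocalization.eq_mk'_iff_mul_eq,
      ← map_mul] at hc
    have h := IsLocalization.injective V hM hc
    refine ht.pow_dvd_of_dvd_mul_right n ?_ (h ▸ dvd_mul_right _ _ : t ^ n ∣ s * (a : S))
    exact fun hd ↦ a.2 ((Ideal.ext_iff.1 hP _).2 (Ideal.mem_span_singleton.2 hd))
  · rintro ⟨c, rfl⟩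
    exact ⟨algebraMap S V c, by rw [map_mul, map_pow]⟩

theorem idealOrder_span_algebraMap {P : Ideal S} [P.IsPrime]
    [IsLocalization.AtPrime V P] (hP : P = Ideal.span {t}) (ht : Prime t) {s : S} {n : ℕ}
    (h : t ^ n ∣ s) (h' : ¬ t ^ (n + 1) ∣ s) :
    idealOrder V (Ideal.span {algebraMap S V s}) = n := by
  have : {m : ℕ | Ideal.span {algebraMap S V s} ≤ maximalIdeal V ^ m} = Set.Iic n := by
    ext m
    rw [Set.mem_ofPred_eq, Ideal.span_singleton_le_iff_mem,
      algebraMap_mem_maximalIdeal_pow_iff hP ht, Set.mem_Iic]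
    constructor
    · intro hm
      by_contra hlt
      exact h' ((pow_dvd_pow t (by omega)).trans hm)
    · exact fun hm ↦ (pow_dvd_pow t hm).trans h
  rw [idealOrder, this, csSup_Iic]

theorem exists_pow_dvd_and_not [WfDvdMonoid S] (ht : Prime t) {s : S} (hs : s ≠ 0) :
    ∃ n, t ^ n ∣ s ∧ ¬ t ^ (n + 1) ∣ s := by
  obtain ⟨n, g, hg, rfl⟩ := WfDvdMonoid.max_power_factor hs ht.irreducible
  refine ⟨n, dvd_mul_right _ _, fun h ↦ hg ?_⟩
  rw [pow_succ] at h
  exact (mul_dvd_mul_iff_left (pow_ne_zero _ ht.ne_zero)).1 h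

end Order

section Frame

variable {k : Type u} [Field k] {S V : Type u} [CommRing S] [Algebra k S] [CommRing V]
  [Algebra k V] [Algebra S V] [IsScalarTower k S V] {d₁ d₂ : Derivation k S S}

/-- Expansion of a derivation in a frame. -/
theorem IsFrame.derivation_apply (hF : IsFrame d₁ d₂) :
    ∃ x y : S, IsRSP S x y ∧ ∀ {M : Type u} [AddCommGroup M] [Module k M] [Module S M]
      [IsScalarTower k S M] (D : Derivation k S M) (a : S), D a = d₁ a • D x + d₂ a • D y := by
  obtain ⟨x, y, hxy, h1, h2, h3, h4⟩ := hF.exists_dual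
  refine ⟨x, y, hxy, fun {M} _ _ _ _ D a ↦ ?_⟩
  obtain ⟨p, q, hpq⟩ := (hF.coordinates x y hxy).exists_coeff a
  have e1 := hpq d₁
  have e2 := hpq d₂
  simp only [h1, h2, h3, h4, smul_eq_mul, mul_one, mul_zero, add_zero, zero_add] at e1 e2
  rw [e1, e2, hpq D]

/-- A derivation of a localization vanishes if it vanishes on two elements whose Jacobian
determinant is invertible. -/
theorem IsFrame.derivation_eq_zero (hF : IsFrame d₁ d₂) (N : Submonoid S) [IsLocalization N V]
    {M : Type u} [AddCommGroup M] [Module k M] [Module V M] [IsScalarTower k V M]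
    (D : Derivation k V M) {a b : S} (ha : D (algebraMap S V a) = 0)
    (hb : D (algebraMap S V b) = 0) (hu : IsUnit (algebraMap S V (jac d₁ d₂ a b))) (c : V) :
    D c = 0 := by
  obtain ⟨x, y, hxy, hD⟩ := hF.derivation_apply
  have hcV : Coordinates k (algebraMap S V x) (algebraMap S V y) :=
    (hF.coordinates x y hxy).localization N
  let _ : Module S M := Module.compHom M (algebraMap S V)
  have : IsScalarTower S V M := .of_algebraMap_smul fun _ _ ↦ rfl
  have : IsScalarTower k S M := by
    refine .of_algebraMap_smul fun r m ↦ ?_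
    rw [← algebraMap_smul V, ← IsScalarTower.algebraMap_apply, algebraMap_smul]
  have hDS : ∀ a : S, D (algebraMap S V a) = algebraMap S V (d₁ a) • D (algebraMap S V x) +
      algebraMap S V (d₂ a) • D (algebraMap S V y) := fun a ↦ hD (D.compAlgebraMap S) a
  rw [hDS] at ha hb
  have hx : D (algebraMap S V x) = 0 := by
    refine hu.smul_left_cancel.1 ?_
    rw [smul_zero]
    have e1 : algebraMap S V (jac d₁ d₂ a b) • D (algebraMap S V x) =
        algebraMap S V (d₂ b) • (algebraMap S V (d₁ a) • D (algebraMap S V x) +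
          algebraMap S V (d₂ a) • D (algebraMap S V y)) - algebraMap S V (d₂ a) •
        (algebraMap S V (d₁ b) • D (algebraMap S V x) +
          algebraMap S V (d₂ b) • D (algebraMap S V y)) := by
      rw [jac, map_sub, map_mul, map_mul]
      module
    rw [e1, ha, hb, smul_zero, smul_zero, sub_zero]
  have hy : D (algebraMap S V y) = 0 := by
    refine hu.smul_left_cancel.1 ?_
    rw [smul_zero]
    have e1 : algebraMap S V (jac d₁ d₂ a b) • D (algebraMap S V y) =
        algebraMap S V (d₁ a) • (algebraMap S V (d₁ b) • D (algebraMap S V x) +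
          algebraMap S V (d₂ b) • D (algebraMap S V y)) - algebraMap S V (d₁ b) •
        (algebraMap S V (d₁ a) • D (algebraMap S V x) +
          algebraMap S V (d₂ a) • D (algebraMap S V y)) := by
      rw [jac, map_sub, map_mul, map_mul]
      module
    rw [e1, ha, hb, smul_zero, smul_zero, sub_zero]
  obtain ⟨p, q, hpq⟩ := hcV.exists_coeff c
  rw [hpq D, hx, hy, smul_zero, smul_zero, add_zero]

end Frame

section Tame

open Polynomial

variable {k : Type u} [Field k] {R S : Type u} [CommRing R] [CommRing S] [Algebra k R]
  [Algebra k S] [Algebra R S] [IsScalarTower k R S] {d₁ d₂ : Derivation k S S}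

/-- The derivation `jac t ·`. -/
def jacDeriv (d₁ d₂ : Derivation k S S) (t : S) : Derivation k S S := d₁ t • d₂ - d₂ t • d₁

theorem jacDeriv_apply (t a : S) : jacDeriv d₁ d₂ t a = jac d₁ d₂ t a := by
  simp only [jacDeriv, jac, Derivation.sub_apply, Derivation.smul_apply, smul_eq_mul]; ring

theorem dvd_deriv_eval₂_sub {D : Derivation k S S} {t : S} (hR : ∀ r : R, t ∣ D (algebraMap R S r))
    (F : R[X]) (y : S) :
    t ∣ D (F.eval₂ (algebraMap R S) y) - F.derivative.eval₂ (algebraMap R S) y * D y := by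
  induction F using Polynomial.induction_on' with
  | add p q hp hq =>
    simp only [eval₂_add, map_add]
    convert dvd_add hp hq using 1
    ring
  | monomial n a =>
    rw [derivative_monomial, eval₂_monomial, eval₂_monomial, Derivation.leibniz,
      Derivation.leibniz_pow]
    simp only [smul_eq_mul, nsmul_eq_mul, map_mul, map_natCast]
    convert (hR a).mul_left (y ^ n) using 1
    ring

variable [IsDomain S]

/-- For a prime `t` with `u = t ^ a g`, optimality of `u, v` along `t = 0` means that neither the
ramification index `a` nor the derivative of `v` along `t = 0` vanishes. -/
theorem isOptimal_iff_of_eq_pow_mul {t g v : S} (ht : Prime t) {a : ℕ} (ha : a ≠ 0)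
    (hg : ¬ t ∣ g) (hv : ¬ t ∣ v) :
    IsOptimal (jac d₁ d₂ (t ^ a * g) v) t (t ^ a * g) v ↔
      ¬ ringChar k ∣ a ∧ ¬ t ∣ jac d₁ d₂ t v := by
  have hJ : jac d₁ d₂ (t ^ a * g) v * t =
      t ^ a * (a * g * jac d₁ d₂ t v + t * jac d₁ d₂ g v) := by
    have := jac_pow d₁ d₂ ht.ne_zero g v a 0
    simp only [pow_zero, mul_one, add_zero, Nat.cast_zero, zero_mul] at this
    rw [mul_comm (t ^ a)]
    exact this
  have huv : ∀ n, t ^ n ∣ t ^ a * g * v ↔ n ≤ a := by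
    intro n
    constructor
    · intro h
      by_contra hlt
      have h1 : t ^ a * t ∣ t ^ a * (g * v) := by
        rw [← pow_succ, ← mul_assoc]; exact (pow_dvd_pow t (by omega)).trans h
      exact (ht.dvd_or_dvd ((mul_dvd_mul_iff_left (pow_ne_zero _ ht.ne_zero)).1 h1)).elim hg hv
    · intro h
      exact ((pow_dvd_pow t h).mul_right g).mul_right v
  have h1 : IsOptimal (jac d₁ d₂ (t ^ a * g) v) t (t ^ a * g) v ↔
      ¬ t ∣ a * g * jac d₁ d₂ t v + t * jac d₁ d₂ g v := by
    have h2 : t ^ (a + 1) ∣ t * jac d₁ d₂ (t ^ a * g) v ↔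
        t ∣ a * g * jac d₁ d₂ t v + t * jac d₁ d₂ g v := by
      rw [mul_comm t, hJ, pow_succ, mul_dvd_mul_iff_left (pow_ne_zero _ ht.ne_zero)]
    rw [← h2]
    constructor
    · intro h h3
      exact absurd ((huv _).1 (h _ h3)) (by omega)
    · intro h n hn
      rw [huv]
      by_contra hlt
      exact h ((pow_dvd_pow t (by omega)).trans hn)
  rw [h1, dvd_add_left (dvd_mul_right _ _), ht.dvd_mul, ht.dvd_mul]
  have h3 : t ∣ (a : S) ↔ ringChar k ∣ a := by
    rw [← CharP.cast_eq_zero_iff k]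
    constructor
    · intro h
      by_contra h0
      refine ht.not_isUnit (isUnit_of_dvd_unit h ?_)
      rw [← map_natCast (algebraMap k S)]
      exact (IsUnit.mk0 _ h0).map _
    · intro h
      rw [← map_natCast (algebraMap k S), h, map_zero]
      exact dvd_zero _
  rw [h3]
  tauto

/-- In characteristic zero, an element of the maximal ideal that does not vanish along `t = 0` has
nonzero derivative along `t = 0`. -/
theorem IsFrame.not_dvd_jac_of_ringChar_eq_zero [IsLocalRing S] (hF : IsFrame d₁ d₂) {t y v : S}
    (h : IsRSP S t y) (hp : ringChar k = 0) (hv : v ∈ maximalIdeal S) (htv : ¬ t ∣ v) :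
    ¬ t ∣ jac d₁ d₂ t v := by
  intro hd
  obtain ⟨e, c, n, he, rfl⟩ := h.exists_eq_unit_mul_pow_add htv
  have hn : n ≠ 0 := by
    rintro rfl
    have := sub_mem hv (Ideal.mul_mem_left _ c h.left_mem)
    rw [pow_zero, mul_one, add_sub_cancel_right] at this
    exact this he
  obtain ⟨m, rfl⟩ := Nat.exists_eq_succ_of_ne_zero hn
  have h1 : jac d₁ d₂ t (e * y ^ (m + 1) + c * t) =
      y ^ m * (y * jac d₁ d₂ t e + ((m + 1 : ℕ) : S) * e * jac d₁ d₂ t y) +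
        t * jac d₁ d₂ t c := by
    have ht0 : jac d₁ d₂ t t = 0 := by unfold jac; ring
    simp only [← jacDeriv_apply] at ht0 ⊢
    simp only [map_add, Derivation.leibniz, Derivation.leibniz_pow, ht0, smul_eq_mul,
      nsmul_eq_mul, Nat.add_sub_cancel, mul_zero, zero_add]
    ring
  rw [Nat.succ_eq_add_one, h1] at hd
  have h2 := (dvd_add_left (dvd_mul_right t _)).1 hd
  rcases h.prime_left.dvd_or_dvd h2 with h3 | h3
  · exact h.not_dvd (h.prime_left.dvd_of_dvd_pow h3)
  · refine h.prime_left.not_isUnit (isUnit_of_dvd_unit h3 (isUnit_of_sub_mem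
      (a := ((m + 1 : ℕ) : S) * e * jac d₁ d₂ t y) ?_ ?_))
    · refine (IsUnit.mul ?_ he).mul (hF.isUnit_jac h)
      rw [← map_natCast (algebraMap k S)]
      refine (IsUnit.mk0 _ fun h0 ↦ ?_).map _
      have := (CharP.cast_eq_zero_iff k (ringChar k) (m + 1)).1 h0
      rw [hp, zero_dvd_iff] at this
      omega
    · rw [sub_add_cancel_right]
      exact neg_mem (Ideal.mul_mem_right _ _ h.right_mem)

variable {W V : Type u} [CommRing W] [CommRing V] [IsLocalRing W] [IsLocalRing V] [Algebra k W]
  [Algebra k V] [Algebra R W] [Algebra S V] [Algebra W V] [Algebra R V] [IsScalarTower k R W]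
  [IsScalarTower k S V] [IsScalarTower k W V] [IsScalarTower R W V] [IsScalarTower R S V]
  [IsLocalHom (algebraMap W V)]

/-- If the residue field extension is separable, its derivation along `t = 0` cannot vanish on the
image of `R`. -/
theorem IsFrame.exists_not_dvd_jac_of_isSeparable [IsLocalRing S] (hF : IsFrame d₁ d₂) {t y : S}
    (h : IsRSP S t y) {P : Ideal S} [P.IsPrime] [IsLocalization.AtPrime V P]
    (hP : P = Ideal.span {t}) {p : Ideal R} [p.IsPrime] [IsLocalization.AtPrime W p]
    (hsep : letI : Algebra (ResidueField W) (ResidueField V) :=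
      (ResidueField.map (algebraMap W V)).toAlgebra
      Algebra.IsSeparable (ResidueField W) (ResidueField V)) :
    ∃ r : R, ¬ t ∣ jac d₁ d₂ t (algebraMap R S r) := by
  by_contra! hcon
  simp only [← jacDeriv_apply] at hcon
  let _ : Algebra (ResidueField W) (ResidueField V) :=
    (ResidueField.map (algebraMap W V)).toAlgebra
  have hsep' : Algebra.IsSeparable (ResidueField W) (ResidueField V) := hsep
  set θ : ResidueField V := residue V (algebraMap S V y)
  have hθ := Algebra.IsSeparable.isSeparable (ResidueField W) θ
  have hker : ∀ s : S, residue V (algebraMap S V s) = 0 ↔ t ∣ s := by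
    intro s
    rw [residue_eq_zero_iff]
    simpa using algebraMap_mem_maximalIdeal_pow_iff (V := V) hP h.prime_left s 1
  obtain ⟨f, hf⟩ := Polynomial.map_surjective (residue W) residue_surjective
    (minpoly (ResidueField W) θ)
  obtain ⟨b, hbp, hb⟩ := IsLocalization.integerNormalization_spec p.primeCompl f
  lift b to p.primeCompl using hbp
  set F := IsLocalization.integerNormalization p.primeCompl f
  have hev : ∀ G : R[X], residue V (algebraMap S V (G.eval₂ (algebraMap R S) y)) =
      aeval θ ((G.map (algebraMap R W)).map (residue W)) := by
    intro G
    rw [hom_eval₂, hom_eval₂, aeval_def, eval₂_map, eval₂_map]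
    congr 1
    ext r
    simp only [RingHom.comp_apply]
    rw [← IsScalarTower.algebraMap_apply, IsScalarTower.algebraMap_apply R W V]
    rfl
  have hFd : (F.map (algebraMap R W)).map (residue W) =
      C (residue W (algebraMap R W b)) * minpoly (ResidueField W) θ := by
    rw [hb, ← hf, Algebra.smul_def, Polynomial.map_mul]
    congr 1
    rw [IsScalarTower.algebraMap_apply R W W[X]]
    simp
  have hb0 : residue W (algebraMap R W b) ≠ 0 := by
    rw [Ne, residue_eq_zero_iff]
    exact fun hm ↦ hm (IsLocalization.map_units W b)
  have h1 : t ∣ F.eval₂ (algebraMap R S) y := by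
    rw [← hker, hev, hFd, map_mul, minpoly.aeval, mul_zero]
  have h2 : ¬ t ∣ F.derivative.eval₂ (algebraMap R S) y := by
    rw [← hker, hev, ← derivative_map, ← derivative_map, hFd, derivative_C_mul, map_mul, aeval_C,
      mul_eq_zero, not_or]
    refine ⟨?_, ?_⟩
    · rwa [Ne, FaithfulSMul.algebraMap_eq_zero_iff] at *
    · exact hθ.aeval_derivative_ne_zero (minpoly.aeval _ _)
  have h3 := dvd_deriv_eval₂_sub hcon F y
  have h4 : t ∣ jacDeriv d₁ d₂ t (F.eval₂ (algebraMap R S) y) := by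
    obtain ⟨c, hc⟩ := h1
    have ht0 : jacDeriv d₁ d₂ t t = 0 := by rw [jacDeriv_apply]; unfold jac; ring
    rw [hc, Derivation.leibniz, ht0]
    simp
  have h5 := (dvd_sub_right h4).1 h3
  rw [jacDeriv_apply] at h5
  exact h2 ((hF.isUnit_jac h).dvd_mul_right.1 h5)

/-- If `v` has nonzero derivative along `t = 0`, the residue field of the divisor `t = 0` is
unramified, hence separable, over the residue field of its image. -/
theorem IsFrame.isSeparable_of_not_dvd_jac [Algebra.EssFiniteType k V] (hF : IsFrame d₁ d₂)
    {t v : S} {P : Ideal S} [P.IsPrime]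
    [IsLocalization.AtPrime V P] (hP : P = Ideal.span {t}) (ht : Prime t)
    {w : W} (hw : algebraMap W V w = algebraMap S V v) (hd : ¬ t ∣ jac d₁ d₂ t v) :
    letI : Algebra (ResidueField W) (ResidueField V) :=
      (ResidueField.map (algebraMap W V)).toAlgebra
    Algebra.IsSeparable (ResidueField W) (ResidueField V) := by
  let _ : Algebra (ResidueField W) (ResidueField V) :=
    (ResidueField.map (algebraMap W V)).toAlgebra
  change Algebra.IsSeparable (ResidueField W) (ResidueField V)
  have hWV : IsScalarTower k (ResidueField W) (ResidueField V) := by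
    refine IsScalarTower.of_algebraMap_eq fun c ↦ ?_
    rw [IsScalarTower.algebraMap_apply k V (ResidueField V),
      IsScalarTower.algebraMap_apply k W (ResidueField W), IsScalarTower.algebraMap_apply k W V]
    rfl
  have hft : Algebra.FiniteType V (ResidueField V) :=
    Algebra.FiniteType.of_surjective (Algebra.ofId V (ResidueField V)) residue_surjective
  have : Algebra.EssFiniteType k (ResidueField V) := .comp k V _
  have : Algebra.EssFiniteType (ResidueField W) (ResidueField V) := .of_comp k _ _
  rw [← Algebra.FormallyUnramified.iff_isSeparable, Algebra.formallyUnramified_iff]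
  let D : Derivation k V (Ω[ResidueField V⁄ResidueField W]) :=
    ((KaehlerDifferential.D (ResidueField W) (ResidueField V)).restrictScalars k).compAlgebraMap V
  have hD : ∀ a : V, D a = KaehlerDifferential.D (ResidueField W) (ResidueField V)
    (algebraMap V (ResidueField V) a) := fun a ↦ rfl
  have ht0 : D (algebraMap S V t) = 0 := by
    rw [hD, show algebraMap V (ResidueField V) (algebraMap S V t) = 0 from ?_, map_zero]
    rw [ResidueField.algebraMap_eq, residue_eq_zero_iff]
    simpa using (algebraMap_mem_maximalIdeal_pow_iff (V := V) hP ht t 1).2 (by simp)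
  have hv0 : D (algebraMap S V v) = 0 := by
    rw [hD, ← hw]
    exact Derivation.map_algebraMap (KaehlerDifferential.D (ResidueField W) (ResidueField V))
      (residue W w)
  have hunit : IsUnit (algebraMap S V (jac d₁ d₂ t v)) := by
    by_contra hu
    have := (algebraMap_mem_maximalIdeal_pow_iff (V := V) hP ht (jac d₁ d₂ t v) 1).1
      (by simpa using hu)
    exact hd (by simpa using this)
  have hD0 := hF.derivation_eq_zero P.primeCompl D ht0 hv0 hunit
  have htop := KaehlerDifferential.span_range_derivation (ResidueField W) (ResidueField V)
  rw [← Submodule.subsingleton_iff (ResidueField V)]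
  refine subsingleton_of_bot_eq_top ?_
  rw [← htop, eq_comm, Submodule.span_eq_bot]
  rintro _ ⟨a, rfl⟩
  obtain ⟨a, rfl⟩ := residue_surjective a
  exact hD0 a

/-- Tame ramification along a prime divisor that dominates a prime divisor `u = 0`, in terms of the
Jacobian determinant. -/
theorem IsFrame.isTame_iff_isOptimal [IsLocalRing R] [IsDomain R] [IsLocalRing S]
    [IsLocalHom (algebraMap R S)] [WfDvdMonoid S] [Algebra.EssFiniteType k V]
    (hF : IsFrame d₁ d₂) {u v : R} (huv : IsRSP R u v) (hc : Coordinates k u v) {t y : S}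
    (h : IsRSP S t y) {P : Ideal S} [P.IsPrime] [IsLocalization.AtPrime V P]
    (hP : P = Ideal.span {t}) {p : Ideal R} [p.IsPrime] [IsLocalization.AtPrime W p]
    (hp : p = Ideal.span {u}) (hPp : P.comap (algebraMap R S) = p)
    (hu0 : algebraMap R S u ≠ 0) :
    IsTame k (algebraMap W V) ↔ IsOptimal (jac d₁ d₂ (algebraMap R S u) (algebraMap R S v)) t
      (algebraMap R S u) (algebraMap R S v) := by
  have htu : t ∣ algebraMap R S u := by
    rw [← Ideal.mem_span_singleton, ← hP, ← Ideal.mem_comap, hPp, hp]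
    exact Ideal.mem_span_singleton_self u
  have htv : ¬ t ∣ algebraMap R S v := by
    rw [← Ideal.mem_span_singleton, ← hP, ← Ideal.mem_comap, hPp, hp, Ideal.mem_span_singleton]
    exact huv.not_dvd
  obtain ⟨a, g, hg, hug⟩ := WfDvdMonoid.max_power_factor hu0 h.prime_left.irreducible
  have ha : a ≠ 0 := by
    rintro rfl
    rw [pow_zero, one_mul] at hug
    exact hg (hug ▸ htu)
  have hord : idealOrder V ((maximalIdeal W).map (algebraMap W V)) = a := by
    rw [maximalIdeal_eq_span_of_isLocalization (V := W) hp, Ideal.map_span, Set.image_singleton,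
      ← IsScalarTower.algebraMap_apply, IsScalarTower.algebraMap_apply R S V, hug]
    refine idealOrder_span_algebraMap hP h.prime_left (dvd_mul_right _ _) fun h1 ↦ hg ?_
    rw [pow_succ] at h1
    exact (mul_dvd_mul_iff_left (pow_ne_zero _ h.prime_left.ne_zero)).1 h1
  rw [hug, isOptimal_iff_of_eq_pow_mul h.prime_left ha hg htv, IsTame, hord]
  have hvm : algebraMap R S v ∈ maximalIdeal S := map_mem_maximalIdeal huv.right_mem
  constructor
  · rintro (hp0 | ⟨hpa, hsep⟩)
    · refine ⟨?_, hF.not_dvd_jac_of_ringChar_eq_zero h hp0 hvm htv⟩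
      rwa [hp0, zero_dvd_iff]
    · refine ⟨hpa, fun htJ ↦ ?_⟩
      obtain ⟨r, hr⟩ := hF.exists_not_dvd_jac_of_isSeparable (R := R) h hP (p := p) hsep
      refine hr ?_
      obtain ⟨b, c, hbc⟩ := hc.exists_coeff r
      have h1 := hbc ((jacDeriv d₁ d₂ t).compAlgebraMap R)
      simp only [Derivation.compAlgebraMap_apply, jacDeriv_apply] at h1
      rw [h1, Algebra.smul_def, Algebra.smul_def]
      refine dvd_add (Dvd.dvd.mul_left ?_ _) (htJ.mul_left _)
      rw [hug, ← jacDeriv_apply, Derivation.leibniz, Derivation.leibniz_pow, jacDeriv_apply,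
        jacDeriv_apply]
      have ht0 : jac d₁ d₂ t t = 0 := by unfold jac; ring
      rw [ht0, smul_zero, smul_zero, smul_zero, add_zero, smul_eq_mul]
      exact (dvd_pow_self t ha).mul_right _
  · rintro ⟨hpa, htJ⟩
    refine Or.inr ⟨hpa, hF.isSeparable_of_not_dvd_jac hP h.prime_left (w := algebraMap R W v) ?_
      htJ⟩
    rw [← IsScalarTower.algebraMap_apply, ← IsScalarTower.algebraMap_apply]

end Tame

/-! ### Jacobian determinants of homomorphisms of regular local rings -/

section Frames

open Polynomial

theorem IsRSP.coordinates {k S : Type u} [Field k] [PerfectField k] [CommRing S] [IsLocalRing S]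
    [Algebra k S] [Algebra.EssFiniteType k S] [Algebra.IsAlgebraic k (ResidueField S)] {x y : S}
    (h : IsRSP S x y) : Coordinates k x y := by
  have := span_D_eq_top k h.span
  rwa [Set.image_pair] at this

theorem exists_isFrame {k S : Type u} [Field k] [PerfectField k] [CommRing S] [IsDomain S]
    [IsRegularLocalRing S] [Algebra k S] [Algebra.EssFiniteType k S]
    [Algebra.IsAlgebraic k (ResidueField S)] (hd : ringKrullDim S = 2) (L : Type u) [Field L]
    [Algebra k L] [Algebra S L] [IsScalarTower k S L] [IsFractionRing S L]
    (hL : Module.finrank L (Ω[L⁄k]) = 2) : ∃ d₁ d₂ : Derivation k S S, IsFrame d₁ d₂ := by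
  obtain ⟨x, y, h⟩ := IsRSP.exists_regular_of_isRegularLocalRing hd
  obtain ⟨d₁, d₂, h1, h2, h3, h4⟩ := h.coordinates.exists_dual (k := k) L hL
  exact ⟨d₁, d₂, fun a b hab ↦ hab.coordinates, x, y, h, h1, h2, h3, h4⟩

variable {k : Type u} [Field k] {R S : Type u} [CommRing R] [CommRing S] [Algebra k R]
  [Algebra k S] [Algebra R S] [IsScalarTower k R S] {d₁ d₂ : Derivation k S S}

theorem Coordinates.jac_dvd {u v : R} (hc : Coordinates k u v) (a b : R) :
    jac d₁ d₂ (algebraMap R S u) (algebraMap R S v) ∣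
      jac d₁ d₂ (algebraMap R S a) (algebraMap R S b) := by
  obtain ⟨p, q, hpq⟩ := hc.exists_coeff a
  obtain ⟨r, s, hrs⟩ := hc.exists_coeff b
  have e1 := hpq (d₁.compAlgebraMap R)
  have e2 := hpq (d₂.compAlgebraMap R)
  have e3 := hrs (d₁.compAlgebraMap R)
  have e4 := hrs (d₂.compAlgebraMap R)
  simp only [Derivation.compAlgebraMap_apply, Algebra.smul_def] at e1 e2 e3 e4
  refine ⟨algebraMap R S (p * s - q * r), ?_⟩
  unfold jac
  rw [e1, e2, e3, e4, map_sub, map_mul, map_mul]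
  ring

variable [IsDomain S]

/-- A derivation of `S` vanishing on `R` is zero if the extension of fraction fields is
separable. -/
theorem derivation_eq_zero_of_isSeparable (K L : Type u) [Field K] [Field L] [IsDomain R]
    [Algebra R K] [IsFractionRing R K] [Algebra S L] [IsFractionRing S L] [Algebra K L]
    [Algebra R L] [IsScalarTower R K L] [IsScalarTower R S L] [Algebra.IsSeparable K L]
    (D : Derivation k S S) (h : ∀ r : R, D (algebraMap R S r) = 0) : D = 0 := by
  ext s
  have hSL := IsFractionRing.injective S L
  set θ := algebraMap S L s
  have hθ := Algebra.IsSeparable.isSeparable K θ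
  obtain ⟨b, hbR, hb⟩ := IsLocalization.integerNormalization_spec (nonZeroDivisors R)
    (minpoly K θ)
  lift b to nonZeroDivisors R using hbR
  set F := IsLocalization.integerNormalization (nonZeroDivisors R) (minpoly K θ)
  have hev : ∀ G : R[X], algebraMap S L (G.eval₂ (algebraMap R S) s) =
      aeval θ (G.map (algebraMap R K)) := by
    intro G
    rw [hom_eval₂, aeval_def, eval₂_map, ← IsScalarTower.algebraMap_eq R S L,
      ← IsScalarTower.algebraMap_eq R K L]
  have hbK : algebraMap R K b ≠ 0 := fun h0 ↦ nonZeroDivisors.ne_zero b.2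
    (IsFractionRing.injective R K (by rw [h0, map_zero]))
  have hFd : F.map (algebraMap R K) = C (algebraMap R K b) * minpoly K θ := by
    rw [hb, Algebra.smul_def, IsScalarTower.algebraMap_apply R K K[X]]
    simp
  have h1 : F.eval₂ (algebraMap R S) s = 0 := by
    refine hSL ?_
    rw [hev, hFd, map_mul, minpoly.aeval, mul_zero, map_zero]
  have h2 : F.derivative.eval₂ (algebraMap R S) s ≠ 0 := by
    intro h0
    have h3 := hev F.derivative
    rw [h0, map_zero, ← derivative_map, hFd, derivative_C_mul, map_mul, aeval_C, eq_comm,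
      mul_eq_zero] at h3
    rcases h3 with h3 | h3
    · exact hbK ((algebraMap K L).injective (by rw [h3, map_zero]))
    · exact hθ.aeval_derivative_ne_zero (minpoly.aeval _ _) h3
  have h3 := dvd_deriv_eval₂_sub (t := 0) (fun r ↦ by rw [h r]) F s
  rw [h1, map_zero, zero_sub, zero_dvd_iff, neg_eq_zero, mul_eq_zero] at h3
  exact h3.resolve_left h2

theorem IsFrame.isJacobian (K L : Type u) [Field K] [Field L] [IsDomain R]
    [Algebra R K] [IsFractionRing R K] [Algebra S L] [IsFractionRing S L] [Algebra K L]
    [Algebra R L] [IsScalarTower R K L] [IsScalarTower R S L] [Algebra.IsSeparable K L]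
    (hF : IsFrame d₁ d₂) (hc : ∀ u v : R, IsRSP R u v → Coordinates k u v) {u v : R}
    (h : IsRSP R u v) :
    IsJacobian (algebraMap R S) d₁ d₂ (jac d₁ d₂ (algebraMap R S u) (algebraMap R S v)) := by
  refine ⟨fun h0 ↦ ?_, fun a b hab ↦
    associated_of_dvd_dvd ((hc u v h).jac_dvd a b) ((hc a b hab).jac_dvd u v)⟩
  obtain ⟨x, y, -, h1, h2, h3, h4⟩ := hF.exists_dual
  -- a derivation vanishing on `u` and `v` vanishes on `R`, hence on `S`
  have key : ∀ D : Derivation k S S, D (algebraMap R S u) = 0 → D (algebraMap R S v) = 0 →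
      D = 0 := by
    intro D hu hv
    refine derivation_eq_zero_of_isSeparable (R := R) K L D fun r ↦ ?_
    obtain ⟨p, q, hpq⟩ := (hc u v h).exists_coeff r
    have := hpq (D.compAlgebraMap R)
    simpa only [Derivation.compAlgebraMap_apply, hu, hv, smul_zero, add_zero] using this
  have key2 : ∀ a b : S, a * d₁ (algebraMap R S u) + b * d₂ (algebraMap R S u) = 0 →
      a * d₁ (algebraMap R S v) + b * d₂ (algebraMap R S v) = 0 → a = 0 ∧ b = 0 := by
    intro a b hu hv
    have h5 := key (a • d₁ + b • d₂) hu hv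
    have h6 : (a • d₁ + b • d₂) x = 0 := by rw [h5]; rfl
    have h7 : (a • d₁ + b • d₂) y = 0 := by rw [h5]; rfl
    simp only [Derivation.add_apply, Derivation.smul_apply, h1, h2, h3, h4, smul_eq_mul] at h6 h7
    exact ⟨by simpa using h6, by simpa using h7⟩
  unfold jac at h0
  obtain ⟨e2, e1⟩ := key2 (d₂ (algebraMap R S u)) (-d₁ (algebraMap R S u)) (by ring)
    (by linear_combination -h0)
  obtain ⟨e4, e3⟩ := key2 (d₂ (algebraMap R S v)) (-d₁ (algebraMap R S v))
    (by linear_combination h0) (by ring)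
  rw [neg_eq_zero] at e1 e3
  have := key2 1 0 (by rw [e1, e2]; ring) (by rw [e3, e4]; ring)
  exact one_ne_zero this.1

variable {W V : Type u} [CommRing W] [CommRing V] [Algebra k W]
  [Algebra k V] [Algebra R W] [Algebra S V] [Algebra W V] [Algebra R V] [IsScalarTower k R W]
  [IsScalarTower k S V] [IsScalarTower k W V] [IsScalarTower R W V] [IsScalarTower R S V]

/-- The Jacobian ideal of a localization is generated by the Jacobian determinant. -/
theorem IsFrame.jacobianIdeal_eq (L : Type u) [Field L] [Algebra k L] [Algebra V L]
    [IsDomain V] [IsScalarTower k V L] [IsFractionRing V L]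
    (hL : Module.finrank L (Ω[L⁄k]) = 2) (hF : IsFrame d₁ d₂) {u v : R} (hc : Coordinates k u v)
    (M : Submonoid R) [IsLocalization M W] (N : Submonoid S) [IsLocalization N V] :
    jacobianIdeal k (algebraMap W V) =
      Ideal.span {algebraMap S V (jac d₁ d₂ (algebraMap R S u) (algebraMap R S v))} := by
  obtain ⟨x, y, hxy, hD⟩ := hF.derivation_apply
  have hDS : ∀ (D : Derivation k V V) (a : S), D (algebraMap S V a) =
      algebraMap S V (d₁ a) * D (algebraMap S V x) +
        algebraMap S V (d₂ a) * D (algebraMap S V y) := by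
    intro D a
    have := hD (D.compAlgebraMap S) a
    simpa only [Derivation.compAlgebraMap_apply, Algebra.smul_def] using this
  have hRV : ∀ r : R, algebraMap W V (algebraMap R W r) = algebraMap S V (algebraMap R S r) := by
    intro r
    rw [← IsScalarTower.algebraMap_apply, ← IsScalarTower.algebraMap_apply]
  refine le_antisymm ?_ ?_
  · refine Ideal.span_le.2 ?_
    rintro _ ⟨D₁, D₂, w₁, w₂, rfl⟩
    have hcW : Coordinates k (algebraMap R W u) (algebraMap R W v) := hc.localization M
    obtain ⟨p, q, hpq⟩ := hcW.exists_coeff w₁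
    obtain ⟨r, s, hrs⟩ := hcW.exists_coeff w₂
    have e1 := hpq (D₁.compAlgebraMap W)
    have e2 := hpq (D₂.compAlgebraMap W)
    have e3 := hrs (D₁.compAlgebraMap W)
    have e4 := hrs (D₂.compAlgebraMap W)
    simp only [Derivation.compAlgebraMap_apply, Algebra.smul_def, hRV] at e1 e2 e3 e4
    rw [hDS D₁ (algebraMap R S u), hDS D₁ (algebraMap R S v)] at e1 e3
    rw [hDS D₂ (algebraMap R S u), hDS D₂ (algebraMap R S v)] at e2 e4
    refine Ideal.mem_span_singleton.2 ⟨(algebraMap W V (p * s - q * r)) *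
      (D₁ (algebraMap S V x) * D₂ (algebraMap S V y) -
        D₁ (algebraMap S V y) * D₂ (algebraMap S V x)), ?_⟩
    rw [e1, e2, e3, e4]
    simp only [jac, map_sub, map_mul]
    ring
  · rw [Ideal.span_singleton_le_iff_mem]
    have hcV : Coordinates k (algebraMap S V x) (algebraMap S V y) :=
      (hF.coordinates x y hxy).localization N
    obtain ⟨D₁, D₂, h1, h2, h3, h4⟩ := hcV.exists_dual (k := k) L hL
    refine Ideal.subset_span ⟨D₁, D₂, algebraMap R W u, algebraMap R W v, ?_⟩
    simp only [hRV]
    rw [hDS D₁ (algebraMap R S u), hDS D₁ (algebraMap R S v), hDS D₂ (algebraMap R S u),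
      hDS D₂ (algebraMap R S v), h1, h2, h3, h4]
    simp only [jac, map_sub, map_mul]
    ring

end Frames

/-! ### The local criterion -/

section Local

variable {k : Type u} [Field k] {R S : Type u} [CommRing R] [CommRing S]
  [Algebra k S] {d₁ d₂ : Derivation k S S} [IsDomain S]
  {φ : R →+* S} {J : S}

theorem IsJacobian.pow_dvd (hJ : IsJacobian φ d₁ d₂ J) [WfDvdMonoid S] {u v : R}
    (h : IsRSP R u v) {t : S} (ht : Prime t) {n : ℕ} (hn : t ^ n ∣ φ (u * v)) : t ^ n ∣ t * J := by
  rw [map_mul] at hn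
  exact (pow_dvd_mul_jac d₁ d₂ ht hn).trans (mul_dvd_mul_left t (hJ.associated u v h).symm.dvd)

/-- The complexity of a contracted curve `t = 0` is nonnegative, and it vanishes if and only if some
of the parameters under consideration are optimal. -/
theorem IsJacobian.complexity_nonneg_and_eq_zero_iff [WfDvdMonoid S] {V : Type u} [CommRing V]
    [IsLocalRing V] [Algebra S V] {t : S} {P : Ideal S} [P.IsPrime] [IsLocalization.AtPrime V P]
    (hP : P = Ideal.span {t}) (ht : Prime t) (hJ : IsJacobian φ d₁ d₂ J)
    {Adm : R → R → Prop} (hAdm : ∀ u v, Adm u v → IsRSP R u v) {e : ℕ}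
    (he : e = idealOrder V (Ideal.span {algebraMap S V J})) {c : ℤ}
    (hc : c = (e : ℤ) + 1 - (sSup {n : ℕ | ∃ u v : R, Adm u v ∧
      n = idealOrder V (Ideal.span {algebraMap S V (φ (u * v))})} : ℕ)) :
    0 ≤ c ∧ c ≤ e + 1 ∧ (c = 0 ↔ ∃ u v, Adm u v ∧ IsOptimal J t (φ u) (φ v)) := by
  obtain ⟨n, hn, hn'⟩ := exists_pow_dvd_and_not ht hJ.ne_zero
  rw [idealOrder_span_algebraMap hP ht hn hn'] at he
  subst he
  set A : Set ℕ := {n : ℕ | ∃ u v : R, Adm u v ∧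
      n = idealOrder V (Ideal.span {algebraMap S V (φ (u * v))})}
  have hord : ∀ u v, Adm u v → ∃ m, t ^ m ∣ φ (u * v) ∧ ¬ t ^ (m + 1) ∣ φ (u * v) ∧
      idealOrder V (Ideal.span {algebraMap S V (φ (u * v))}) = m ∧ m ≤ e + 1 := by
    intro u v h
    have h0 : φ (u * v) ≠ 0 := by
      rw [map_mul]
      exact mul_ne_zero (hJ.map_ne_zero_left (hAdm u v h)) (hJ.map_ne_zero_right (hAdm u v h))
    obtain ⟨m, hm, hm'⟩ := exists_pow_dvd_and_not ht h0
    refine ⟨m, hm, hm', idealOrder_span_algebraMap hP ht hm hm', ?_⟩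
    by_contra hlt
    have h1 := (pow_dvd_pow t (by omega : e + 2 ≤ m)).trans hm
    have h2 := hJ.pow_dvd (hAdm u v h) ht h1
    rw [pow_succ' t (e + 1)] at h2
    exact hn' ((mul_dvd_mul_iff_left ht.ne_zero).1 h2)
  have hbdd : ∀ m ∈ A, m ≤ e + 1 := by
    rintro m ⟨u, v, h, rfl⟩
    obtain ⟨m, -, -, h1, h2⟩ := hord u v h
    omega
  have hopt : (∃ u v, Adm u v ∧ IsOptimal J t (φ u) (φ v)) ↔ e + 1 ∈ A := by
    constructor
    · rintro ⟨u, v, h, ho⟩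
      obtain ⟨m, hm, hm', h1, h2⟩ := hord u v h
      have h3 := ho (e + 1) (by rw [pow_succ']; exact mul_dvd_mul_left t hn)
      rw [← map_mul] at h3
      have h4 : e + 1 ≤ m := by
        by_contra hlt
        exact hm' ((pow_dvd_pow t (by omega)).trans h3)
      exact ⟨u, v, h, by omega⟩
    · rintro ⟨u, v, h, h0⟩
      obtain ⟨m, hm, hm', h1, h2⟩ := hord u v h
      refine ⟨u, v, h, fun i hi ↦ ?_⟩
      have h3 : i ≤ e + 1 := by
        by_contra hlt
        have h4 := (pow_dvd_pow t (by omega : e + 2 ≤ i)).trans hi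
        rw [pow_succ' t (e + 1)] at h4
        exact hn' ((mul_dvd_mul_iff_left ht.ne_zero).1 h4)
      rw [← map_mul]
      exact (pow_dvd_pow t (by omega)).trans hm
  have hsup : sSup A ≤ e + 1 := by
    rcases A.eq_empty_or_nonempty with h0 | h0
    · simp [h0]
    · exact csSup_le h0 hbdd
  refine ⟨by omega, by omega, ?_⟩
  rw [hopt]
  constructor
  · intro h0
    have h1 : sSup A = e + 1 := by omega
    rw [← h1]
    refine Nat.sSup_mem ?_ ⟨e + 1, hbdd⟩
    by_contra hne
    rw [Set.not_nonempty_iff_eq_empty] at hne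
    rw [hne] at h1
    simp at h1
  · intro h0
    have := le_antisymm hsup (le_csSup ⟨e + 1, hbdd⟩ h0)
    omega

/-- A regular system of parameters `u, v` such that `I`, if it has to be taken into account, is the
ideal of `u = 0` or of `u v = 0`. -/
def IsAdmissiblePair (b : Prop) (I : Ideal R) (u v : R) : Prop :=
  IsRSP R u v ∧ (b → I = Ideal.span {u} ∨ I = Ideal.span {u * v})

theorem exists_of_isSNCIdeal [IsDomain R] [IsLocalRing R] {I : Ideal R} (h : IsSNCIdeal I)
    (hr : I.IsRadical) (hm : I ≤ maximalIdeal R) :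
    ∃ u v, IsRSP R u v ∧ (I = Ideal.span {u} ∨ I = Ideal.span {u * v}) := by
  obtain ⟨x, y, hxy, a, b, rfl⟩ := h
  have hred : ∀ z n, z ^ n ∈ Ideal.span {x ^ a * y ^ b} → z ∈ Ideal.span {x ^ a * y ^ b} :=
    fun z n hz ↦ hr ⟨n, hz⟩
  rcases Nat.eq_zero_or_pos a with rfl | ha
  · rcases Nat.eq_zero_or_pos b with rfl | hb
    · exact absurd (hm (Ideal.mem_span_singleton_self _)) (by simp)
    · refine ⟨y, x, hxy.symm, Or.inl ?_⟩
      have h1 := hred y b (by simp)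
      refine le_antisymm ?_ ((Ideal.span_singleton_le_iff_mem _).2 h1)
      rw [Ideal.span_singleton_le_span_singleton]
      exact (dvd_pow_self y hb.ne').mul_left _
  · rcases Nat.eq_zero_or_pos b with rfl | hb
    · refine ⟨x, y, hxy, Or.inl ?_⟩
      have h1 := hred x a (by simp)
      refine le_antisymm ?_ ((Ideal.span_singleton_le_iff_mem _).2 h1)
      rw [Ideal.span_singleton_le_span_singleton]
      exact (dvd_pow_self x ha.ne').mul_right _
    · refine ⟨x, y, hxy, Or.inr ?_⟩
      have h1 := hred (x * y) (a + b) (by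
        rw [Ideal.mem_span_singleton, mul_pow]
        exact mul_dvd_mul (pow_dvd_pow x (by omega)) (pow_dvd_pow y (by omega)))
      refine le_antisymm ?_ ((Ideal.span_singleton_le_iff_mem _).2 h1)
      rw [Ideal.span_singleton_le_span_singleton]
      exact mul_dvd_mul (dvd_pow_self x ha.ne') (dvd_pow_self y hb.ne')

theorem IsRSP.not_associated_mul [IsDomain R] {u v w z : R} (h : IsRSP R u v) (h' : IsRSP R w z) :
    ¬ Associated u (w * z) := by
  have := h.isLocalRing
  intro ha
  have h1 : Irreducible (w * z) := ha.irreducible h.prime_left.irreducible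
  rcases h1.isUnit_or_isUnit rfl with h2 | h2
  · exact h'.left_mem h2
  · exact h'.right_mem h2

variable [IsDomain R] [IsLocalRing R] [IsLocalRing S] [IsLocalHom φ]

/-- The local form of the theorem: parameters with a monomial form exist if and only if there are
optimal parameters along every zero of the Jacobian determinant. -/
theorem IsJacobian.exists_form_iff [UniqueFactorizationMonoid S] (hJ : IsJacobian φ d₁ d₂ J)
    (hF : IsFrame d₁ d₂) (hR : ∃ u v, IsRSP R u v) {b : Prop} {I : Ideal R}
    (hI : b → ∃ u v, IsRSP R u v ∧ (I = Ideal.span {u} ∨ I = Ideal.span {u * v}))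
    (hIS : b → IsSNCIdeal (I.map φ))
    (hb : b → ∀ t, Prime t → t ∣ J → ∀ a ∈ I, t ∣ φ a)
    (hnb : ¬ b → ∀ t, Prime t → t ∣ J → ∀ a ∈ maximalIdeal R, t ∣ φ a)
    (hZ : ¬ b → ∀ w v, IsRSP R w v → ∀ s : ℕ, 1 ≤ s →
      (∃ s₁ ∈ maximalIdeal S, ∃ s₂ ∈ maximalIdeal S, φ w = s₁ * s₂) →
      φ w ^ s ∣ φ v ∨ φ v ∣ φ w ^ s) :
    (∃ u v, IsAdmissiblePair b I u v ∧
      ∃ x y, IsRSP S x y ∧ (FormOne k (φ u) (φ v) x y ∨ FormTwo k (φ u) (φ v) x y)) ↔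
    ∀ t, Prime t → t ∣ J → ∃ u v, IsAdmissiblePair b I u v ∧ IsOptimal J t (φ u) (φ v) := by
  constructor
  · rintro ⟨u, v, h, x, y, hxy, hf⟩ t ht htJ
    exact ⟨u, v, h, hJ.isOptimal_of_form hF h.1 hxy hf ht htJ⟩
  intro hopt
  by_cases hbb : b
  · obtain ⟨u, v, huv, hI'⟩ := hI hbb
    obtain ⟨x, y, hxy, m, n, hmn⟩ := hIS hbb
    have hgen : ∀ c, I = Ideal.span {c} → ∃ γ, IsUnit γ ∧ φ c = γ * (x ^ m * y ^ n) := by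
      intro c hc
      rw [hc, Ideal.map_span, Set.image_singleton, Ideal.span_singleton_eq_span_singleton] at hmn
      obtain ⟨γ, hγ⟩ := hmn.symm
      exact ⟨γ, γ.isUnit, by rw [← hγ, mul_comm]⟩
    have hall : ∀ c, I = Ideal.span {c} → ∀ t, Prime t → t ∣ J → t ∣ φ c :=
      fun c hc t ht htJ ↦ hb hbb t ht htJ c (hc ▸ Ideal.mem_span_singleton_self c)
    rcases hI' with hI' | hI'
    · obtain ⟨γ, hγ, hw⟩ := hgen u hI'
      obtain ⟨v', hv', hf⟩ := hJ.exists_form_of_simple hF huv hxy hγ hw (hall u hI') (by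
        intro t ht htJ
        obtain ⟨w, z, ⟨hwz, hwz'⟩, ho⟩ := hopt t ht htJ
        have h1 : Ideal.span {w} = Ideal.span {u} := by
          rcases hwz' hbb with h2 | h2
          · rw [← h2, hI']
          · rw [hI', Ideal.span_singleton_eq_span_singleton] at h2
            exact (huv.not_associated_mul hwz h2).elim
        obtain ⟨e, rfl⟩ := Ideal.span_singleton_eq_span_singleton.1 h1
        refine ⟨z, ?_, ho.mono (mul_dvd_mul_right ?_ _)⟩
        · have := hwz.of_unit_combination (β := 0) e.isUnit
          rwa [zero_mul, add_zero, mul_comm] at this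
        · rw [map_mul]; exact dvd_mul_right _ _)
      exact ⟨u, v', ⟨hv', fun _ ↦ Or.inl hI'⟩, hf⟩
    · obtain ⟨γ, hγ, hw⟩ := hgen (u * v) hI'
      refine ⟨u, v, ⟨huv, fun _ ↦ Or.inr hI'⟩,
        hJ.exists_form_of_double hF huv hxy hγ hw (hall _ hI') ?_⟩
      intro t ht htJ
      obtain ⟨w, z, ⟨hwz, hwz'⟩, ho⟩ := hopt t ht htJ
      have h1 : Ideal.span {w * z} = Ideal.span {u * v} := by
        rcases hwz' hbb with h2 | h2
        · rw [hI', Ideal.span_singleton_eq_span_singleton] at h2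
          exact (hwz.not_associated_mul huv h2.symm).elim
        · rw [← h2, hI']
      refine ho.mono ?_
      rw [← map_mul, ← map_mul]
      exact map_dvd φ (Ideal.span_singleton_eq_span_singleton.1 h1).dvd
  · obtain ⟨u, v, huv, hf⟩ := hJ.exists_form_of_contracted hF hR (hnb hbb) (by
      intro t ht htJ
      obtain ⟨u, v, h, ho⟩ := hopt t ht htJ
      exact ⟨u, v, h.1, ho⟩) (hZ hbb)
    exact ⟨u, v, ⟨huv, fun h ↦ (hbb h).elim⟩, hf⟩

end Local

/-! ### Generizations of a point and primes of its local ring -/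

section Specialization

variable {X Y : Scheme.{u}}

/-- The prime ideal of the local ring at `x` that belongs to the generization `η` of `x`. -/
def primeOf {η x : X} (h : η ⤳ x) : Ideal (X.presheaf.stalk x) :=
  (maximalIdeal (X.presheaf.stalk η)).comap (X.presheaf.stalkSpecializes h).hom

instance {η x : X} (h : η ⤳ x) : (primeOf h).IsPrime :=
  inferInstanceAs ((maximalIdeal (X.presheaf.stalk η)).comap _).IsPrime

theorem fromSpecStalk_primeOf {η x : X} (h : η ⤳ x) :
    X.fromSpecStalk x (⟨primeOf h, inferInstance⟩ : PrimeSpectrum _) = η := by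
  have h1 := Scheme.SpecMap_stalkSpecializes_fromSpecStalk h
  have h2 := congrArg (fun f ↦ f.base (closedPoint (X.presheaf.stalk η))) h1
  exact h2.trans Scheme.fromSpecStalk_closedPoint

theorem exists_primeOf_eq (x : X) (P : Ideal (X.presheaf.stalk x)) [hP : P.IsPrime] :
    ∃ (η : X) (h : η ⤳ x), primeOf h = P := by
  have h1 : X.fromSpecStalk x (⟨P, hP⟩ : PrimeSpectrum _) ∈ Set.range (X.fromSpecStalk x) :=
    ⟨_, rfl⟩
  rw [Scheme.range_fromSpecStalk] at h1
  refine ⟨_, h1, ?_⟩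
  have h2 := (X.fromSpecStalk x).isEmbedding.injective (fromSpecStalk_primeOf h1)
  exact congrArg PrimeSpectrum.asIdeal h2

theorem eq_of_primeOf_eq_maximalIdeal {η x : X} (h : η ⤳ x)
    (hm : primeOf h = maximalIdeal (X.presheaf.stalk x)) : η = x := by
  refine (fromSpecStalk_primeOf h).symm.trans (Eq.trans ?_ Scheme.fromSpecStalk_closedPoint)
  exact congrArg (X.fromSpecStalk x) (PrimeSpectrum.ext hm)

theorem isLocalization_stalk_of_specializes {η x : X} (h : η ⤳ x) :
    letI := (X.presheaf.stalkSpecializes h).hom.toAlgebra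
    IsLocalization.AtPrime (X.presheaf.stalk η) (primeOf h) := by
  let _ := (X.presheaf.stalkSpecializes h).hom.toAlgebra
  obtain ⟨U, hU, hxU, -⟩ := Opens.isBasis_iff_nbhd.1 X.isBasis_affineOpens (Opens.mem_top x)
  have hηU : η ∈ U := h.mem_open U.2 hxU
  have hU : IsAffineOpen U := hU
  let _ := X.presheaf.algebra_section_stalk (U := U) ⟨x, hxU⟩
  let _ := X.presheaf.algebra_section_stalk (U := U) ⟨η, hηU⟩
  have hx := hU.isLocalization_stalk ⟨x, hxU⟩
  have hη := hU.isLocalization_stalk ⟨η, hηU⟩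
  have hT : IsScalarTower Γ(X, U) (X.presheaf.stalk x) (X.presheaf.stalk η) := by
    refine .of_algebraMap_eq fun a ↦ ?_
    have := X.presheaf.germ_stalkSpecializes hxU h
    exact (congrArg (fun f ↦ f.hom a) this).symm
  have hle : (hU.primeIdealOf ⟨x, hxU⟩).asIdeal.primeCompl ≤
      (hU.primeIdealOf ⟨η, hηU⟩).asIdeal.primeCompl := by
    intro a ha
    rw [← IsLocalization.AtPrime.isUnit_to_map_iff (X.presheaf.stalk x)] at ha
    rw [← IsLocalization.AtPrime.isUnit_to_map_iff (X.presheaf.stalk η)]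
    have := ha.map (algebraMap (X.presheaf.stalk x) (X.presheaf.stalk η))
    rwa [← IsScalarTower.algebraMap_apply] at this
  have h1 := IsLocalization.isLocalization_of_submonoid_le (X.presheaf.stalk x)
    (X.presheaf.stalk η) _ _ hle
  refine IsLocalization.of_le ((hU.primeIdealOf ⟨η, hηU⟩).asIdeal.primeCompl.map
    (algebraMap Γ(X, U) (X.presheaf.stalk x))) (primeOf h).primeCompl ?_ ?_
  · rintro _ ⟨a, ha, rfl⟩ hmem
    have h2 : IsUnit (algebraMap (X.presheaf.stalk x) (X.presheaf.stalk η)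
        (algebraMap Γ(X, U) (X.presheaf.stalk x) a)) := by
      rw [← IsScalarTower.algebraMap_apply]
      exact IsLocalization.map_units (X.presheaf.stalk η)
        (⟨a, ha⟩ : (hU.primeIdealOf ⟨η, hηU⟩).asIdeal.primeCompl)
    exact hmem h2
  · intro r hr
    by_contra hu
    exact hr hu

theorem ringKrullDim_stalk_eq_height {η x : X} (h : η ⤳ x) :
    ringKrullDim (X.presheaf.stalk η) = (primeOf h).height := by
  let _ := (X.presheaf.stalkSpecializes h).hom.toAlgebra
  have := isLocalization_stalk_of_specializes h
  exact IsLocalization.AtPrime.ringKrullDim_eq_height (primeOf h) _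

theorem ringKrullDim_stalk_le {η x : X} (h : η ⤳ x) :
    ringKrullDim (X.presheaf.stalk η) ≤ ringKrullDim (X.presheaf.stalk x) := by
  rw [ringKrullDim_stalk_eq_height h]
  exact Ideal.height_le_ringKrullDim_of_ne_top (Ideal.IsPrime.ne_top inferInstance)

/-- A generization of a surface point of codimension one is given by a prime element. -/
theorem exists_primeOf_eq_span [IsIntegral X] (hX : IsNonsingular X) {η x : X} (h : η ⤳ x)
    (hx : IsSurfacePoint x) (hη : ringKrullDim (X.presheaf.stalk η) = 1) :
    ∃ t, Prime t ∧ primeOf h = Ideal.span {t} := by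
  have := hX x
  obtain ⟨a, b, hab⟩ := IsRSP.exists_regular_of_isRegularLocalRing hx
  rw [ringKrullDim_stalk_eq_height h] at hη
  have hη : (primeOf h).height = 1 := by exact_mod_cast hη
  have hm : primeOf h ≠ maximalIdeal _ := by
    intro h0
    rw [h0, hab.height_eq] at hη
    norm_num at hη
  obtain ⟨t, ht⟩ := hab.exists_eq_span_singleton hm
  refine ⟨t, ?_, ht⟩
  have ht0 : t ≠ 0 := by
    rintro rfl
    rw [ht, Ideal.span_singleton_zero, Ideal.height_bot] at hη
    norm_num at hη
  rw [← Ideal.span_singleton_prime ht0, ← ht]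
  infer_instance

theorem ringKrullDim_stalk_eq_one [IsIntegral X] (hX : IsNonsingular X) {η x : X} (h : η ⤳ x)
    {t : X.presheaf.stalk x} (ht : Prime t) (hP : primeOf h = Ideal.span {t}) :
    ringKrullDim (X.presheaf.stalk η) = 1 := by
  have := hX x
  rw [ringKrullDim_stalk_eq_height h, hP]
  have h1 : (Ideal.span {t}).height ≤ 1 := Ideal.height_span_singleton_le_one
    ht.not_isUnit
  have h2 : (Ideal.span {t}).height ≠ 0 := by
    have hp : (Ideal.span {t}).IsPrime := (Ideal.span_singleton_prime ht.ne_zero).2 ht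
    rw [Ne, Ideal.height_eq_zero_iff_eq_bot]
    simpa using ht.ne_zero
  have h3 : (Ideal.span {t}).height = 1 := le_antisymm h1 (Order.one_le_iff_ne_zero.2 h2)
  rw [h3]
  rfl

variable (f : Y ⟶ X)

theorem stalkSpecializes_comp_stalkMap {η β : Y} (h : η ⤳ β) :
    (f.stalkMap η).hom.comp (X.presheaf.stalkSpecializes (f.base.hom.map_specializes h)).hom =
      (Y.presheaf.stalkSpecializes h).hom.comp (f.stalkMap β).hom := by
  have := Scheme.Hom.stalkSpecializes_stalkMap f η β h
  exact congrArg CommRingCat.Hom.hom this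

theorem comap_primeOf {η β : Y} (h : η ⤳ β) :
    (primeOf h).comap (f.stalkMap β).hom = primeOf (f.base.hom.map_specializes h) := by
  unfold primeOf
  rw [Ideal.comap_comap, ← stalkSpecializes_comp_stalkMap, ← Ideal.comap_comap]
  rw [IsLocalRing.maximalIdeal_comap]

end Specialization

/-! ### Tame ramification and admissible parameters -/

section TameAdmissible

theorem IsRSP.exists_of_associated {S : Type u} [CommRing S] [IsDomain S] {x y t : S}
    (h : IsRSP S x y) (ht : Associated x t) : IsRSP S t y := by
  obtain ⟨e, rfl⟩ := ht
  have := h.of_unit_combination (β := 0) e.isUnit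
  rwa [zero_mul, add_zero, mul_comm] at this

theorem IsRSP.eq_span_left {R : Type u} [CommRing R] [IsDomain R] [IsLocalRing R] {u v : R}
    (h : IsRSP R u v) {p : Ideal R} [hp : p.IsPrime] (hpm : p ≠ maximalIdeal R) (hu : u ∈ p) :
    p = Ideal.span {u} := by
  obtain ⟨s, hs⟩ := h.exists_eq_span_singleton hpm
  rw [hs, Ideal.span_singleton_eq_span_singleton]
  refine (h.prime_left.irreducible.dvd_iff.1 ?_).elim (fun hsu ↦ ?_) Associated.symm
  · rwa [← Ideal.mem_span_singleton, ← hs]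
  · exact (hp.ne_top (by rw [hs]; exact Ideal.span_singleton_eq_top.2 hsu)).elim

/-- A number bounding all multiplicities of prime factors. -/
theorem exists_pow_dvd_le {S : Type u} [CommRing S] [IsDomain S] [UniqueFactorizationMonoid S]
    {a : S} (ha : a ≠ 0) : ∃ N : ℕ, ∀ t, Prime t → ∀ n, t ^ n ∣ a → n ≤ N := by
  induction a using UniqueFactorizationMonoid.induction_on_prime with
  | h₁ => exact (ha rfl).elim
  | h₂ x hx =>
    refine ⟨0, fun t ht n hn ↦ ?_⟩
    by_contra h0
    exact ht.not_isUnit (isUnit_of_dvd_unit ((dvd_pow_self t (by omega)).trans hn) hx)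
  | h₃ a p ha0 hp ih =>
    obtain ⟨N, hN⟩ := ih ha0
    refine ⟨N + 1, fun t ht n hn ↦ ?_⟩
    rcases Nat.eq_zero_or_pos n with rfl | hn0
    · omega
    obtain ⟨m, rfl⟩ := Nat.exists_eq_succ_of_ne_zero hn0.ne'
    suffices h : t ^ m ∣ a by have := hN t ht m h; omega
    by_cases htp : t ∣ p
    · obtain ⟨e, rfl⟩ := (ht.dvd_prime_iff_associated hp).1 htp
      rw [Nat.succ_eq_add_one, pow_succ', mul_assoc, mul_dvd_mul_iff_left ht.ne_zero] at hn
      exact e.isUnit.dvd_mul_left.1 hn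
    · exact (pow_dvd_pow t m.le_succ).trans (ht.pow_dvd_of_dvd_mul_left _ htp hn)

variable {k : Type u} [Field k] {R S : Type u} [CommRing R] [CommRing S] [Algebra k R]
  [Algebra k S] [Algebra R S] [IsScalarTower k R S] {d₁ d₂ : Derivation k S S} [IsDomain S]
  {W V : Type u} [CommRing W] [CommRing V] [IsLocalRing W] [IsLocalRing V] [Algebra k W]
  [Algebra k V] [Algebra R W] [Algebra S V] [Algebra W V] [Algebra R V] [IsScalarTower k R W]
  [IsScalarTower k S V] [IsScalarTower k W V] [IsScalarTower R W V] [IsScalarTower R S V]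
  [IsLocalHom (algebraMap W V)] [IsLocalRing R] [IsDomain R] [IsLocalRing S]
  [IsLocalHom (algebraMap R S)] [Algebra.EssFiniteType k V]

/-- A curve of the critical divisor that lies over a branch curve is tamely ramified if and only if
some, and then every, pair of admissible parameters is optimal along it. -/
theorem IsFrame.isTame_iff_exists [WfDvdMonoid S] (hF : IsFrame d₁ d₂) {J : S}
    (hJ : IsJacobian (algebraMap R S) d₁ d₂ J) (hc : ∀ u v : R, IsRSP R u v → Coordinates k u v)
    {b : Prop} (hb : b) {I : Ideal R}
    (hI : ∃ u v, IsRSP R u v ∧ (I = Ideal.span {u} ∨ I = Ideal.span {u * v}))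
    (hIS : IsSNCIdeal (I.map (algebraMap R S))) {t : S} (ht : Prime t) {P : Ideal S} [P.IsPrime]
    [IsLocalization.AtPrime V P] (hP : P = Ideal.span {t}) {p : Ideal R} [p.IsPrime]
    [IsLocalization.AtPrime W p] (hPp : P.comap (algebraMap R S) = p) (hIp : I ≤ p)
    (hpm : p ≠ maximalIdeal R) :
    IsTame k (algebraMap W V) ↔ ∃ u v, IsAdmissiblePair b I u v ∧
      IsOptimal J t (algebraMap R S u) (algebraMap R S v) := by
  obtain ⟨y, hty⟩ : ∃ y, IsRSP S t y := by
    obtain ⟨x, y, hxy, m, n, hmn⟩ := hIS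
    have h1 : x ^ m * y ^ n ∈ P := by
      rw [← hPp, ← Ideal.map_le_iff_le_comap] at hIp
      exact hIp (hmn ▸ Ideal.mem_span_singleton_self _)
    rw [hP, Ideal.mem_span_singleton] at h1
    rcases ht.dvd_or_dvd h1 with h2 | h2
    · exact ⟨y, hxy.exists_of_associated
        ((ht.dvd_prime_iff_associated hxy.prime_left).1 (ht.dvd_of_dvd_pow h2)).symm⟩
    · exact ⟨x, hxy.symm.exists_of_associated
        ((ht.dvd_prime_iff_associated hxy.prime_right).1 (ht.dvd_of_dvd_pow h2)).symm⟩
  have key : ∀ u v, IsRSP R u v → u ∈ p → (IsTame k (algebraMap W V) ↔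
      IsOptimal J t (algebraMap R S u) (algebraMap R S v)) := by
    intro u v h hu
    rw [hF.isTame_iff_isOptimal h (hc u v h) hty hP (h.eq_span_left hpm hu) hPp
      (hJ.map_ne_zero_left h)]
    have ha := hJ.associated u v h
    exact ⟨fun ho ↦ ho.of_associated ha.symm, fun ho ↦ ho.of_associated ha⟩
  have key' : ∀ u v, IsRSP R u v → u * v ∈ p → (IsTame k (algebraMap W V) ↔
      IsOptimal J t (algebraMap R S u) (algebraMap R S v)) := by
    intro u v h huv
    rcases Ideal.IsPrime.mem_or_mem inferInstance huv with hu | hv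
    · exact key u v h hu
    · rw [key v u h.symm hv]
      exact ⟨fun ho ↦ ho.mono (mul_comm _ _).dvd, fun ho ↦ ho.mono (mul_comm _ _).dvd⟩
  have hmem : ∀ u v, (I = Ideal.span {u} ∨ I = Ideal.span {u * v}) → u * v ∈ p := by
    rintro u v (h | h)
    · exact Ideal.mul_mem_right _ _ (hIp (h ▸ Ideal.mem_span_singleton_self u))
    · exact hIp (h ▸ Ideal.mem_span_singleton_self _)
  constructor
  · intro hT
    obtain ⟨u, v, h, hI⟩ := hI
    exact ⟨u, v, ⟨h, fun _ ↦ hI⟩, (key' u v h (hmem u v hI)).1 hT⟩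
  · rintro ⟨u, v, ⟨h, hI⟩, ho⟩
    exact (key' u v h (hmem u v (hI hb))).2 ho

end TameAdmissible

/-! ### Differentials and dimension -/

section Dimension

open KaehlerDifferential

/-- The dimension of a regular local ring with algebraic residue field is at least the rank of the
differentials of its field of fractions. -/
theorem finrank_kaehlerDifferential_le_ringKrullDim (k : Type u) [Field k] [PerfectField k]
    {A : Type u} [CommRing A] [IsDomain A] [IsRegularLocalRing A] [Algebra k A]
    [Algebra.EssFiniteType k A] [Algebra.IsAlgebraic k (ResidueField A)] (L : Type u) [Field L]
    [Algebra k L] [Algebra A L] [IsScalarTower k A L] [IsFractionRing A L] :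
    (Module.finrank L (Ω[L⁄k]) : WithBot ℕ∞) ≤ ringKrullDim A := by
  have hgen : ((maximalIdeal A).generators).ncard = _ :=
    Submodule.FG.generators_ncard (maximalIdeal A).fg_of_isNoetherianRing
  have hfin := Submodule.FG.finite_generators (maximalIdeal A).fg_of_isNoetherianRing
  have hs : Ideal.span ((maximalIdeal A).generators) = maximalIdeal A :=
    Submodule.span_generators _
  have htop := span_D_eq_top k hs
  set s := (maximalIdeal A).generators
  have hL : Submodule.span L ((fun a ↦ D k L (algebraMap A L a)) '' s) = ⊤ := by
    rw [eq_top_iff, ← span_range_map_derivation_of_isLocalization k A L (nonZeroDivisors A),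
      Submodule.span_le]
    rintro _ ⟨a, rfl⟩
    have ha : D k A a ∈ Submodule.span A (D k A '' s) := htop ▸ Submodule.mem_top
    change map k k A L (D k A a) ∈ _
    generalize D k A a = w at ha ⊢
    induction ha using Submodule.span_induction with
    | mem x hx =>
      obtain ⟨b, hb, rfl⟩ := hx
      rw [map_D]
      exact Submodule.subset_span ⟨b, hb, rfl⟩
    | zero => rw [map_zero]; exact zero_mem _
    | add x y _ _ hx hy => rw [map_add]; exact add_mem hx hy
    | smul c x _ hx =>
      rw [map_smul, ← algebraMap_smul L c]
      exact Submodule.smul_mem _ _ hx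
  have h1 := IsRegularLocalRing.spanFinrank_maximalIdeal (R := A)
  rw [← h1, ← hgen]
  have h2 : Module.finrank L (Ω[L⁄k]) ≤ s.ncard := by
    have hfi := hfin.image (fun a ↦ D k L (algebraMap A L a))
    have := hfi.fintype
    have h3 := finrank_span_le_card (R := L) ((fun a ↦ D k L (algebraMap A L a)) '' s)
    rw [hL, finrank_top, ← Set.ncard_eq_toFinset_card'] at h3
    exact h3.trans (Set.ncard_image_le hfin)
  exact_mod_cast h2

end Dimension

/-! ### Points of nonsingular surfaces -/

section Structure

variable {k : Type u} [Field k] {X Y : Scheme.{u}}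

theorem stalkSpecializes_comp_algebraMap (s : X ⟶ Spec (CommRingCat.of k)) {η x : X} (h : η ⤳ x) :
    (X.presheaf.stalkSpecializes h).hom.comp (stalkAlgebra s x).algebraMap =
      (stalkAlgebra s η).algebraMap := by
  have := X.presheaf.germ_stalkSpecializes (U := ⊤) (y := x) trivial h
  refine congrArg CommRingCat.Hom.hom (?_ : ((Scheme.ΓSpecIso (CommRingCat.of k)).inv ≫ s.appTop ≫
    X.presheaf.germ ⊤ x trivial) ≫ X.presheaf.stalkSpecializes h = _)
  rw [Category.assoc, Category.assoc, this]

theorem stalkMap_comp_algebraMap {sX : X ⟶ Spec (CommRingCat.of k)}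
    {sY : Y ⟶ Spec (CommRingCat.of k)} {f : Y ⟶ X} (h : f ≫ sX = sY) (y : Y) :
    (f.stalkMap y).hom.comp (stalkAlgebra sX (f y)).algebraMap =
      (stalkAlgebra sY y).algebraMap := by
  subst h
  have := Scheme.Hom.germ_stalkMap f ⊤ y trivial
  refine congrArg CommRingCat.Hom.hom (?_ : ((Scheme.ΓSpecIso (CommRingCat.of k)).inv ≫ sX.appTop ≫
    X.presheaf.germ ⊤ (f y) trivial) ≫ f.stalkMap y = (Scheme.ΓSpecIso (CommRingCat.of k)).inv ≫
    (f ≫ sX).appTop ≫ Y.presheaf.germ ⊤ y trivial)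
  rw [Category.assoc, Category.assoc, this, Scheme.Hom.comp_appTop, Category.assoc]
  rfl

/-- A nonsingular integral algebraic scheme with a function field of transcendence degree two. -/
structure IsNonsingularSurface [IsIntegral X] (s : X ⟶ Spec (CommRingCat.of k)) : Prop where
  algebraic : IsAlgebraicScheme s
  nonsingular : IsNonsingular X
  trdeg_eq_two :
    letI := stalkAlgebra s (genericPoint X)
    Algebra.trdeg k X.functionField = 2

variable [IsIntegral X] {s : X ⟶ Spec (CommRingCat.of k)}

theorem IsNonsingularSurface.isScalarTower (s : X ⟶ Spec (CommRingCat.of k)) (x : X) :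
    letI := stalkAlgebra s x
    letI := stalkAlgebra s (genericPoint X)
    IsScalarTower k (X.presheaf.stalk x) X.functionField := by
  let _ := stalkAlgebra s x
  let _ := stalkAlgebra s (genericPoint X)
  exact .of_algebraMap_eq' (stalkSpecializes_comp_algebraMap s
    ((genericPoint_spec X).specializes trivial)).symm

theorem IsNonsingularSurface.finrank_eq_two [PerfectField k] (hs : IsNonsingularSurface s) :
    letI := stalkAlgebra s (genericPoint X)
    Module.finrank X.functionField (Ω[X.functionField⁄k]) = 2 := by
  let _ := stalkAlgebra s (genericPoint X)
  have : Algebra.EssFiniteType k X.functionField := hs.algebraic.essFiniteType _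
  exact finrank_kaehlerDifferential_eq_two hs.trdeg_eq_two

theorem IsNonsingularSurface.ringKrullDim_le_two_and (hs : IsNonsingularSurface s) (x : X) :
    ringKrullDim (X.presheaf.stalk x) ≤ 2 ∧ (IsSurfacePoint x →
      letI := stalkAlgebra s x
      Algebra.IsAlgebraic k (ResidueField (X.presheaf.stalk x))) := by
  let _ := stalkAlgebra s x
  let _ := stalkAlgebra s (genericPoint X)
  have := IsNonsingularSurface.isScalarTower s x
  have := hs.algebraic.essFiniteType x
  refine ringKrullDim_le_two_and_isAlgebraic k fun n g hg ↦ ?_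
  have h1 : AlgebraicIndependent k (algebraMap (X.presheaf.stalk x) X.functionField ∘ g) :=
    hg.map' (f := IsScalarTower.toAlgHom k (X.presheaf.stalk x) X.functionField)
      (IsFractionRing.injective (X.presheaf.stalk x) X.functionField)
  have h2 := h1.lift_cardinalMk_le_trdeg
  rw [hs.trdeg_eq_two] at h2
  simpa using h2

theorem IsNonsingularSurface.isSurfacePoint_of_isAlgebraic [PerfectField k]
    (hs : IsNonsingularSurface s) (x : X)
    (h : letI := stalkAlgebra s x
      Algebra.IsAlgebraic k (ResidueField (X.presheaf.stalk x))) : IsSurfacePoint x := by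
  let _ := stalkAlgebra s x
  let _ := stalkAlgebra s (genericPoint X)
  have := IsNonsingularSurface.isScalarTower s x
  have := hs.algebraic.essFiniteType x
  have := hs.nonsingular x
  refine le_antisymm (hs.ringKrullDim_le_two_and x).1 ?_
  have := finrank_kaehlerDifferential_le_ringKrullDim k (A := X.presheaf.stalk x) X.functionField
  rwa [hs.finrank_eq_two] at this

theorem IsNonsingularSurface.coordinates [PerfectField k] (hs : IsNonsingularSurface s) {x : X}
    {u v : X.presheaf.stalk x} (h : IsRSP _ u v) :
    letI := stalkAlgebra s x
    Coordinates k u v := by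
  let _ := stalkAlgebra s x
  have := hs.algebraic.essFiniteType x
  have := (hs.ringKrullDim_le_two_and x).2 h.dim_eq_two
  exact h.coordinates

theorem IsNonsingularSurface.exists_isFrame [PerfectField k] (hs : IsNonsingularSurface s) {x : X}
    (hx : IsSurfacePoint x) :
    letI := stalkAlgebra s x
    ∃ d₁ d₂ : Derivation k (X.presheaf.stalk x) (X.presheaf.stalk x), IsFrame d₁ d₂ := by
  let _ := stalkAlgebra s x
  let _ := stalkAlgebra s (genericPoint X)
  have := IsNonsingularSurface.isScalarTower s x
  have := hs.algebraic.essFiniteType x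
  have := hs.nonsingular x
  have := (hs.ringKrullDim_le_two_and x).2 hx
  exact MonomialModel.exists_isFrame hx X.functionField hs.finrank_eq_two

theorem IsNonsingularSurface.exists_isRSP (hs : IsNonsingularSurface s) {x : X}
    (hx : IsSurfacePoint x) : ∃ u v, IsRSP (X.presheaf.stalk x) u v := by
  have := hs.nonsingular x
  exact IsRSP.exists_regular_of_isRegularLocalRing hx

/-- Surface points have no proper specializations. -/
theorem IsNonsingularSurface.eq_of_specializes (hs : IsNonsingularSurface s) {η x : X}
    (h : η ⤳ x) (hη : IsSurfacePoint η) : η = x := by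
  have hx : IsSurfacePoint x := le_antisymm (hs.ringKrullDim_le_two_and x).1
    (hη.ge.trans (ringKrullDim_stalk_le h))
  obtain ⟨u, v, huv⟩ := hs.exists_isRSP hx
  refine eq_of_primeOf_eq_maximalIdeal h ?_
  by_contra hne
  obtain ⟨t, ht⟩ := huv.exists_eq_span_singleton hne
  have h1 := ringKrullDim_stalk_eq_height h
  have := huv.isNoetherianRing
  have h2 : (primeOf h).height ≤ 1 := by
    rw [ht]
    refine Ideal.height_span_singleton_le_one ?_
    rw [← Ideal.span_singleton_eq_top, ← ht]
    exact Ideal.IsPrime.ne_top inferInstance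
  rw [hη] at h1
  have h3 : (2 : ℕ∞) = (primeOf h).height := WithBot.coe_injective h1
  rw [← h3] at h2
  norm_num at h2

theorem IsNonsingularSurface.isClosed_singleton (hs : IsNonsingularSurface s) {x : X}
    (hx : IsSurfacePoint x) : IsClosed ({x} : Set X) := by
  rw [← closure_eq_iff_isClosed]
  refine Set.Subset.antisymm (fun y hy ↦ ?_) subset_closure
  exact (hs.eq_of_specializes (specializes_iff_mem_closure.2 hy) hx).symm

/-- The local ring of a point other than the generic one has dimension one or two. -/
theorem IsNonsingularSurface.dim_eq_one_or_two (hs : IsNonsingularSurface s) {x : X}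
    (hx : x ≠ genericPoint X) :
    ringKrullDim (X.presheaf.stalk x) = 1 ∨ IsSurfacePoint x := by
  have h1 := (hs.ringKrullDim_le_two_and x).1
  have h0 : ringKrullDim (X.presheaf.stalk x) ≠ 0 := by
    intro h0
    have h : genericPoint X ⤳ x := (genericPoint_spec X).specializes trivial
    refine hx (eq_of_primeOf_eq_maximalIdeal h ?_).symm
    have := (ringKrullDimZero_iff_ringKrullDim_eq_zero).2 h0
    exact IsLocalRing.eq_maximalIdeal (Ideal.isMaximal_of_isPrime _)
  have h3 : 0 ≤ ringKrullDim (X.presheaf.stalk x) := ringKrullDim_nonneg_of_nontrivial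
  unfold IsSurfacePoint
  generalize ringKrullDim (X.presheaf.stalk x) = d at *
  induction d with
  | bot => simp at h3
  | coe d =>
    induction d with
    | top => exact absurd h1 (by decide)
    | coe d =>
      have h1 : d ≤ 2 := Nat.cast_le.1 (WithBot.coe_le_coe.1 h1)
      have h0 : d ≠ 0 := by exact_mod_cast h0
      interval_cases d
      · omega
      · exact Or.inl rfl
      · exact Or.inr rfl

end Structure

/-! ### Points of a model -/

section Model

variable {k : Type u} [Field k] {X Y : Scheme.{u}} [IsIntegral X] [IsIntegral Y]
  {sX : X ⟶ Spec (CommRingCat.of k)} {sY : Y ⟶ Spec (CommRingCat.of k)} {f : Y ⟶ X}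

theorem isField_stalk_of_eq_genericPoint {x : X} (hx : x = genericPoint X) :
    IsField (X.presheaf.stalk x) := by
  subst hx
  exact Field.toIsField X.functionField

theorem IsModel.isNonsingularSurface_target (hf : IsModel sX sY f) (hX : IsNonsingular X) :
    IsNonsingularSurface sX := ⟨hf.algebraic_target, hX, hf.trdeg_eq_two⟩

theorem trdeg_stalk_of_eq_genericPoint {x : X} (hx : x = genericPoint X)
    (h : letI := stalkAlgebra sX (genericPoint X); Algebra.trdeg k X.functionField = 2) :
    letI := stalkAlgebra sX x
    Algebra.trdeg k (X.presheaf.stalk x) = 2 := by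
  subst hx
  exact h

open Algebra in
theorem IsModel.isNonsingularSurface_source (hf : IsModel sX sY f) (hY : IsNonsingular Y) :
    IsNonsingularSurface sY := by
  refine ⟨hf.algebraic_source, hY, ?_⟩
  let _ := stalkAlgebra sY (genericPoint Y)
  let _ := stalkAlgebra sX (f (genericPoint Y))
  let _ := (isField_stalk_of_eq_genericPoint hf.map_genericPoint).toField
  let _ := (f.stalkMap (genericPoint Y)).hom.toAlgebra
  have : IsScalarTower k (X.presheaf.stalk (f (genericPoint Y))) Y.functionField :=
    .of_algebraMap_eq' (stalkMap_comp_algebraMap hf.comp_eq (genericPoint Y)).symm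
  have : Module.Finite (X.presheaf.stalk (f (genericPoint Y))) Y.functionField := hf.finite
  have : FaithfulSMul k (X.presheaf.stalk (f (genericPoint Y))) :=
    (faithfulSMul_iff_algebraMap_injective _ _).2 (algebraMap k _).injective
  have h1 := trdeg_add_eq k (X.presheaf.stalk (f (genericPoint Y))) (A := Y.functionField)
  rw [trdeg_stalk_of_eq_genericPoint hf.map_genericPoint hf.trdeg_eq_two, trdeg_eq_zero,
    add_zero] at h1
  exact h1.symm

theorem IsModel.isSurfacePoint_map [PerfectField k] (hf : IsModel sX sY f) (hX : IsNonsingular X)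
    (hY : IsNonsingular Y) {β : Y} (hβ : IsSurfacePoint β) : IsSurfacePoint (f β) := by
  refine (hf.isNonsingularSurface_target hX).isSurfacePoint_of_isAlgebraic _ ?_
  let _ := stalkAlgebra sY β
  let _ := stalkAlgebra sX (f β)
  have h1 : Algebra.IsAlgebraic k (ResidueField (Y.presheaf.stalk β)) :=
    ((hf.isNonsingularSurface_source hY).ringKrullDim_le_two_and β).2 hβ
  let g : ResidueField (X.presheaf.stalk (f β)) →ₐ[k] ResidueField (Y.presheaf.stalk β) :=
    { ResidueField.map (f.stalkMap β).hom with
      commutes' := fun c ↦ congrArg (residue _)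
        (congrArg (fun g ↦ g c) (stalkMap_comp_algebraMap hf.comp_eq β)) }
  exact Algebra.IsAlgebraic.of_injective g (ResidueField.map (f.stalkMap β).hom).injective

/-- A closed point over a surface point is a surface point, by the Nullstellensatz. -/
theorem IsModel.isSurfacePoint_of_isClosed [PerfectField k] (hf : IsModel sX sY f)
    (hX : IsNonsingular X) (hY : IsNonsingular Y) {y : Y} (hy : IsClosed ({y} : Set Y))
    (hfy : IsSurfacePoint (f y)) : IsSurfacePoint y := by
  have hsX := hf.isNonsingularSurface_target hX
  have := hf.proper
  refine (hf.isNonsingularSurface_source hY).isSurfacePoint_of_isAlgebraic _ ?_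
  have := isClosed_singleton_iff_isClosedImmersion.1 hy
  have h1 : LocallyOfFiniteType (Spec.map (f.residueFieldMap y) ≫ X.fromSpecResidueField (f y)) := by
    rw [Scheme.Hom.SpecMap_residueFieldMap_fromSpecResidueField]
    infer_instance
  have h2 : LocallyOfFiniteType (Spec.map (f.residueFieldMap y)) := locallyOfFiniteType_of_comp _
    (X.fromSpecResidueField (f y))
  rw [HasRingHomProperty.Spec_iff (P := @LocallyOfFiniteType)] at h2
  let _ := stalkAlgebra sY y
  let _ := stalkAlgebra sX (f y)
  let _ : Algebra (ResidueField (X.presheaf.stalk (f y))) (ResidueField (Y.presheaf.stalk y)) :=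
    (ResidueField.map (f.stalkMap y).hom).toAlgebra
  have h3 : Algebra.FiniteType (ResidueField (X.presheaf.stalk (f y)))
    (ResidueField (Y.presheaf.stalk y)) := h2
  have h4 := finite_of_finite_type_of_isJacobsonRing (ResidueField (X.presheaf.stalk (f y)))
    (ResidueField (Y.presheaf.stalk y))
  have h5 : Algebra.IsAlgebraic k (ResidueField (X.presheaf.stalk (f y))) :=
    (hsX.ringKrullDim_le_two_and _).2 hfy
  have h6 : IsScalarTower k (ResidueField (X.presheaf.stalk (f y)))
      (ResidueField (Y.presheaf.stalk y)) := .of_algebraMap_eq fun c ↦ congrArg (residue _)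
        (congrArg (fun g ↦ g c) (stalkMap_comp_algebraMap hf.comp_eq y)).symm
  exact Algebra.IsAlgebraic.trans k (ResidueField (X.presheaf.stalk (f y))) _

/-- A point whose image specializes to a surface point `α` specializes to a surface point
over `α`. -/
theorem IsModel.exists_specializes [PerfectField k] (hf : IsModel sX sY f) (hX : IsNonsingular X)
    (hY : IsNonsingular Y) {η : Y} {α : X} (hα : IsSurfacePoint α) (h : f η ⤳ α) :
    ∃ β, η ⤳ β ∧ f β = α ∧ IsSurfacePoint β := by
  have hsX := hf.isNonsingularSurface_target hX
  have := hf.proper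
  have := hf.algebraic_source.noetherian
  have h1 : IsClosed (f '' closure {η}) := f.isClosedMap _ isClosed_closure
  have h2 : α ∈ f '' closure {η} := h.mem_closed h1 ⟨η, subset_closure rfl, rfl⟩
  have h3 : IsClosed (closure {η} ∩ f ⁻¹' {α}) :=
    isClosed_closure.inter ((hsX.isClosed_singleton hα).preimage f.continuous)
  obtain ⟨β, ⟨hβ, hβα⟩, hβc⟩ := h3.exists_closed_singleton (by
    obtain ⟨y, hy, hyα⟩ := h2
    exact ⟨y, hy, hyα⟩)
  exact ⟨β, specializes_iff_mem_closure.2 hβ, hβα,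
    hf.isSurfacePoint_of_isClosed hX hY hβc (by rwa [hβα])⟩

theorem bijective_stalkSpecializes_of_eq {x x' : X} (h : x ⤳ x') (e : x = x') :
    Function.Bijective (X.presheaf.stalkSpecializes h).hom := by
  subst e
  rw [TopCat.Presheaf.stalkSpecializes_refl]
  exact Function.bijective_id

/-- A point over the generic point is itself generic: its local ring is integral over a field. -/
theorem IsModel.isField_stalk (hf : IsModel sX sY f) {y : Y} (hy : f y = genericPoint X) :
    IsField (Y.presheaf.stalk y) := by
  have h : genericPoint Y ⤳ y := (genericPoint_spec Y).specializes trivial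
  let _ := (f.stalkMap y).hom.toAlgebra
  have hinj : Function.Injective (Y.presheaf.stalkSpecializes h).hom :=
    IsFractionRing.injective (Y.presheaf.stalk y) Y.functionField
  have hint : Algebra.IsIntegral (X.presheaf.stalk (f y)) (Y.presheaf.stalk y) := by
    refine ⟨fun a ↦ ?_⟩
    let _ := (f.stalkMap (genericPoint Y)).hom.toAlgebra
    have : Module.Finite (X.presheaf.stalk (f (genericPoint Y)))
      (Y.presheaf.stalk (genericPoint Y)) := hf.finite
    obtain ⟨F, hF, hF0⟩ := Algebra.IsIntegral.isIntegral
      (R := X.presheaf.stalk (f (genericPoint Y))) ((Y.presheaf.stalkSpecializes h).hom a)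
    have hs : f (genericPoint Y) ⤳ f y := f.base.hom.map_specializes h
    have hsurj := (bijective_stalkSpecializes_of_eq hs
      (hf.map_genericPoint.trans hy.symm)).2
    obtain ⟨G, hG, -, hG'⟩ := Polynomial.lifts_and_degree_eq_and_monic (f := _)
      ((Polynomial.mem_lifts F).2 (Polynomial.map_surjective _ hsurj F)) hF
    refine ⟨G, hG', hinj ?_⟩
    rw [map_zero, ← hF0, ← hG, Polynomial.eval₂_map, Polynomial.hom_eval₂]
    congr 1
    exact (stalkSpecializes_comp_stalkMap f h).symm
  exact isField_of_isIntegral_of_isField' (isField_stalk_of_eq_genericPoint hy)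

theorem IsModel.map_ne_genericPoint (hf : IsModel sX sY f) {η : Y}
    (hη : ringKrullDim (Y.presheaf.stalk η) = 1) : f η ≠ genericPoint X := by
  intro h
  have := ringKrullDim_eq_zero_of_isField (hf.isField_stalk h)
  rw [hη] at this
  exact one_ne_zero this

end Model

/-! ### The branch locus -/

section Branch

variable {X Y : Scheme.{u}}

theorem mem_idealAt_iff {Z : Set X} {x : X} {r : X.presheaf.stalk x} :
    r ∈ idealAt Z x ↔ ∀ z ∈ Z, ∀ h : z ⤳ x, r ∈ primeOf h := by
  simp only [idealAt, Ideal.mem_iInf]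
  rfl

theorem idealAt_le_primeOf {Z : Set X} {z x : X} (hz : z ∈ Z) (h : z ⤳ x) :
    idealAt Z x ≤ primeOf h := fun _ hr ↦ mem_idealAt_iff.1 hr z hz h

theorem isRadical_idealAt (Z : Set X) (x : X) : (idealAt Z x).IsRadical := by
  rintro r ⟨n, hr⟩
  rw [mem_idealAt_iff] at hr ⊢
  exact fun z hz h ↦ Ideal.IsPrime.mem_of_pow_mem inferInstance n (hr z hz h)

theorem idealAt_le_maximalIdeal {Z : Set X} {x : X} (hx : x ∈ Z) :
    idealAt Z x ≤ maximalIdeal (X.presheaf.stalk x) :=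
  (idealAt_le_primeOf hx specializes_rfl).trans
    (IsLocalRing.le_maximalIdeal (Ideal.IsPrime.ne_top inferInstance))

variable {k : Type u} [Field k] [IsIntegral X] [IsIntegral Y]
  {sX : X ⟶ Spec (CommRingCat.of k)} {sY : Y ⟶ Spec (CommRingCat.of k)} {f : Y ⟶ X}

theorem IsModel.mem_branchLocus_of_specializes (hf : IsModel sX sY f) {z x : X}
    (hz : z ∈ branchLocus sY f) (h : z ⤳ x) : x ∈ branchLocus sY f := by
  have := hf.proper
  obtain ⟨y, ⟨η, hη, hy⟩, rfl⟩ := hz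
  have h1 : IsClosed (f '' closure {η}) := f.isClosedMap _ isClosed_closure
  obtain ⟨y', hy', rfl⟩ := h.mem_closed h1 ⟨y, hy.mem_closure, rfl⟩
  exact ⟨y', ⟨η, hη, specializes_iff_mem_closure.2 hy'⟩, rfl⟩

theorem map_mem_branchLocus {η : Y} (hη : IsComponent (divR sY f) η) : f η ∈ branchLocus sY f :=
  ⟨η, ⟨η, hη, specializes_rfl⟩, rfl⟩

end Branch

/-! ### The critical divisor near a point -/

section Critical

variable {k : Type u} [Field k] [PerfectField k] {X Y : Scheme.{u}} [IsIntegral X] [IsIntegral Y]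
  {sX : X ⟶ Spec (CommRingCat.of k)} {sY : Y ⟶ Spec (CommRingCat.of k)} {f : Y ⟶ X}

theorem isFractionRing_stalk_of_eq_genericPoint {x₀ x : X} (h₀ : x₀ = genericPoint X)
    (h : x₀ ⤳ x) :
    letI := (X.presheaf.stalkSpecializes h).hom.toAlgebra
    IsFractionRing (X.presheaf.stalk x) (X.presheaf.stalk x₀) := by
  subst h₀
  exact inferInstanceAs (IsFractionRing (X.presheaf.stalk x) X.functionField)

/-- Near a surface point, the critical divisor is the divisor of a Jacobian determinant. -/
theorem IsModel.exists_isJacobian (hf : IsModel sX sY f) (hX : IsNonsingular X)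
    (hY : IsNonsingular Y) {β : Y} (hβ : IsSurfacePoint β) :
    letI := stalkAlgebra sY β
    ∃ (d₁ d₂ : Derivation k (Y.presheaf.stalk β) (Y.presheaf.stalk β)) (J : Y.presheaf.stalk β),
      IsFrame d₁ d₂ ∧ IsJacobian (f.stalkMap β).hom d₁ d₂ J ∧
      (∃ u v, IsRSP (X.presheaf.stalk (f β)) u v ∧
        J = jac d₁ d₂ ((f.stalkMap β).hom u) ((f.stalkMap β).hom v)) ∧
      ∀ (η : Y) (h : η ⤳ β),
        (letI := stalkAlgebra sY η; jacobianIdeal k (f.stalkMap η).hom) =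
          Ideal.span {(Y.presheaf.stalkSpecializes h).hom J} := by
  have hsX := hf.isNonsingularSurface_target hX
  have hsY := hf.isNonsingularSurface_source hY
  let _ := stalkAlgebra sY β
  let _ := stalkAlgebra sX (f β)
  obtain ⟨d₁, d₂, hF⟩ := hsY.exists_isFrame hβ
  obtain ⟨u, v, huv⟩ := hsX.exists_isRSP (hf.isSurfacePoint_map hX hY hβ)
  let _ := (f.stalkMap β).hom.toAlgebra
  have : IsScalarTower k (X.presheaf.stalk (f β)) (Y.presheaf.stalk β) :=
    .of_algebraMap_eq' (stalkMap_comp_algebraMap hf.comp_eq β).symm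
  have hgen : genericPoint Y ⤳ β := (genericPoint_spec Y).specializes trivial
  have hgenX := f.base.hom.map_specializes hgen
  refine ⟨d₁, d₂, jac d₁ d₂ ((f.stalkMap β).hom u) ((f.stalkMap β).hom v), hF, ?_,
    ⟨u, v, huv, rfl⟩, ?_⟩
  · let _ := (isField_stalk_of_eq_genericPoint hf.map_genericPoint).toField
    let _ := (f.stalkMap (genericPoint Y)).hom.toAlgebra
    let _ := (X.presheaf.stalkSpecializes hgenX).hom.toAlgebra
    let _ := ((f.stalkMap (genericPoint Y)).hom.comp
      (X.presheaf.stalkSpecializes hgenX).hom).toAlgebra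
    have : IsFractionRing (X.presheaf.stalk (f β)) (X.presheaf.stalk (f (genericPoint Y))) :=
      isFractionRing_stalk_of_eq_genericPoint hf.map_genericPoint hgenX
    have : IsScalarTower (X.presheaf.stalk (f β)) (X.presheaf.stalk (f (genericPoint Y)))
      Y.functionField := .of_algebraMap_eq' rfl
    have : IsScalarTower (X.presheaf.stalk (f β)) (Y.presheaf.stalk β) Y.functionField :=
      .of_algebraMap_eq' (stalkSpecializes_comp_stalkMap f hgen)
    have : Algebra.IsSeparable (X.presheaf.stalk (f (genericPoint Y))) Y.functionField :=
      hf.separable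
    exact hF.isJacobian (X.presheaf.stalk (f (genericPoint Y))) Y.functionField
      (fun a b hab ↦ hsX.coordinates hab) huv
  · intro η h
    have hX' := f.base.hom.map_specializes h
    let _ := stalkAlgebra sY η
    let _ := stalkAlgebra sX (f η)
    let _ := stalkAlgebra sY (genericPoint Y)
    let _ := (f.stalkMap η).hom.toAlgebra
    let _ := (Y.presheaf.stalkSpecializes h).hom.toAlgebra
    let _ := (X.presheaf.stalkSpecializes hX').hom.toAlgebra
    let _ := ((f.stalkMap η).hom.comp (X.presheaf.stalkSpecializes hX').hom).toAlgebra
    have : IsScalarTower k (X.presheaf.stalk (f β)) (X.presheaf.stalk (f η)) :=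
      .of_algebraMap_eq' (stalkSpecializes_comp_algebraMap sX hX').symm
    have : IsScalarTower k (Y.presheaf.stalk β) (Y.presheaf.stalk η) :=
      .of_algebraMap_eq' (stalkSpecializes_comp_algebraMap sY h).symm
    have : IsScalarTower k (X.presheaf.stalk (f η)) (Y.presheaf.stalk η) :=
      .of_algebraMap_eq' (stalkMap_comp_algebraMap hf.comp_eq η).symm
    have : IsScalarTower (X.presheaf.stalk (f β)) (X.presheaf.stalk (f η)) (Y.presheaf.stalk η) :=
      .of_algebraMap_eq' rfl
    have : IsScalarTower (X.presheaf.stalk (f β)) (Y.presheaf.stalk β) (Y.presheaf.stalk η) :=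
      .of_algebraMap_eq' (stalkSpecializes_comp_stalkMap f h)
    have := IsNonsingularSurface.isScalarTower sY η
    have : IsLocalization (primeOf h).primeCompl (Y.presheaf.stalk η) :=
      isLocalization_stalk_of_specializes h
    have : IsLocalization (primeOf hX').primeCompl (X.presheaf.stalk (f η)) :=
      isLocalization_stalk_of_specializes hX'
    exact hF.jacobianIdeal_eq Y.functionField hsY.finrank_eq_two (hsX.coordinates huv)
      (primeOf hX').primeCompl (primeOf h).primeCompl

end Critical

/-! ### Unramifiedness over the complement of the branch locus -/

section ValuationRing

/-- The localization of an integral closure at a prime ideal over a principal prime is a valuation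
ring. -/
theorem valuationRing_localization_integralClosure {R : Type u} (K : Type u) {L : Type u}
    [CommRing R] [IsDomain R] [IsNoetherianRing R] [IsIntegrallyClosed R] [Field K] [Field L]
    [Algebra R K] [IsFractionRing R K] [Algebra R L] [Algebra K L] [IsScalarTower R K L]
    [FiniteDimensional K L] [Algebra.IsSeparable K L] {π : R} (hπ : Prime π)
    (q : Ideal (integralClosure R L)) [q.IsPrime]
    (hq : q.comap (algebraMap R (integralClosure R L)) = Ideal.span {π}) :
    ValuationRing (Localization.AtPrime q) := by
  let C := integralClosure R L
  have : Module.Finite R C := IsIntegralClosure.finite R K L C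
  have : IsNoetherianRing C := .of_finite R _
  have hfrac : IsFractionRing C L := IsIntegralClosure.isFractionRing_of_finite_extension R K L C
  have hic : IsIntegrallyClosed C := integralClosure.isIntegrallyClosedOfFiniteExtension K
  let T := Localization.AtPrime q
  have : IsNoetherianRing T := IsLocalization.isNoetherianRing q.primeCompl T inferInstance
  have : IsIntegrallyClosed T :=
    isIntegrallyClosed_of_isLocalization T q.primeCompl q.primeCompl_le_nonZeroDivisors
  have hinj : Function.Injective (algebraMap R C) := by
    have h1 : Function.Injective (algebraMap R L) := by
      rw [IsScalarTower.algebraMap_eq R K L]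
      exact (algebraMap K L).injective.comp (IsFractionRing.injective R K)
    rw [IsScalarTower.algebraMap_eq R C L] at h1
    exact Function.Injective.of_comp (f := algebraMap C L) h1
  refine ((tfae_of_isNoetherianRing_of_isLocalRing_of_isDomain T).out 3 1 rfl rfl).1
    ⟨‹_›, fun P hP hPp ↦ ?_⟩
  have hmap : (P.comap (algebraMap C T)).map (algebraMap C T) = P :=
    IsLocalization.map_under q.primeCompl T P
  have hle : P.comap (algebraMap C T) ≤ q := by
    intro a ha
    by_contra haq
    refine hPp.ne_top (Ideal.eq_top_of_isUnit_mem _ ha ?_)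
    exact IsLocalization.map_units T (⟨a, haq⟩ : q.primeCompl)
  have hne : P.comap (algebraMap C T) ≠ ⊥ := by
    intro h
    rw [h, Ideal.map_bot] at hmap
    exact hP hmap.symm
  -- the contraction to `R` is a nonzero prime ideal inside `(π)`
  have hπP : π ∈ (P.comap (algebraMap C T)).comap (algebraMap R C) := by
    obtain ⟨a, ha, ha0⟩ := Submodule.exists_mem_ne_zero_of_ne_bot
      (Ideal.comap_ne_bot_of_integral_mem (R := R) (x := (Submodule.exists_mem_ne_zero_of_ne_bot hne).choose)
        (Submodule.exists_mem_ne_zero_of_ne_bot hne).choose_spec.2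
        (Submodule.exists_mem_ne_zero_of_ne_bot hne).choose_spec.1 (Algebra.IsIntegral.isIntegral _))
    obtain ⟨n, b, hb, rfl⟩ := WfDvdMonoid.max_power_factor ha0 hπ.irreducible
    have hpr : ((P.comap (algebraMap C T)).comap (algebraMap R C)).IsPrime := inferInstance
    rcases hpr.mem_or_mem ha with h | h
    · exact hpr.mem_of_pow_mem n h
    · refine (hb ?_).elim
      rw [← Ideal.mem_span_singleton, ← hq]
      exact hle h
  have heq : P.comap (algebraMap C T) = q := by
    by_contra hlt
    refine (Ideal.IsIntegral.comap_lt_comap (R := R) (lt_of_le_of_ne hle hlt)).not_ge ?_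
    rw [hq, Ideal.span_singleton_le_iff_mem]
    exact hπP
  rw [← hmap, heq, IsLocalization.AtPrime.map_eq_maximalIdeal q T]

theorem surjective_of_valuationRing {V O L : Type u} [CommRing V] [CommRing O] [Field L]
    [IsDomain V] [ValuationRing V] [Algebra V L] [IsFractionRing V L] [Algebra O L]
    (hO : Function.Injective (algebraMap O L)) (g : V →+* O) [IsLocalHom g]
    (hg : ∀ a, algebraMap O L (g a) = algebraMap V L a) : Function.Surjective g := by
  intro x
  rcases ValuationRing.isInteger_or_isInteger V (algebraMap O L x) with ⟨a, ha⟩ | ⟨a, ha⟩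
  · exact ⟨a, hO ((hg a).trans ha)⟩
  · by_cases hx : x = 0
    · exact ⟨0, by rw [map_zero, hx]⟩
    have hx' : algebraMap O L x ≠ 0 := fun h ↦ hx (hO (by rw [h, map_zero]))
    have h1 : g a * x = 1 := hO (by rw [map_mul, hg, ha, map_one, inv_mul_cancel₀ hx'])
    have h2 : IsUnit a := isUnit_of_map_unit g a (IsUnit.of_mul_eq_one _ h1)
    obtain ⟨e, rfl⟩ := h2
    refine ⟨((e⁻¹ : Vˣ) : V), ?_⟩
    calc g ((e⁻¹ : Vˣ) : V) = g ((e⁻¹ : Vˣ) : V) * (g e * x) := by rw [h1, mul_one]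
      _ = x := by rw [← mul_assoc, ← map_mul, Units.inv_mul, map_one, one_mul]

end ValuationRing

section Lift

variable {k : Type u} [Field k] {X Y : Scheme.{u}} [IsIntegral X] [IsIntegral Y]
  {sX : X ⟶ Spec (CommRingCat.of k)} {sY : Y ⟶ Spec (CommRingCat.of k)} {f : Y ⟶ X}

/-- The valuative criterion: a valuation ring of the function field of `Y` that dominates a point of
`X` dominates a point of `Y`. -/
theorem IsModel.exists_lift (hf : IsModel sX sY f) {α : X} (h₀ : f (genericPoint Y) ⤳ α)
    (O : Type u) [CommRing O] [IsDomain O] [ValuationRing O] [Algebra O Y.functionField]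
    [IsFractionRing O Y.functionField] (ρ : X.presheaf.stalk α →+* O)
    (hρ : ∀ r, algebraMap O Y.functionField (ρ r) =
      (f.stalkMap (genericPoint Y)).hom ((X.presheaf.stalkSpecializes h₀).hom r)) :
    ∃ η : Y, f η ⤳ α ∧ ∃ g : Y.presheaf.stalk η →+* O, IsLocalHom g ∧
      ∀ a, algebraMap O Y.functionField (g a) =
        algebraMap (Y.presheaf.stalk η) Y.functionField a := by
  have := hf.proper
  have hex : ValuativeCriterion.Existence f := by
    have : UniversallyClosed f := inferInstance
    rw [UniversallyClosed.eq_valuativeCriterion] at this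
    exact this.1
  let i₂ : Spec (.of O) ⟶ X := Spec.map (CommRingCat.ofHom ρ) ≫ X.fromSpecStalk α
  let i₁ : Spec (.of Y.functionField) ⟶ Y := Y.fromSpecStalk (genericPoint Y)
  have hsq : i₁ ≫ f = Spec.map (CommRingCat.ofHom (algebraMap O Y.functionField)) ≫ i₂ := by
    change Y.fromSpecStalk (genericPoint Y) ≫ f = _
    rw [← Scheme.SpecMap_stalkMap_fromSpecStalk,
      ← Scheme.SpecMap_stalkSpecializes_fromSpecStalk h₀]
    change _ = Spec.map _ ≫ Spec.map _ ≫ _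
    rw [← Spec.map_comp_assoc, ← Spec.map_comp_assoc]
    congr 2
    ext r
    exact (hρ r).symm
  obtain ⟨⟨⟨l, hl₁, hl₂⟩⟩⟩ := hex ⟨O, Y.functionField, i₁, i₂, ⟨hsq⟩⟩
  obtain ⟨l, hl₁, hl₂⟩ : ∃ l : Spec (.of O) ⟶ Y,
      Spec.map (CommRingCat.ofHom (algebraMap O Y.functionField)) ≫ l = i₁ ∧ l ≫ f = i₂ :=
    ⟨l, hl₁, hl₂⟩
  refine ⟨l (closedPoint O), ?_, (Scheme.stalkClosedPointTo l).hom, inferInstance, fun a ↦ ?_⟩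
  · have h1 : f (l (closedPoint O)) = i₂ (closedPoint O) := by rw [← hl₂]; rfl
    have h2 : f (l (closedPoint O)) ∈ Set.range (X.fromSpecStalk α) := by
      rw [h1]; exact ⟨_, rfl⟩
    rwa [Scheme.range_fromSpecStalk] at h2
  · have h1 := Scheme.Spec_stalkClosedPointTo_fromSpecStalk l
    have hs : genericPoint Y ⤳ l (closedPoint O) := (genericPoint_spec Y).specializes trivial
    have h2 := Scheme.SpecMap_stalkSpecializes_fromSpecStalk hs
    have h3 : Spec.map (Scheme.stalkClosedPointTo l ≫
        CommRingCat.ofHom (algebraMap O Y.functionField)) = Spec.map (Y.presheaf.stalkSpecializes hs) := by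
      rw [← cancel_mono (Y.fromSpecStalk (l (closedPoint O))), h2, Spec.map_comp, Category.assoc, h1,
        hl₁]
    exact congrArg (fun g ↦ g.hom a) (Spec.map_injective h3)

end Lift

section Unramified

variable {k : Type u} [Field k] {R S O : Type u} [CommRing R] [CommRing S] [CommRing O]
  [Algebra k R] [Algebra k S] [Algebra k O] [Algebra R S] [Algebra R O] [Algebra S O]
  [IsScalarTower k R O] [IsScalarTower k S O] [IsScalarTower R S O] {d₁ d₂ : Derivation k S S}

/-- A localization in which the Jacobian determinant becomes invertible is unramified. -/
theorem IsFrame.formallyUnramified (hF : IsFrame d₁ d₂) (N : Submonoid S) [IsLocalization N O]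
    {u v : R} (h : IsUnit (algebraMap S O (jac d₁ d₂ (algebraMap R S u) (algebraMap R S v)))) :
    Algebra.FormallyUnramified R O := by
  rw [Algebra.formallyUnramified_iff]
  let D : Derivation k O (Ω[O⁄R]) := (KaehlerDifferential.D R O).restrictScalars k
  have hR : ∀ r : R, D (algebraMap S O (algebraMap R S r)) = 0 := by
    intro r
    rw [← IsScalarTower.algebraMap_apply]
    exact Derivation.map_algebraMap (KaehlerDifferential.D R O) r
  have hD := hF.derivation_eq_zero N D (hR u) (hR v) h
  rw [← Submodule.subsingleton_iff O]
  refine subsingleton_of_bot_eq_top ?_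
  rw [← KaehlerDifferential.span_range_derivation R O, eq_comm, Submodule.span_eq_bot]
  rintro _ ⟨a, rfl⟩
  exact hD a

end Unramified

section Model

variable {k : Type u} [Field k] {X Y : Scheme.{u}} [IsIntegral X] [IsIntegral Y]
  {sX : X ⟶ Spec (CommRingCat.of k)} {sY : Y ⟶ Spec (CommRingCat.of k)} {f : Y ⟶ X}

/-- The prime divisor `t = 0` is a component of the critical divisor if and only if `t` divides the
Jacobian determinant. -/
theorem criticalOrder_ne_zero_iff {η β : Y} (h : η ⤳ β) [IsNoetherianRing (Y.presheaf.stalk β)]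
    {J t : Y.presheaf.stalk β}
    (hjac : (letI := stalkAlgebra sY η; jacobianIdeal k (f.stalkMap η).hom) =
      Ideal.span {(Y.presheaf.stalkSpecializes h).hom J})
    (hJ : J ≠ 0) (ht : Prime t) (hP : primeOf h = Ideal.span {t}) :
    criticalOrder sY f η ≠ 0 ↔ t ∣ J := by
  let _ := (Y.presheaf.stalkSpecializes h).hom.toAlgebra
  have : IsLocalization.AtPrime (Y.presheaf.stalk η) (primeOf h) :=
    isLocalization_stalk_of_specializes h
  obtain ⟨n, hn, hn'⟩ := exists_pow_dvd_and_not ht hJ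
  have h1 : criticalOrder sY f η = n := by
    rw [criticalOrder, hjac]
    exact idealOrder_span_algebraMap hP ht hn hn'
  rw [h1]
  constructor
  · exact fun h0 ↦ (dvd_pow_self t h0).trans hn
  · rintro hd rfl
    exact hn' (by simpa using hd)

variable [PerfectField k]

/-- Away from the branch locus, `Y` is unramified in codimension one over `X`. -/
theorem IsModel.isUnramifiedAt (hf : IsModel sX sY f) (hX : IsNonsingular X) (hY : IsNonsingular Y)
    {α : X} (hα : IsSurfacePoint α) (hB : α ∉ branchLocus sY f) (h₀ : f (genericPoint Y) ⤳ α) :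
    letI := ((f.stalkMap (genericPoint Y)).hom.comp (X.presheaf.stalkSpecializes h₀).hom).toAlgebra
    ∀ π : X.presheaf.stalk α, Prime π →
      ∀ q : Ideal (integralClosure (X.presheaf.stalk α) Y.functionField), ∀ [q.IsPrime],
      q.comap (algebraMap (X.presheaf.stalk α) _) = Ideal.span {π} →
        Algebra.IsUnramifiedAt (X.presheaf.stalk α) q := by
  have hsX := hf.isNonsingularSurface_target hX
  have hsY := hf.isNonsingularSurface_source hY
  let _ := ((f.stalkMap (genericPoint Y)).hom.comp (X.presheaf.stalkSpecializes h₀).hom).toAlgebra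
  intro π hπ q hq hqπ
  let R := X.presheaf.stalk α
  obtain ⟨a, b, hab⟩ := hsX.exists_isRSP hα
  have := hab.isNoetherianRing
  have := hab.uniqueFactorizationMonoid
  let C := integralClosure R Y.functionField
  let O := Localization.AtPrime q
  let _ := (isField_stalk_of_eq_genericPoint hf.map_genericPoint).toField
  let _ := (f.stalkMap (genericPoint Y)).hom.toAlgebra
  let _ := (X.presheaf.stalkSpecializes h₀).hom.toAlgebra
  have : IsFractionRing R (X.presheaf.stalk (f (genericPoint Y))) :=
    isFractionRing_stalk_of_eq_genericPoint hf.map_genericPoint h₀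
  have : IsScalarTower R (X.presheaf.stalk (f (genericPoint Y))) Y.functionField :=
    .of_algebraMap_eq' rfl
  have : FiniteDimensional (X.presheaf.stalk (f (genericPoint Y))) Y.functionField := hf.finite
  have : Algebra.IsSeparable (X.presheaf.stalk (f (genericPoint Y))) Y.functionField :=
    hf.separable
  have hval : ValuationRing O := valuationRing_localization_integralClosure
    (X.presheaf.stalk (f (genericPoint Y))) hπ q hqπ
  have hCL : IsFractionRing C Y.functionField :=
    IsIntegralClosure.isFractionRing_of_finite_extension R
      (X.presheaf.stalk (f (genericPoint Y))) _ C
  let _ : Algebra O Y.functionField := (IsLocalization.lift (M := q.primeCompl)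
    (g := algebraMap C Y.functionField) fun y ↦ by
      refine (map_ne_zero_iff _ (IsFractionRing.injective C Y.functionField)).2 ?_ |>.isUnit
      rintro h0
      exact y.2 (h0 ▸ zero_mem q)).toAlgebra
  have hCO : IsScalarTower C O Y.functionField :=
    .of_algebraMap_eq fun c ↦ (IsLocalization.lift_eq _ c).symm
  have hOL : IsFractionRing O Y.functionField :=
    .isFractionRing_of_isDomain_of_isLocalization q.primeCompl O Y.functionField
  have hinj : Function.Injective (algebraMap O Y.functionField) := IsFractionRing.injective _ _
  have hRO : ∀ r : R, algebraMap O Y.functionField (algebraMap R O r) =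
      (f.stalkMap (genericPoint Y)).hom ((X.presheaf.stalkSpecializes h₀).hom r) := by
    intro r
    rw [IsScalarTower.algebraMap_apply R C O, ← IsScalarTower.algebraMap_apply C O]
    rfl
  obtain ⟨η, hηα, g, hgl, hg⟩ := hf.exists_lift h₀ O (algebraMap R O) hRO
  have hgR : ∀ r : R, g ((f.stalkMap η).hom ((X.presheaf.stalkSpecializes hηα).hom r)) =
      algebraMap R O r := by
    intro r
    refine hinj ?_
    rw [hg, hRO]
    have hη : genericPoint Y ⤳ η := (genericPoint_spec Y).specializes trivial
    have h1 := congrArg (fun g ↦ g ((X.presheaf.stalkSpecializes hηα).hom r))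
      (stalkSpecializes_comp_stalkMap f hη)
    refine h1.symm.trans (congrArg (f.stalkMap (genericPoint Y)).hom ?_)
    exact congrArg (fun g ↦ g.hom r)
      (X.presheaf.stalkSpecializes_comp (f.base.hom.map_specializes hη) hηα)
  -- the image of `η` is the generic point of the curve `π = 0`
  have hpr : primeOf hηα = Ideal.span {π} := by
    rw [← hqπ]
    ext r
    have h1 : r ∈ q.comap (algebraMap R C) ↔ algebraMap R O r ∈ maximalIdeal O := by
      rw [IsScalarTower.algebraMap_apply R C O, IsLocalization.AtPrime.to_map_mem_maximal_iff O q]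
      rfl
    rw [h1, ← hgR, mem_maximalIdeal, mem_nonunits_iff, isUnit_map_iff g,
      isUnit_map_iff (f.stalkMap η).hom]
    rfl
  have hfη : ringKrullDim (X.presheaf.stalk (f η)) = 1 := ringKrullDim_stalk_eq_one hX hηα hπ hpr
  have hη : ringKrullDim (Y.presheaf.stalk η) = 1 := by
    refine (hsY.dim_eq_one_or_two ?_).resolve_right fun h ↦ ?_
    · rintro rfl
      have := ringKrullDim_eq_zero_of_isField (isField_stalk_of_eq_genericPoint hf.map_genericPoint)
      rw [hfη] at this
      exact one_ne_zero this
    · have := hf.isSurfacePoint_map hX hY h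
      rw [IsSurfacePoint, hfη] at this
      norm_num at this
  obtain ⟨β, hβ, rfl, hβs⟩ := hf.exists_specializes hX hY hα hηα
  let _ := stalkAlgebra sY β
  let _ := stalkAlgebra sX (f β)
  obtain ⟨d₁, d₂, J, hF, hJ, ⟨u, v, huv, rfl⟩, hjac⟩ := hf.exists_isJacobian hX hY hβs
  obtain ⟨t, ht, hPt⟩ := exists_primeOf_eq_span hY hβ hβs hη
  have : IsNoetherianRing (Y.presheaf.stalk β) :=
    (hsY.exists_isRSP hβs).choose_spec.choose_spec.isNoetherianRing
  have htJ := mt (criticalOrder_ne_zero_iff hβ (hjac η hβ) hJ.ne_zero ht hPt).2 fun hcr ↦ by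
    refine hB (hf.mem_branchLocus_of_specializes (map_mem_branchLocus (η := η) ?_) hηα)
    rw [IsComponent, divR, if_pos ⟨hη, hfη⟩]
    exact hcr
  let _ := (Y.presheaf.stalkSpecializes hβ).hom.toAlgebra
  have hloc : IsLocalization.AtPrime (Y.presheaf.stalk η) (primeOf hβ) :=
    isLocalization_stalk_of_specializes hβ
  have : IsNoetherianRing (Y.presheaf.stalk η) := by
    have := hY η
    infer_instance
  have hvη : ValuationRing (Y.presheaf.stalk η) :=
    ((tfae_of_isNoetherianRing_of_isLocalRing_of_isDomain (Y.presheaf.stalk η)).out 4 1 rfl rfl).1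
      ⟨_, maximalIdeal_eq_span_of_isLocalization hPt⟩
  have hbij : Function.Bijective g := by
    refine ⟨Function.Injective.of_comp (f := algebraMap O Y.functionField) ?_,
      surjective_of_valuationRing hinj g hg⟩
    rw [show algebraMap O Y.functionField ∘ g =
      algebraMap (Y.presheaf.stalk η) Y.functionField from funext hg]
    exact IsFractionRing.injective _ _
  let _ : Algebra (Y.presheaf.stalk β) O :=
    (g.comp (Y.presheaf.stalkSpecializes hβ).hom).toAlgebra
  let _ := (f.stalkMap β).hom.toAlgebra
  let _ : Algebra k O := ((algebraMap R O).comp (algebraMap k R)).toAlgebra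
  let e : Y.presheaf.stalk η ≃ₐ[Y.presheaf.stalk β] O :=
    AlgEquiv.ofBijective { g with commutes' := fun _ ↦ rfl } hbij
  have hlocO : IsLocalization (primeOf hβ).primeCompl O :=
    IsLocalization.isLocalization_of_algEquiv _ e
  have hSO : ∀ r : R, algebraMap R O r =
      g ((Y.presheaf.stalkSpecializes hβ).hom ((f.stalkMap β).hom r)) := by
    intro r
    rw [← hgR]
    exact congrArg g (congrArg (fun g ↦ g r) (stalkSpecializes_comp_stalkMap f hβ))
  have : IsScalarTower k R O := .of_algebraMap_eq' rfl
  have : IsScalarTower R (Y.presheaf.stalk β) O := .of_algebraMap_eq hSO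
  have : IsScalarTower k (Y.presheaf.stalk β) O := by
    refine .of_algebraMap_eq fun c ↦ (hSO _).trans ?_
    exact congrArg (algebraMap (Y.presheaf.stalk β) O)
      (congrArg (fun g ↦ g c) (stalkMap_comp_algebraMap hf.comp_eq β))
  refine hF.formallyUnramified (primeOf hβ).primeCompl (u := u) (v := v) ?_
  refine IsLocalization.map_units O (⟨_, ?_⟩ : (primeOf hβ).primeCompl)
  intro hmem
  rw [hPt] at hmem
  exact htJ (Ideal.mem_span_singleton.1 hmem)

theorem IsModel.pow_dvd_or_dvd_pow (hf : IsModel sX sY f) (hX : IsNonsingular X)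
    (hY : IsNonsingular Y) {β : Y} (hβ : IsSurfacePoint β) (hB : f β ∉ branchLocus sY f)
    {w v : X.presheaf.stalk (f β)} (h : IsRSP _ w v) {s : ℕ} (hs : 1 ≤ s)
    (hw : ∃ s₁ ∈ maximalIdeal (Y.presheaf.stalk β), ∃ s₂ ∈ maximalIdeal (Y.presheaf.stalk β),
      (f.stalkMap β).hom w = s₁ * s₂) :
    (f.stalkMap β).hom w ^ s ∣ (f.stalkMap β).hom v ∨
      (f.stalkMap β).hom v ∣ (f.stalkMap β).hom w ^ s := by
  have hsY := hf.isNonsingularSurface_source hY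
  have hgen : genericPoint Y ⤳ β := (genericPoint_spec Y).specializes trivial
  have h₀ := f.base.hom.map_specializes hgen
  obtain ⟨a, b, hab⟩ := hsY.exists_isRSP hβ
  have := hab.uniqueFactorizationMonoid
  let _ := ((f.stalkMap (genericPoint Y)).hom.comp (X.presheaf.stalkSpecializes h₀).hom).toAlgebra
  let _ := (isField_stalk_of_eq_genericPoint hf.map_genericPoint).toField
  let _ := (f.stalkMap (genericPoint Y)).hom.toAlgebra
  let _ := (X.presheaf.stalkSpecializes h₀).hom.toAlgebra
  let _ := (f.stalkMap β).hom.toAlgebra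
  have : IsLocalHom (algebraMap (X.presheaf.stalk (f β)) (Y.presheaf.stalk β)) :=
    inferInstanceAs (IsLocalHom (f.stalkMap β).hom)
  have : IsFractionRing (X.presheaf.stalk (f β)) (X.presheaf.stalk (f (genericPoint Y))) :=
    isFractionRing_stalk_of_eq_genericPoint hf.map_genericPoint h₀
  have : IsScalarTower (X.presheaf.stalk (f β)) (X.presheaf.stalk (f (genericPoint Y)))
    Y.functionField := .of_algebraMap_eq' rfl
  have : IsScalarTower (X.presheaf.stalk (f β)) (Y.presheaf.stalk β) Y.functionField :=
    .of_algebraMap_eq' (stalkSpecializes_comp_stalkMap f hgen)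
  have : FiniteDimensional (X.presheaf.stalk (f (genericPoint Y))) Y.functionField := hf.finite
  have : Algebra.IsSeparable (X.presheaf.stalk (f (genericPoint Y))) Y.functionField :=
    hf.separable
  exact IsRSP.pow_dvd_or_dvd_pow (S := Y.presheaf.stalk β)
    (K := X.presheaf.stalk (f (genericPoint Y))) (L := Y.functionField)
    (hf.isUnramifiedAt hX hY (hf.isSurfacePoint_map hX hY hβ) hB h₀) h hs hw

end Model

/-! ### Components of the critical divisor through a point -/

section Component

variable {k : Type u} [Field k] {X Y : Scheme.{u}} [IsIntegral X] [IsIntegral Y]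
  {sX : X ⟶ Spec (CommRingCat.of k)} {sY : Y ⟶ Spec (CommRingCat.of k)} {f : Y ⟶ X}

theorem isComponent_divR_iff {η : Y} : IsComponent (divR sY f) η ↔
    (ringKrullDim (Y.presheaf.stalk η) = 1 ∧ ringKrullDim (X.presheaf.stalk (f η)) = 1) ∧
      criticalOrder sY f η ≠ 0 := by
  rw [IsComponent, divR]
  split_ifs with h
  · simp [h]
  · simp [h]

theorem isComponent_divS_iff {η : Y} : IsComponent (divS sY f) η ↔
    (ringKrullDim (Y.presheaf.stalk η) = 1 ∧ IsSurfacePoint (f η)) ∧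
      criticalOrder sY f η ≠ 0 := by
  rw [IsComponent, divS]
  split_ifs with h
  · simp [h]
  · simp [h]

theorem exists_isAdmissible_iff {x x' : X} (h : x ⤳ x') (e : x = x')
    (p : X.presheaf.stalk x → X.presheaf.stalk x → Prop) :
    (∃ u v, IsAdmissible sY f x u v ∧ p u v) ↔ ∃ u v, IsAdmissible sY f x' u v ∧
      p ((X.presheaf.stalkSpecializes h).hom u) ((X.presheaf.stalkSpecializes h).hom v) := by
  subst e
  rw [TopCat.Presheaf.stalkSpecializes_refl]
  rfl

variable [PerfectField k]

theorem IsModel.primeOf_map_ne (hf : IsModel sX sY f) (hX : IsNonsingular X) (hY : IsNonsingular Y)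
    {η β : Y} (h : η ⤳ β) (hβ : IsSurfacePoint β)
    (hη : ringKrullDim (X.presheaf.stalk (f η)) = 1) :
    primeOf (f.base.hom.map_specializes h) ≠ maximalIdeal (X.presheaf.stalk (f β)) := by
  intro hm
  have h1 := eq_of_primeOf_eq_maximalIdeal (f.base.hom.map_specializes h) hm
  have h2 : IsSurfacePoint (f η) := by
    change IsSurfacePoint (f.base.hom η)
    rw [h1]
    exact hf.isSurfacePoint_map hX hY hβ
  rw [IsSurfacePoint, hη] at h2
  norm_num at h2

theorem primeOf_of_eq {x x' : X} (h : x ⤳ x') (e : x = x') :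
    primeOf h = maximalIdeal (X.presheaf.stalk x') := by
  subst e
  unfold primeOf
  rw [TopCat.Presheaf.stalkSpecializes_refl]
  exact Ideal.comap_id _

/-- The complexity of a contracted curve `t = 0` in terms of optimal admissible parameters. -/
theorem IsModel.complexity_nonneg_and_eq_zero_iff (hf : IsModel sX sY f) (hX : IsNonsingular X)
    (hY : IsNonsingular Y) {η β : Y} (h : η ⤳ β) (hβ : IsSurfacePoint β)
    (hη : IsComponent (divS sY f) η) {J t : Y.presheaf.stalk β}
    {d₁ d₂ : letI := stalkAlgebra sY β
      Derivation k (Y.presheaf.stalk β) (Y.presheaf.stalk β)}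
    (hJ : letI := stalkAlgebra sY β
      IsJacobian (f.stalkMap β).hom d₁ d₂ J)
    (hjac : (letI := stalkAlgebra sY η; jacobianIdeal k (f.stalkMap η).hom) =
      Ideal.span {(Y.presheaf.stalkSpecializes h).hom J})
    (ht : Prime t) (hP : primeOf h = Ideal.span {t}) :
    0 ≤ complexity sY f η ∧ complexity sY f η ≤ criticalOrder sY f η + 1 ∧
      (complexity sY f η = 0 ↔ ∃ u v, IsAdmissible sY f (f β) u v ∧
        IsOptimal J t ((f.stalkMap β).hom u) ((f.stalkMap β).hom v)) := by
  have hsX := hf.isNonsingularSurface_target hX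
  have hsY := hf.isNonsingularSurface_source hY
  have : IsNoetherianRing (Y.presheaf.stalk β) :=
    (hsY.exists_isRSP hβ).choose_spec.choose_spec.isNoetherianRing
  let _ := stalkAlgebra sY β
  let _ := (Y.presheaf.stalkSpecializes h).hom.toAlgebra
  have : IsLocalization.AtPrime (Y.presheaf.stalk η) (primeOf h) :=
    isLocalization_stalk_of_specializes h
  have hη' := isComponent_divS_iff.1 hη
  have hm := f.base.hom.map_specializes h
  have heq := hsX.eq_of_specializes hm hη'.1.2
  have hdiv : divS sY f η = criticalOrder sY f η := if_pos hη'.1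
  refine hJ.complexity_nonneg_and_eq_zero_iff hP ht (Adm := IsAdmissible sY f (f β))
    (fun u v huv ↦ huv.1) (V := Y.presheaf.stalk η) ?_ ?_
  · rw [criticalOrder, hjac]
    rfl
  · rw [complexity, hdiv]
    congr 3
    ext n
    refine (exists_isAdmissible_iff hm heq _).trans ?_
    refine exists_congr fun u ↦ exists_congr fun v ↦ and_congr_right fun _ ↦ ?_
    rw [← map_mul]
    have h1 := congrArg (fun g ↦ g (u * v)) (stalkSpecializes_comp_stalkMap f h)
    exact Eq.congr_right (congrArg (fun a ↦ idealOrder (Y.presheaf.stalk η) (Ideal.span {a})) h1)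

/-- Tame ramification along a component of `R_f` in terms of optimal admissible parameters. -/
theorem IsModel.isTame_iff (hf : IsModel sX sY f) (hX : IsNonsingular X)
    (hY : IsNonsingular Y) (hB : BranchSNC sY f) (hfB : PullbackBranchSNC sY f)
    {η β : Y} (h : η ⤳ β) (hβ : IsSurfacePoint β)
    (hη : IsComponent (divR sY f) η) {J t : Y.presheaf.stalk β}
    {d₁ d₂ : letI := stalkAlgebra sY β
      Derivation k (Y.presheaf.stalk β) (Y.presheaf.stalk β)}
    (hF : letI := stalkAlgebra sY β
      IsFrame d₁ d₂)
    (hJ : letI := stalkAlgebra sY β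
      IsJacobian (f.stalkMap β).hom d₁ d₂ J)
    (ht : Prime t) (hP : primeOf h = Ideal.span {t}) :
    IsTame k (f.stalkMap η).hom ↔ ∃ u v, IsAdmissible sY f (f β) u v ∧
        IsOptimal J t ((f.stalkMap β).hom u) ((f.stalkMap β).hom v) := by
  have hsX := hf.isNonsingularSurface_target hX
  have hsY := hf.isNonsingularSurface_source hY
  have hα := hf.isSurfacePoint_map hX hY hβ
  have : IsNoetherianRing (Y.presheaf.stalk β) :=
    (hsY.exists_isRSP hβ).choose_spec.choose_spec.isNoetherianRing
  have hη' := isComponent_divR_iff.1 hη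
  have hX' := f.base.hom.map_specializes h
  have hηB := map_mem_branchLocus hη
  have hb : f β ∈ branchLocus sY f := hf.mem_branchLocus_of_specializes hηB hX'
  let _ := stalkAlgebra sY β
  let _ := stalkAlgebra sX (f β)
  let _ := stalkAlgebra sY η
  let _ := stalkAlgebra sX (f η)
  let _ := (f.stalkMap β).hom.toAlgebra
  let _ := (f.stalkMap η).hom.toAlgebra
  let _ := (Y.presheaf.stalkSpecializes h).hom.toAlgebra
  let _ := (X.presheaf.stalkSpecializes hX').hom.toAlgebra
  let _ := ((f.stalkMap η).hom.comp (X.presheaf.stalkSpecializes hX').hom).toAlgebra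
  have : IsScalarTower k (X.presheaf.stalk (f β)) (Y.presheaf.stalk β) :=
    .of_algebraMap_eq' (stalkMap_comp_algebraMap hf.comp_eq β).symm
  have : IsScalarTower k (X.presheaf.stalk (f β)) (X.presheaf.stalk (f η)) :=
    .of_algebraMap_eq' (stalkSpecializes_comp_algebraMap sX hX').symm
  have : IsScalarTower k (Y.presheaf.stalk β) (Y.presheaf.stalk η) :=
    .of_algebraMap_eq' (stalkSpecializes_comp_algebraMap sY h).symm
  have : IsScalarTower k (X.presheaf.stalk (f η)) (Y.presheaf.stalk η) :=
    .of_algebraMap_eq' (stalkMap_comp_algebraMap hf.comp_eq η).symm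
  have : IsScalarTower (X.presheaf.stalk (f β)) (X.presheaf.stalk (f η)) (Y.presheaf.stalk η) :=
    .of_algebraMap_eq' rfl
  have : IsScalarTower (X.presheaf.stalk (f β)) (Y.presheaf.stalk β) (Y.presheaf.stalk η) :=
    .of_algebraMap_eq' (stalkSpecializes_comp_stalkMap f h)
  have : IsLocalization.AtPrime (Y.presheaf.stalk η) (primeOf h) :=
    isLocalization_stalk_of_specializes h
  have : IsLocalization.AtPrime (X.presheaf.stalk (f η)) (primeOf hX') :=
    isLocalization_stalk_of_specializes hX'
  have : IsLocalHom (algebraMap (X.presheaf.stalk (f β)) (Y.presheaf.stalk β)) :=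
    inferInstanceAs (IsLocalHom (f.stalkMap β).hom)
  have : IsLocalHom (algebraMap (X.presheaf.stalk (f η)) (Y.presheaf.stalk η)) :=
    inferInstanceAs (IsLocalHom (f.stalkMap η).hom)
  have : Algebra.EssFiniteType k (Y.presheaf.stalk η) := hsY.algebraic.essFiniteType η
  exact hF.isTame_iff_exists (R := X.presheaf.stalk (f β)) (S := Y.presheaf.stalk β)
    (W := X.presheaf.stalk (f η)) (V := Y.presheaf.stalk η) hJ (fun u v huv ↦ hsX.coordinates huv)
    (b := f β ∈ branchLocus sY f) hb
    (exists_of_isSNCIdeal (hB _ hα) (isRadical_idealAt _ _) (idealAt_le_maximalIdeal hb))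
    (hfB β hβ) ht hP (comap_primeOf f h) (idealAt_le_primeOf hηB hX')
    (hf.primeOf_map_ne hX hY h hβ hη'.1.2)

/-- The criterion for monomiality with the condition on complexities spelled out for each
component. -/
theorem IsModel.isMonomialAt_iff (hf : IsModel sX sY f) (hX : IsNonsingular X)
    (hY : IsNonsingular Y) (hB : BranchSNC sY f) (hfB : PullbackBranchSNC sY f)
    {β : Y} (hβ : IsSurfacePoint β) :
    IsMonomialAt sY f β ↔
      (∀ η : Y, IsComponent (divR sY f) η → η ⤳ β → IsTame k (f.stalkMap η).hom) ∧
        ∀ η : Y, IsComponent (divS sY f) η → η ⤳ β → complexity sY f η = 0 := by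
  have hsX := hf.isNonsingularSurface_target hX
  have hsY := hf.isNonsingularSurface_source hY
  have hα := hf.isSurfacePoint_map hX hY hβ
  obtain ⟨x, y, hxy⟩ := hsY.exists_isRSP hβ
  have := hxy.isNoetherianRing
  have := hxy.uniqueFactorizationMonoid
  let _ := stalkAlgebra sY β
  obtain ⟨d₁, d₂, J, hF, hJ, -, hjac⟩ := hf.exists_isJacobian hX hY hβ
  -- the prime factors of `J` and the components of the critical divisor
  have hcomp : ∀ t, Prime t → t ∣ J → ∃ (η : Y) (h : η ⤳ β), primeOf h = Ideal.span {t} ∧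
      (IsComponent (divR sY f) η ∨ IsComponent (divS sY f) η) := by
    intro t ht htJ
    have := (Ideal.span_singleton_prime ht.ne_zero).2 ht
    obtain ⟨η, h, hP⟩ := exists_primeOf_eq β (Ideal.span {t})
    have hη := ringKrullDim_stalk_eq_one hY h ht hP
    have hcr := (criticalOrder_ne_zero_iff h (hjac η h) hJ.ne_zero ht hP).2 htJ
    refine ⟨η, h, hP, ?_⟩
    rcases hsX.dim_eq_one_or_two (hf.map_ne_genericPoint hη) with h1 | h1
    · exact Or.inl (isComponent_divR_iff.2 ⟨⟨hη, h1⟩, hcr⟩)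
    · exact Or.inr (isComponent_divS_iff.2 ⟨⟨hη, h1⟩, hcr⟩)
  have hS : ∀ {η : Y} (h : η ⤳ β), IsComponent (divS sY f) η →
      (primeOf h).comap (f.stalkMap β).hom = maximalIdeal _ := by
    intro η h hη
    rw [comap_primeOf]
    exact primeOf_of_eq _ (hsX.eq_of_specializes (f.base.hom.map_specializes h)
      (isComponent_divS_iff.1 hη).1.2)
  have hRB : ∀ {η : Y} (h : η ⤳ β), IsComponent (divR sY f) η → f β ∈ branchLocus sY f :=
    fun h hη ↦ hf.mem_branchLocus_of_specializes (map_mem_branchLocus hη)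
      (f.base.hom.map_specializes h)
  have hmain := hJ.exists_form_iff hF (hsX.exists_isRSP hα) (b := f β ∈ branchLocus sY f)
    (I := idealAt (branchLocus sY f) (f β))
    (fun hb ↦ exists_of_isSNCIdeal (hB _ hα) (isRadical_idealAt _ _) (idealAt_le_maximalIdeal hb))
    (fun _ ↦ hfB β hβ)
    (fun hb t ht htJ a ha ↦ by
      obtain ⟨η, h, hP, hη⟩ := hcomp t ht htJ
      rw [← Ideal.mem_span_singleton, ← hP, ← Ideal.mem_comap]
      rcases hη with hη | hη
      · rw [comap_primeOf]
        exact idealAt_le_primeOf (map_mem_branchLocus hη) _ ha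
      · rw [hS h hη]
        exact idealAt_le_maximalIdeal hb ha)
    (fun hb t ht htJ a ha ↦ by
      obtain ⟨η, h, hP, hη⟩ := hcomp t ht htJ
      rw [← Ideal.mem_span_singleton, ← hP, ← Ideal.mem_comap]
      rcases hη with hη | hη
      · exact (hb (hRB h hη)).elim
      · rwa [hS h hη])
    (fun hb w v hwv s hs hw ↦ hf.pow_dvd_or_dvd_pow hX hY hβ hb hwv hs hw)
  refine Iff.trans hmain ⟨fun ho ↦ ⟨fun η hη h ↦ ?_, fun η hη h ↦ ?_⟩, ?_⟩
  · have hη' := isComponent_divR_iff.1 hη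
    obtain ⟨t, ht, hP⟩ := exists_primeOf_eq_span hY h hβ hη'.1.1
    have htJ := (criticalOrder_ne_zero_iff h (hjac η h) hJ.ne_zero ht hP).1 hη'.2
    exact (hf.isTame_iff hX hY hB hfB h hβ hη hF hJ ht hP).2 (ho t ht htJ)
  · have hη' := isComponent_divS_iff.1 hη
    obtain ⟨t, ht, hP⟩ := exists_primeOf_eq_span hY h hβ hη'.1.1
    have htJ := (criticalOrder_ne_zero_iff h (hjac η h) hJ.ne_zero ht hP).1 hη'.2
    exact (hf.complexity_nonneg_and_eq_zero_iff hX hY h hβ hη hJ (hjac η h) ht hP).2.2.2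
      (ho t ht htJ)
  · rintro ⟨h₁, h₂⟩ t ht htJ
    obtain ⟨η, h, hP, hη | hη⟩ := hcomp t ht htJ
    · exact (hf.isTame_iff hX hY hB hfB h hβ hη hF hJ ht hP).1 (h₁ η hη h)
    · exact (hf.complexity_nonneg_and_eq_zero_iff hX hY h hβ hη hJ (hjac η h) ht hP).2.2.1
        (h₂ η hη h)

/-- The complexity at a point vanishes if and only if those of all components through it do. -/
theorem IsModel.complexityAt_eq_zero_iff (hf : IsModel sX sY f) (hX : IsNonsingular X)
    (hY : IsNonsingular Y) {β : Y} (hβ : β ∈ supp (divS sY f)) :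
    complexityAt sY f β = 0 ↔
      ∀ η : Y, IsComponent (divS sY f) η → η ⤳ β → complexity sY f η = 0 := by
  have hsX := hf.isNonsingularSurface_target hX
  have hsY := hf.isNonsingularSurface_source hY
  obtain ⟨η₀, hη₀, h₀⟩ := hβ
  have hα : IsSurfacePoint (f β) := by
    have h1 := (isComponent_divS_iff.1 hη₀).1.2
    have h2 := hsX.eq_of_specializes (f.base.hom.map_specializes h₀) h1
    change IsSurfacePoint (f.base.hom η₀) at h1
    rwa [h2] at h1
  obtain ⟨β', hβ', -, hs⟩ := hf.exists_specializes hX hY hα (specializes_rfl (x := f β))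
  obtain ⟨x, y, hxy⟩ := hsY.exists_isRSP hs
  have := hxy.isNoetherianRing
  have := hxy.uniqueFactorizationMonoid
  let _ := stalkAlgebra sY β'
  obtain ⟨d₁, d₂, J, hF, hJ, -, hjac⟩ := hf.exists_isJacobian hX hY hs
  obtain ⟨N, hN⟩ := exists_pow_dvd_le hJ.ne_zero
  have hbd : ∀ η, IsComponent (divS sY f) η → η ⤳ β →
      0 ≤ complexity sY f η ∧ complexity sY f η ≤ N + 1 := by
    intro η hη h
    have h' := h.trans hβ'
    obtain ⟨t, ht, hP⟩ := exists_primeOf_eq_span hY h' hs (isComponent_divS_iff.1 hη).1.1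
    obtain ⟨h1, h2, -⟩ :=
      hf.complexity_nonneg_and_eq_zero_iff hX hY h' hs hη hJ (hjac η h') ht hP
    refine ⟨h1, h2.trans ?_⟩
    let _ := (Y.presheaf.stalkSpecializes h').hom.toAlgebra
    have : IsLocalization.AtPrime (Y.presheaf.stalk η) (primeOf h') :=
      isLocalization_stalk_of_specializes h'
    obtain ⟨n, hn, hn'⟩ := exists_pow_dvd_and_not ht hJ.ne_zero
    have h3 : criticalOrder sY f η = n := by
      rw [criticalOrder, hjac η h']
      exact idealOrder_span_algebraMap hP ht hn hn'
    have := hN t ht n hn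
    omega
  rw [complexityAt]
  set A : Set ℤ := {i | ∃ η : Y, IsComponent (divS sY f) η ∧ η ⤳ β ∧ i = complexity sY f η}
  have hA : A.Nonempty := ⟨_, η₀, hη₀, h₀, rfl⟩
  have hA' : BddAbove A := by
    refine ⟨N + 1, ?_⟩
    rintro _ ⟨η, hη, h, rfl⟩
    exact (hbd η hη h).2
  constructor
  · intro h0 η hη h
    exact le_antisymm (h0 ▸ le_csSup hA' ⟨η, hη, h, rfl⟩) (hbd η hη h).1
  · intro h0
    obtain ⟨η, hη, h, hi⟩ := Int.csSup_mem hA hA'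
    rw [hi, h0 η hη h]

end Component

end MonomialModel

end

open MonomialModel in
theorem proposition5 {k : Type u} [Field k] [PerfectField k] {X Y : Scheme.{u}}
    [IsIntegral X] [IsIntegral Y]
    (sX : X ⟶ Spec (CommRingCat.of k)) (sY : Y ⟶ Spec (CommRingCat.of k)) (f : Y ⟶ X)
    (hf : IsModel sX sY f) (hX : IsNonsingular X) (hY : IsNonsingular Y)
    (hB : BranchSNC sY f) (hfB : PullbackBranchSNC sY f) :
    (∀ β : Y, IsSurfacePoint β →
      (IsMonomialAt sY f β ↔
        (∀ η : Y, IsComponent (divR sY f) η → η ⤳ β → IsTame k (f.stalkMap η).hom) ∧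
        (β ∈ supp (divS sY f) → complexityAt sY f β = 0))) ∧
    (IsMonomial sY f ↔
      ∀ β : Y, IsSurfacePoint β →
        (∀ η : Y, IsComponent (divR sY f) η → η ⤳ β → IsTame k (f.stalkMap η).hom) ∧
        (β ∈ supp (divS sY f) → complexityAt sY f β = 0)) ∧
    ((∀ x : X, IsClosed ({x} : Set X) → IsSurfacePoint x) →
      (IsMonomial sY f ↔
        (∀ η : Y, IsComponent (divR sY f) η → IsTame k (f.stalkMap η).hom) ∧
        (∀ β : Y, β ∈ supp (divS sY f) → complexityAt sY f β = 0))) := by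
  have hsX := hf.isNonsingularSurface_target hX
  have hsY := hf.isNonsingularSurface_source hY
  have hlocal : ∀ β : Y, IsSurfacePoint β →
      (IsMonomialAt sY f β ↔
        (∀ η : Y, IsComponent (divR sY f) η → η ⤳ β → IsTame k (f.stalkMap η).hom) ∧
        (β ∈ supp (divS sY f) → complexityAt sY f β = 0)) := by
    intro β hβ
    rw [hf.isMonomialAt_iff hX hY hB hfB hβ]
    refine and_congr_right fun _ ↦ ⟨fun h hS ↦ (hf.complexityAt_eq_zero_iff hX hY hS).2 h, ?_⟩
    intro h η hη hηβ
    have hS : β ∈ supp (divS sY f) := ⟨η, hη, hηβ⟩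
    exact (hf.complexityAt_eq_zero_iff hX hY hS).1 (h hS) η hη hηβ
  have hglobal : IsMonomial sY f ↔
      ∀ β : Y, IsSurfacePoint β →
        (∀ η : Y, IsComponent (divR sY f) η → η ⤳ β → IsTame k (f.stalkMap η).hom) ∧
        (β ∈ supp (divS sY f) → complexityAt sY f β = 0) :=
    forall₂_congr hlocal
  refine ⟨hlocal, hglobal, fun hclosed ↦ hglobal.trans ⟨fun h ↦ ⟨fun η hη ↦ ?_, fun β hβ ↦ ?_⟩,
    fun h β hβ ↦ ⟨fun η hη _ ↦ h.1 η hη, h.2 β⟩⟩⟩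
  · -- the curve through `η` contains a surface point
    have := hf.algebraic_target.noetherian
    obtain ⟨α, hα, hαc⟩ := (isClosed_closure (s := ({f η} : Set X))).exists_closed_singleton
      ⟨_, subset_closure rfl⟩
    obtain ⟨β, hηβ, -, hβ⟩ := hf.exists_specializes hX hY (hclosed α hαc)
      (specializes_iff_mem_closure.2 hα)
    exact (h β hβ).1 η hη hηβ
  · rw [hf.complexityAt_eq_zero_iff hX hY hβ]
    intro η hη hηβ
    obtain ⟨β', hηβ', -, hβ'⟩ := hf.exists_specializes hX hY (isComponent_divS_iff.1 hη).1.2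
      (specializes_rfl (x := f η))
    have hS : β' ∈ supp (divS sY f) := ⟨η, hη, hηβ'⟩
    exact (hf.complexityAt_eq_zero_iff hX hY hS).1 ((h β' hβ').2 hS) η hη hηβ'
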